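/- There are universal constants $C_0>0$ and $\epsilon_0>0$ such that for every $C\ge C_0$ there is a (deterministic) learning algorithm with the following property. Let $d,k\ge 1$ be integers, let $0<\epsilon\le\epsilon_0$, and put $N=\lceil (dk/\epsilon)^{Ck}\rceil$. Let $w_1,\dots,w_k\in\mathbb{R}$ with $\sum_{i=1}^k|w_i|\le 1$, let $v_1,\dots,v_k\in\mathbb{R}^d$ be unit vectors, and let $F:\mathbb{R}^d\to\mathbb{R}$ be given by $F(x)=\sum_{i=1}^k w_i\,\mathrm{ReLU}(v_i\cdot x)$, where $\mathrm{ReLU}(t)=\max\{0,t\}$. Given $d,k,N,\epsilon$ and $N$ labelled samples $(X_j,F(X_j))$, where $X_1,\dots,X_N$ are independent with distribution $N(0,I_d)$, the algorithm runs in time $\mathrm{poly}(N)$ and outputs a hypothesis representing a function $\tilde F:\mathbb{R}^d\to\mathbb{R}$, which can be evaluated at any given point in time $\mathrm{poly}(N)$, such that with probability at least $9/10$ over the samples $$\|\tilde F(X)-F(X)\|_{2}=\Bigl(\mathbf{E}_{X\sim N(0,I_d)}\bigl[(\tilde F(X)-F(X))^2\bigr]\Bigr)^{1/2}\le\epsilon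 .$$ Here the polynomial depends only on $C$. The algorithm is a pair of fixed finite programs (one for learning, one for evaluating the hypothesis), not depending on $d,k,\epsilon$, the network or the samples, for a real RAM: natural-number cells with addition, truncated subtraction, comparison and indirect addressing, and real cells with exact addition, subtraction, multiplication, division and comparison, each operation at unit cost. The running-time bounds hold for every sample and every evaluation point. -/

import Mathlib

open MeasureTheory ProbabilityTheory

/-! ## A real RAM

Programs are finite syntactic objects of a small imperative language.  Two kinds of memory are
available: natural-number cells (counters and addresses) and real cells.  Every memory is organised
in arrays; an array has a fixed name (a numeral of the program) and its cells are addressed by a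
row and a column, which are computed natural numbers (indirect addressing).

Natural numbers can be added, subtracted (truncated at zero) and compared; real numbers can be
added, subtracted, multiplied, divided and compared, exactly and at unit cost.  There is no
rounding of reals, no conversion from reals to natural numbers, and the only numerical constants
in a program are natural numbers. -/

namespace RealRAM

/-- Memory contents: `nat a i j` and `real a i j` are the cells in row `i` and column `j` of the
natural-number array, respectively the real array, with name `a`. -/
structure State where
  nat : ℕ → ℕ → ℕ → ℕ
  real : ℕ → ℕ → ℕ → ℝ

/-- Natural-number expressions. -/
inductive NatExp where
  | lit (n : ℕ)
  | cell (a : ℕ) (i j : NatExp)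
  | add (e f : NatExp)
  | sub (e f : NatExp)

/-- Real expressions. -/
inductive RealExp where
  | ofNat (e : NatExp)
  | cell (a : ℕ) (i j : NatExp)
  | add (e f : RealExp)
  | sub (e f : RealExp)
  | mul (e f : RealExp)
  | div (e f : RealExp)

/-- Tests: strict comparison of two natural numbers or of two reals. -/
inductive Test where
  | natLt (e f : NatExp)
  | realLt (e f : RealExp)

/-- Programs. -/
inductive Prog where
  | skip
  | setNat (a : ℕ) (i j : NatExp) (e : NatExp)
  | setReal (a : ℕ) (i j : NatExp) (e : RealExp)
  | seq (p q : Prog)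
  | ite (b : Test) (p q : Prog)
  | while (b : Test) (p : Prog)

/-- Value of a natural-number expression. -/
def NatExp.eval (σ : State) : NatExp → ℕ
  | lit n => n
  | cell a i j => σ.nat a (i.eval σ) (j.eval σ)
  | add e f => e.eval σ + f.eval σ
  | sub e f => e.eval σ - f.eval σ

/-- Number of elementary operations in a natural-number expression. -/
def NatExp.cost : NatExp → ℕ
  | lit _ => 1
  | cell _ i j => i.cost + j.cost + 1
  | add e f => e.cost + f.cost + 1
  | sub e f => e.cost + f.cost + 1

/-- Value of a real expression (the quotient by zero is zero). -/
noncomputable def RealExp.eval (σ : State) : RealExp → ℝ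
  | ofNat e => (e.eval σ : ℝ)
  | cell a i j => σ.real a (i.eval σ) (j.eval σ)
  | add e f => e.eval σ + f.eval σ
  | sub e f => e.eval σ - f.eval σ
  | mul e f => e.eval σ * f.eval σ
  | div e f => e.eval σ / f.eval σ

/-- Number of elementary operations in a real expression. -/
def RealExp.cost : RealExp → ℕ
  | ofNat e => e.cost + 1
  | cell _ i j => i.cost + j.cost + 1
  | add e f => e.cost + f.cost + 1
  | sub e f => e.cost + f.cost + 1
  | mul e f => e.cost + f.cost + 1
  | div e f => e.cost + f.cost + 1

/-- Truth of a test. -/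
def Test.holds (σ : State) : Test → Prop
  | natLt e f => e.eval σ < f.eval σ
  | realLt e f => e.eval σ < f.eval σ

/-- Number of elementary operations in a test. -/
def Test.cost : Test → ℕ
  | natLt e f => e.cost + f.cost + 1
  | realLt e f => e.cost + f.cost + 1

/-- Overwrite one natural-number cell. -/
def State.setNat (σ : State) (a i j n : ℕ) : State :=
  { σ with nat := fun a' i' j' => if a' = a ∧ i' = i ∧ j' = j then n else σ.nat a' i' j' }

/-- Overwrite one real cell. -/
noncomputable def State.setReal (σ : State) (a i j : ℕ) (r : ℝ) : State :=
  { σ with real := fun a' i' j' => if a' = a ∧ i' = i ∧ j' = j then r else σ.real a' i' j' }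

/-- `Exec p σ t τ`: started in the memory `σ`, the program `p` halts after exactly `t` elementary
steps with the memory `τ`. -/
inductive Exec : Prog → State → ℕ → State → Prop
  | skip (σ : State) : Exec .skip σ 1 σ
  | setNat (a : ℕ) (i j e : NatExp) (σ : State) :
      Exec (.setNat a i j e) σ (i.cost + j.cost + e.cost + 1)
        (σ.setNat a (i.eval σ) (j.eval σ) (e.eval σ))
  | setReal (a : ℕ) (i j : NatExp) (e : RealExp) (σ : State) :
      Exec (.setReal a i j e) σ (i.cost + j.cost + e.cost + 1)
        (σ.setReal a (i.eval σ) (j.eval σ) (e.eval σ))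
  | seq {p q : Prog} {σ τ υ : State} {s t : ℕ} (hp : Exec p σ s τ) (hq : Exec q τ t υ) :
      Exec (.seq p q) σ (s + t) υ
  | iteTrue {b : Test} {p q : Prog} {σ τ : State} {t : ℕ} (hb : b.holds σ) (hp : Exec p σ t τ) :
      Exec (.ite b p q) σ (b.cost + t) τ
  | iteFalse {b : Test} {p q : Prog} {σ τ : State} {t : ℕ} (hb : ¬ b.holds σ)
      (hq : Exec q σ t τ) : Exec (.ite b p q) σ (b.cost + t) τ
  | whileFalse {b : Test} {p : Prog} {σ : State} (hb : ¬ b.holds σ) :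
      Exec (.while b p) σ b.cost σ
  | whileTrue {b : Test} {p : Prog} {σ τ υ : State} {s t : ℕ} (hb : b.holds σ)
      (hp : Exec p σ s τ) (hw : Exec (.while b p) τ t υ) :
      Exec (.while b p) σ (b.cost + s + t) υ

/-- Execution is deterministic: the running time and the final memory are determined by the
program and the initial memory. -/
theorem Exec.deterministic {p : Prog} {σ τ : State} {t : ℕ} (h : Exec p σ t τ) :
    ∀ {t' : ℕ} {τ' : State}, Exec p σ t' τ' → t = t' ∧ τ = τ' := by
  induction h with
  | skip => intro _ _ h'; cases h'; exact ⟨rfl, rfl⟩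
  | setNat => intro _ _ h'; cases h'; exact ⟨rfl, rfl⟩
  | setReal => intro _ _ h'; cases h'; exact ⟨rfl, rfl⟩
  | seq _ _ ihp ihq =>
    intro _ _ h'
    cases h' with
    | seq hp' hq' =>
      obtain ⟨rfl, rfl⟩ := ihp hp'
      obtain ⟨rfl, rfl⟩ := ihq hq'
      exact ⟨rfl, rfl⟩
  | iteTrue hb _ ih =>
    intro _ _ h'
    cases h' with
    | iteTrue _ hp' => obtain ⟨rfl, rfl⟩ := ih hp'; exact ⟨rfl, rfl⟩
    | iteFalse hb' _ => exact absurd hb hb'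
  | iteFalse hb _ ih =>
    intro _ _ h'
    cases h' with
    | iteTrue hb' _ => exact absurd hb' hb
    | iteFalse _ hq' => obtain ⟨rfl, rfl⟩ := ih hq'; exact ⟨rfl, rfl⟩
  | whileFalse hb =>
    intro _ _ h'
    cases h' with
    | whileFalse _ => exact ⟨rfl, rfl⟩
    | whileTrue hb' _ _ => exact absurd hb' hb
  | whileTrue hb _ _ ihp ihw =>
    intro _ _ h'
    cases h' with
    | whileFalse hb' => exact absurd hb hb'
    | whileTrue _ hp' hw' =>
      obtain ⟨rfl, rfl⟩ := ihp hp'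
      obtain ⟨rfl, rfl⟩ := ihw hw'
      exact ⟨rfl, rfl⟩

end RealRAM

/-! ## Learning algorithms for real-valued functions on `ℝ^d` -/

/-- A learning algorithm consists of two programs.  The program `learn` is run on the parameters
and the labelled sample; the memory it leaves behind is the hypothesis that it outputs.  The
program `predict` evaluates a hypothesis at a given point.  Both programs are finite and do not
depend on the parameters, on the sample or on the point. -/
structure Learner where
  learn : RealRAM.Prog
  predict : RealRAM.Prog

namespace Learner

/-- The input of the program `learn`: the natural numbers `d`, `k`, `N` in row `0` of the
natural-number array `0`, the accuracy `ε` in the first cell of the real array `0`, the `j`-th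
sample point in row `j` of the real array `1` and its label in the first cell of row `j` of the
real array `2`.  All other cells are zero. -/
noncomputable def input (d k N : ℕ) (ε : ℝ) (S : Fin N → EuclideanSpace ℝ (Fin d) × ℝ) :
    RealRAM.State where
  nat a i j :=
    if a = 0 ∧ i = 0 then
      if j = 0 then d else if j = 1 then k else if j = 2 then N else 0
    else 0
  real a i j :=
    if a = 0 ∧ i = 0 ∧ j = 0 then ε
    else if a = 1 then
      if h : i < N ∧ j < d then (S ⟨i, h.1⟩).1 ⟨j, h.2⟩ else 0
    else if a = 2 ∧ j = 0 then
      if h : i < N then (S ⟨i, h⟩).2 else 0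
    else 0

/-- The input of the program `predict`: the memory `σ` left behind by `learn`, with the point `x`
written into the first `d` cells of row `0` of the real array `3`. -/
noncomputable def query {d : ℕ} (σ : RealRAM.State) (x : EuclideanSpace ℝ (Fin d)) :
    RealRAM.State where
  nat := σ.nat
  real a i j :=
    if h : a = 3 ∧ i = 0 ∧ j < d then x ⟨j, h.2.2⟩ else σ.real a i j

/-- `A.Outputs d k N ε S T f`: on the parameters `d`, `k`, `N`, `ε` and the labelled sample `S`,
the learning phase of `A` halts within `T` steps, and its output is a hypothesis that represents
the function `f`, i.e. for every point `x` the prediction phase halts within `T` steps with the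
value `f x` in the first cell of the real array `4`. -/
def Outputs (A : Learner) (d k N : ℕ) (ε : ℝ) (S : Fin N → EuclideanSpace ℝ (Fin d) × ℝ)
    (T : ℕ) (f : EuclideanSpace ℝ (Fin d) → ℝ) : Prop :=
  ∃ (σ : RealRAM.State) (t : ℕ), t ≤ T ∧ RealRAM.Exec A.learn (input d k N ε S) t σ ∧
    ∀ x : EuclideanSpace ℝ (Fin d), ∃ (τ : RealRAM.State) (s : ℕ), s ≤ T ∧
      RealRAM.Exec A.predict (query σ x) s τ ∧ τ.real 4 0 0 = f x

/-- The function output on a given sample is unique. -/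
theorem Outputs.unique {A : Learner} {d k N : ℕ} {ε : ℝ}
    {S : Fin N → EuclideanSpace ℝ (Fin d) × ℝ} {T T' : ℕ}
    {f f' : EuclideanSpace ℝ (Fin d) → ℝ} (h : A.Outputs d k N ε S T f)
    (h' : A.Outputs d k N ε S T' f') : f = f' := by
  obtain ⟨σ, t, -, hσ, hf⟩ := h
  obtain ⟨σ', t', -, hσ', hf'⟩ := h'
  obtain ⟨-, rfl⟩ := hσ.deterministic hσ'
  funext x
  obtain ⟨τ, s, -, hτ, hx⟩ := hf x
  obtain ⟨τ', s', -, hτ', hx'⟩ := hf' x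
  obtain ⟨-, rfl⟩ := hτ.deterministic hτ'
  rw [← hx, ← hx']

end Learner

/-- The rectified linear unit. -/
noncomputable def ReLU (t : ℝ) : ℝ := max 0 t

/-- The one-hidden-layer ReLU network `x ↦ ∑ i, w i * ReLU (v i ⬝ x)`. -/
noncomputable def reluNetwork {d k : ℕ} (w : Fin k → ℝ) (v : Fin k → EuclideanSpace ℝ (Fin d))
    (x : EuclideanSpace ℝ (Fin d)) : ℝ :=
  ∑ i, w i * ReLU (inner ℝ (v i) x)

/-!
# Learning one-hidden-layer ReLU networks from Gaussian samples

The function `F x = ∑ i, w i * ReLU (v i ⬝ x)` depends on `x` only through its projection to the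
span of the `k` directions `v i`. The algorithm finds a subspace that serves as well as this span,
and then performs a regression with low-degree polynomials in only `k` variables.

**What the data reveal.** The Hermite coefficient of `F` with multi-index `α + e b` is the `b`-th
coordinate of the vector `coefVec w v α`, which is a multiple of `∑ i, w i (v i) ^ α • v i` and
lies in the span of the `v i`. The multiple is the Hermite coefficient of degree `|α| + 1` of the
rectified linear unit, which is bounded away from zero in degree one and in even degrees
(`le_reluCoef_even_sq`) and vanishes in the other odd degrees (`reluCoef_odd`). Sample means over
the first half of the sample estimate all these vectors with `|α| ≤ 2 * k` up to a small error
`τ`.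

**The subspace.** Gram-Schmidt with pivoting on the longest residual, run for `k` rounds on the
estimated vectors, leaves residuals of norm at most `2 ^ (k + 1) * τ`
(`IsPivotedGramSchmidt.norm_res_final_le`), although the `v i` themselves may be arbitrarily badly
conditioned. Thus, if `z i` is the component of `v i` orthogonal to the span `U` of the pivots,
the tensors `∑ i, w i (v i) ^ ⊗ n ⊗ z i` are small for `n = 0` and for odd `n < 2 * k`. They are
then small for all odd `n`: moment tensors with `k` nodes are bounded by those of order less than
`k`, with a loss that is polynomial in the order (`sqrt_momentSq_le`), and this is applied to the
nodes `v i ⊗ v i`. Replacing each `v i` by its projection to `U` in the Hermite expansion of `F`,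
truncated at degree `l`, therefore changes little (`l2norm_ridgeSum_sub_projPartial_le`), while
the truncation itself costs `1 / √l` (`integral_ReLU_sub_partial_sq_le`). Consequently `F` is
close to its orthogonal projection onto the polynomials of degree at most `l` in each of the
pivots (`integral_ridgeSum_sub_boxProj_sq_le`).

**The hypothesis.** This projection is an integral against an explicit kernel, and the hypothesis
`netEst` replaces the integral by the mean over the second half of the sample, which is
independent of the pivots. As `|F x| ≤ ‖x‖`, its mean square error is at most
`(l + 1) ^ k * (2 * k * l + d)` divided by the number of samples. With Hermite polynomials in the
homogenised form `He n t s`, for which `s ^ (n / 2)` is built in, the kernel is a rational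
function of the data, so that no square roots are needed. Markov's inequality for the two sources
of randomness gives `measure_netEst_le`, and `exists_accuracy` checks that
`(d * k / ε) ^ (100 * k)` samples suffice.

**The programs.** The estimator is computed by programs `RealRAM.Cmd` whose loops run up to one of
the input parameters. Such programs have a denotation, translate to the real RAM
(`RealRAM.Cmd.exec_compile`), and take polynomial time (`RealRAM.Cmd.exists_cost_le`). The
multi-indices of degree at most `2 * k` are enumerated along the `d`-ary heap (`wordIndex`): they
all occur among the first `(d + 1) ^ (2 * k) ≤ N` positions.
-/

/-! ### Homogenised Hermite polynomials -/

/-- The homogenised probabilists' Hermite polynomials `He n t s = s ^ (n / 2) * He n (t / √s)`,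
which are polynomials in `t` and `s`.  For `s = 1` they are the usual Hermite polynomials and for
`s = 0` the monomials. -/
def He : ℕ → ℝ → ℝ → ℝ
  | 0, _, _ => 1
  | 1, t, _ => t
  | n + 2, t, s => t * He (n + 1) t s - (n + 1) * s * He n t s

lemma He_succ (n : ℕ) (t s : ℝ) : He (n + 1) t s = t * He n t s - n * s * He (n - 1) t s := by
  cases n with
  | zero => simp [He]
  | succ n => simp [He]

lemma He_zero_right (n : ℕ) (t : ℝ) : He n t 0 = t ^ n := by
  induction n with
  | zero => simp [He]
  | succ n ih => rw [He_succ, ih]; ring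

lemma He_smul (n : ℕ) (c t s : ℝ) : He n (c * t) (c ^ 2 * s) = c ^ n * He n t s := by
  induction n using Nat.strong_induction_on with
  | _ n ih =>
    match n with
    | 0 => simp [He]
    | 1 => simp [He]
    | n + 2 =>
      simp only [He]
      rw [ih (n + 1) (by omega), ih n (by omega)]
      ring

/-- The exponential generating function `exp (t y - s y² / 2)` of `He n t s`. -/
noncomputable def heSeries (t s : ℝ) : PowerSeries ℝ :=
  PowerSeries.mk fun n => He n t s / (n.factorial : ℝ)

lemma heSeries_derivative (t s : ℝ) :
    PowerSeries.derivative ℝ (heSeries t s) =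
      (PowerSeries.C t - PowerSeries.C s * PowerSeries.X) * heSeries t s := by
  ext n
  rw [PowerSeries.coeff_derivative, sub_mul, map_sub, mul_assoc, PowerSeries.coeff_C_mul,
    PowerSeries.coeff_C_mul]
  cases n with
  | zero => simp [heSeries, He]
  | succ n =>
    rw [PowerSeries.coeff_succ_X_mul]
    simp only [heSeries, PowerSeries.coeff_mk, He, Nat.factorial_succ]
    have : (n.factorial : ℝ) ≠ 0 := by positivity
    push_cast
    field_simp

/-- The linear differential equation of the generating function has a unique solution. -/
lemma eq_heSeries {φ : PowerSeries ℝ} {t s : ℝ} (h0 : PowerSeries.coeff 0 φ = 1)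
    (h : PowerSeries.derivative ℝ φ = (PowerSeries.C t - PowerSeries.C s * PowerSeries.X) * φ) :
    φ = heSeries t s := by
  have key : ∀ ψ : PowerSeries ℝ,
      PowerSeries.derivative ℝ ψ = (PowerSeries.C t - PowerSeries.C s * PowerSeries.X) * ψ →
      PowerSeries.coeff 0 ψ = 0 → ∀ n, PowerSeries.coeff n ψ = 0 := by
    intro ψ hψ hψ0 n
    induction n using Nat.strong_induction_on with
    | _ n ih =>
      match n with
      | 0 => exact hψ0
      | n + 1 =>
        have h1 := congrArg (PowerSeries.coeff n) hψ
        rw [PowerSeries.coeff_derivative, sub_mul, map_sub, mul_assoc, PowerSeries.coeff_C_mul,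
          PowerSeries.coeff_C_mul, ih n (by omega)] at h1
        have h2 : PowerSeries.coeff n (PowerSeries.X * ψ) = 0 := by
          cases n with
          | zero => simp
          | succ n => rw [PowerSeries.coeff_succ_X_mul]; exact ih n (by omega)
        rw [h2] at h1
        have h3 : (n : ℝ) + 1 ≠ 0 := by positivity
        simpa [h3] using h1
  ext n
  have := key (φ - heSeries t s) (by rw [map_sub, h, heSeries_derivative, mul_sub])
    (by rw [map_sub, h0]; simp [heSeries, He]) n
  rw [map_sub] at this
  linarith

lemma heSeries_add (t₁ t₂ s₁ s₂ : ℝ) :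
    heSeries (t₁ + t₂) (s₁ + s₂) = heSeries t₁ s₁ * heSeries t₂ s₂ := by
  symm
  apply eq_heSeries
  · simp [PowerSeries.coeff_mul, heSeries, He]
  · rw [Derivation.leibniz, heSeries_derivative, heSeries_derivative]
    simp only [smul_eq_mul, map_add]
    ring

lemma heSeries_sum {ι : Type*} (I : Finset ι) (t s : ι → ℝ) :
    heSeries (∑ i ∈ I, t i) (∑ i ∈ I, s i) = ∏ i ∈ I, heSeries (t i) (s i) := by
  classical
  induction I using Finset.induction_on with
  | empty =>
    symm
    apply eq_heSeries <;> simp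
  | insert a I ha ih => rw [Finset.sum_insert ha, Finset.sum_insert ha, Finset.prod_insert ha,
      heSeries_add, ih]

/-- The addition formula for Hermite polynomials. -/
lemma He_sum {ι : Type*} [DecidableEq ι] (I : Finset ι) (t s : ι → ℝ) (n : ℕ) :
    He n (∑ i ∈ I, t i) (∑ i ∈ I, s i) =
      n.factorial * ∑ l ∈ I.finsuppAntidiag n,
        ∏ i ∈ I, (He (l i) (t i) (s i) / ((l i).factorial : ℝ)) := by
  have h := congrArg (PowerSeries.coeff n) (heSeries_sum I t s)
  rw [PowerSeries.coeff_prod] at h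
  simp only [heSeries, PowerSeries.coeff_mk] at h
  rw [← h]
  have : (n.factorial : ℝ) ≠ 0 := by positivity
  field_simp

/-- The Hermite polynomials as elements of `ℝ[X]`. -/
noncomputable def hePoly : ℕ → Polynomial ℝ
  | 0 => 1
  | 1 => Polynomial.X
  | n + 2 => Polynomial.X * hePoly (n + 1) - Polynomial.C ((n : ℝ) + 1) * hePoly n

lemma eval_hePoly (n : ℕ) (t : ℝ) : (hePoly n).eval t = He n t 1 := by
  induction n using Nat.strong_induction_on with
  | _ n ih =>
    match n with
    | 0 => simp [He, hePoly]
    | 1 => simp [He, hePoly]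
    | n + 2 =>
      simp only [He, hePoly, Polynomial.eval_sub, Polynomial.eval_mul, Polynomial.eval_X,
        Polynomial.eval_C]
      rw [ih (n + 1) (by omega), ih n (by omega)]
      ring

lemma hePoly_succ (n : ℕ) :
    hePoly (n + 1) = Polynomial.X * hePoly n - Polynomial.C (n : ℝ) * hePoly (n - 1) := by
  cases n with
  | zero => simp [hePoly]
  | succ n => simp [hePoly]

lemma derivative_hePoly (n : ℕ) :
    Polynomial.derivative (hePoly n) = Polynomial.C (n : ℝ) * hePoly (n - 1) := by
  induction n using Nat.strong_induction_on with
  | _ n ih =>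
    match n with
    | 0 => simp [hePoly]
    | 1 => simp [hePoly]
    | n + 2 =>
      simp only [hePoly, Polynomial.derivative_sub, Polynomial.derivative_mul,
        Polynomial.derivative_X, Polynomial.derivative_C]
      rw [ih (n + 1) (by omega), ih n (by omega)]
      have := hePoly_succ n
      simp only [Nat.add_sub_cancel, Nat.add_succ_sub_one]
      rw [this]
      push_cast
      simp only [map_add, map_one, map_ofNat]
      ring

/-- Every monomial is a linear combination of Hermite polynomials. -/
lemma X_pow_mem_span_hePoly (n : ℕ) :
    (Polynomial.X ^ n : Polynomial ℝ) ∈ Submodule.span ℝ (Set.range hePoly) := by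
  induction n with
  | zero => exact Submodule.subset_span ⟨0, by simp [hePoly]⟩
  | succ n ih =>
    have key : ∀ q ∈ Submodule.span ℝ (Set.range hePoly),
        Polynomial.X * q ∈ Submodule.span ℝ (Set.range hePoly) := by
      intro q hq
      induction hq using Submodule.span_induction with
      | mem x hx =>
        obtain ⟨m, rfl⟩ := hx
        have : Polynomial.X * hePoly m = hePoly (m + 1) + (m : ℝ) • hePoly (m - 1) := by
          rw [hePoly_succ, Polynomial.smul_eq_C_mul]; ring
        rw [this]
        exact add_mem (Submodule.subset_span ⟨_, rfl⟩)
          (Submodule.smul_mem _ _ (Submodule.subset_span ⟨_, rfl⟩))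
      | zero => simp
      | add x y _ _ hx hy => rw [mul_add]; exact add_mem hx hy
      | smul a x _ hx => rw [mul_smul_comm]; exact Submodule.smul_mem _ _ hx
    rw [pow_succ']
    exact key _ ih

/-! ### The one-dimensional Gaussian measure -/

/-- The standard Gaussian measure on the line. -/
noncomputable abbrev γ₁ : Measure ℝ := gaussianReal 0 1

/-- The density of the standard Gaussian measure. -/
noncomputable abbrev gdens (t : ℝ) : ℝ := gaussianPDFReal 0 1 t

lemma hasDerivAt_gdens (t : ℝ) : HasDerivAt gdens (-t * gdens t) t := by
  unfold gdens gaussianPDFReal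
  have h : HasDerivAt (fun x : ℝ => -(x - 0) ^ 2 / (2 * ((1 : NNReal) : ℝ))) (-t) t := by
    have h1 := ((((hasDerivAt_id t).sub_const 0).pow 2).neg).div_const (2 * ((1 : NNReal) : ℝ))
    refine h1.congr_deriv ?_
    simp only [id, NNReal.coe_one]
    ring
  refine ((h.exp).const_mul _).congr_deriv ?_
  ring

lemma integrable_polynomial_gaussian (p : Polynomial ℝ) : Integrable (fun t => p.eval t) γ₁ := by
  induction p using Polynomial.induction_on' with
  | add p q hp hq => simp only [Polynomial.eval_add]; exact hp.add hq
  | monomial n a =>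
    simp only [Polynomial.eval_monomial]
    refine Integrable.const_mul ?_ a
    rcases Nat.eq_zero_or_pos n with rfl | hn
    · simp
    · have := (memLp_id_gaussianReal' (μ := 0) (v := 1) (n : ENNReal)
        (ENNReal.natCast_ne_top n)).integrable_norm_pow hn.ne'
      refine this.mono' (by fun_prop) (Filter.Eventually.of_forall fun t => ?_)
      simp

lemma integrable_polynomial_mul_gdens (p : Polynomial ℝ) :
    Integrable (fun t => p.eval t * gdens t) := by
  have h := integrable_polynomial_gaussian p
  rw [γ₁, gaussianReal_of_var_ne_zero _ one_ne_zero,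
    integrable_withDensity_iff_integrable_smul₀'
      (measurable_gaussianPDF 0 1).aemeasurable
      (Filter.Eventually.of_forall fun _ => gaussianPDF_lt_top)] at h
  refine h.congr (Filter.Eventually.of_forall fun t => ?_)
  simp [gaussianPDF, mul_comm, gaussianPDFReal_nonneg]

lemma hasDerivAt_polynomial_mul_gdens (p : Polynomial ℝ) (t : ℝ) :
    HasDerivAt (fun t => p.eval t * gdens t)
      ((Polynomial.derivative p - Polynomial.X * p).eval t * gdens t) t := by
  refine ((p.hasDerivAt t).mul (hasDerivAt_gdens t)).congr_deriv ?_
  simp only [Polynomial.eval_sub, Polynomial.eval_mul, Polynomial.eval_X]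
  ring

lemma integral_gaussian_eq (f : ℝ → ℝ) : ∫ t, f t ∂γ₁ = ∫ t, f t * gdens t := by
  rw [integral_gaussianReal_eq_integral_smul one_ne_zero]
  simp [mul_comm]

/-- Gaussian integration by parts for polynomials. -/
lemma stein_polynomial (p : Polynomial ℝ) :
    ∫ t, t * p.eval t ∂γ₁ = ∫ t, (Polynomial.derivative p).eval t ∂γ₁ := by
  have h := integral_eq_zero_of_hasDerivAt_of_integrable
    (hasDerivAt_polynomial_mul_gdens p)
    (integrable_polynomial_mul_gdens _) (integrable_polynomial_mul_gdens _)
  rw [← integral_gaussian_eq] at h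
  simp only [Polynomial.eval_sub, Polynomial.eval_mul, Polynomial.eval_X] at h
  rw [integral_sub (integrable_polynomial_gaussian _)
    ((integrable_polynomial_gaussian (Polynomial.X * p)).congr
      (Filter.Eventually.of_forall fun t => by simp))] at h
  linarith

lemma integral_hePoly_succ_mul (n : ℕ) (p : Polynomial ℝ) :
    ∫ t, (hePoly (n + 1) * p).eval t ∂γ₁ =
      ∫ t, (hePoly n * Polynomial.derivative p).eval t ∂γ₁ := by
  have h := stein_polynomial (hePoly n * p)
  rw [Polynomial.derivative_mul, derivative_hePoly] at h
  have e : hePoly (n + 1) * p =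
      Polynomial.X * (hePoly n * p) - Polynomial.C (n : ℝ) * hePoly (n - 1) * p := by
    rw [hePoly_succ]; ring
  rw [e]
  simp only [Polynomial.eval_sub, Polynomial.eval_add] at h ⊢
  rw [integral_sub (integrable_polynomial_gaussian _) (integrable_polynomial_gaussian _)]
  rw [integral_add (integrable_polynomial_gaussian _) (integrable_polynomial_gaussian _)] at h
  have e2 : ∀ t : ℝ, (Polynomial.X * (hePoly n * p)).eval t = t * (hePoly n * p).eval t := by
    intro t; simp
  simp only [e2]
  rw [h]
  ring

/-- Orthogonality of the Hermite polynomials. -/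
lemma integral_He_mul_He (n m : ℕ) :
    ∫ t, He n t 1 * He m t 1 ∂γ₁ = if n = m then (n.factorial : ℝ) else 0 := by
  have e : ∀ n m, ∫ t, He n t 1 * He m t 1 ∂γ₁ = ∫ t, (hePoly n * hePoly m).eval t ∂γ₁ := by
    intro n m; simp [eval_hePoly]
  rw [e]
  induction n generalizing m with
  | zero =>
    cases m with
    | zero => simp [hePoly]
    | succ m => rw [mul_comm, integral_hePoly_succ_mul]; simp [hePoly]
  | succ n ih =>
    rw [integral_hePoly_succ_mul, derivative_hePoly, mul_left_comm]
    simp only [Polynomial.eval_mul (p := Polynomial.C _), Polynomial.eval_C]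
    rw [integral_const_mul, ih]
    cases m with
    | zero => simp
    | succ m =>
      simp only [Nat.add_sub_cancel, Nat.add_right_cancel_iff]
      split_ifs with h
      · subst h; rw [Nat.factorial_succ]; push_cast; ring
      · simp

lemma integrable_He_mul_He (n m : ℕ) : Integrable (fun t => He n t 1 * He m t 1) γ₁ := by
  simpa [eval_hePoly] using integrable_polynomial_gaussian (hePoly n * hePoly m)

lemma integral_sq_mul_He_sq (n : ℕ) :
    ∫ t, t ^ 2 * (He n t 1 * He n t 1) ∂γ₁ = n.factorial * (2 * n + 1) := by
  have e : ∀ t : ℝ, t ^ 2 * (He n t 1 * He n t 1) =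
      He (n + 1) t 1 * He (n + 1) t 1 + (2 * n) * (He (n + 1) t 1 * He (n - 1) t 1)
        + (n : ℝ) ^ 2 * (He (n - 1) t 1 * He (n - 1) t 1) := by
    intro t
    have : t * He n t 1 = He (n + 1) t 1 + n * He (n - 1) t 1 := by rw [He_succ]; ring
    calc _ = (t * He n t 1) ^ 2 := by ring
      _ = _ := by rw [this]; ring
  simp_rw [e]
  rw [integral_add, integral_add, integral_const_mul, integral_const_mul, integral_He_mul_He,
    integral_He_mul_He, integral_He_mul_He]
  · cases n with
    | zero => simp
    | succ n =>
      simp only [Nat.add_sub_cancel, if_true, Nat.factorial_succ]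
      rw [if_neg (by omega)]
      push_cast
      ring
  · exact integrable_He_mul_He _ _
  · exact (integrable_He_mul_He _ _).const_mul _
  · exact (integrable_He_mul_He _ _).add ((integrable_He_mul_He _ _).const_mul _)
  · exact (integrable_He_mul_He _ _).const_mul _

lemma integrable_sq_mul_He_sq (n : ℕ) :
    Integrable (fun t => t ^ 2 * (He n t 1 * He n t 1)) γ₁ := by
  refine (integrable_polynomial_gaussian (Polynomial.X ^ 2 * (hePoly n * hePoly n))).congr
    (Filter.Eventually.of_forall fun t => ?_)
  simp [eval_hePoly]

/-! ### The Hermite expansion of the rectified linear unit -/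

/-- The (unnormalised) Hermite coefficients of the rectified linear unit. -/
noncomputable def reluCoef (n : ℕ) : ℝ := ∫ t, ReLU t * He n t 1 ∂γ₁

lemma measurable_ReLU : Measurable ReLU := by unfold ReLU; fun_prop

lemma continuous_ReLU : Continuous ReLU := by unfold ReLU; fun_prop

lemma ReLU_nonneg (t : ℝ) : 0 ≤ ReLU t := le_max_left _ _

lemma abs_ReLU_le (t : ℝ) : |ReLU t| ≤ |t| := by
  rw [abs_of_nonneg (ReLU_nonneg t)]
  exact max_le (abs_nonneg t) (le_abs_self t)

lemma integral_ReLU_mul (p : Polynomial ℝ) :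
    ∫ t, ReLU t * p.eval t ∂γ₁ = ∫ t in Set.Ioi 0, (Polynomial.X * p).eval t * gdens t := by
  rw [integral_gaussian_eq, ← integral_indicator measurableSet_Ioi]
  congr 1
  ext t
  by_cases ht : 0 < t
  · rw [Set.indicator_of_mem (by exact ht)]
    simp [ReLU, max_eq_right ht.le]
  · rw [Set.indicator_of_notMem (by exact ht)]
    simp [ReLU, max_eq_left (not_lt.mp ht)]

/-- The boundary term that integration by parts leaves on the half line. -/
lemma integral_Ioi_derivative (p : Polynomial ℝ) :
    ∫ t in Set.Ioi 0, (Polynomial.derivative p - Polynomial.X * p).eval t * gdens t =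
      - (p.eval 0 * gdens 0) := by
  have h := integral_Ioi_of_hasDerivAt_of_tendsto (a := 0)
    (hasDerivAt_polynomial_mul_gdens p 0).continuousAt.continuousWithinAt
    (fun t _ => hasDerivAt_polynomial_mul_gdens p t)
    (integrable_polynomial_mul_gdens _).integrableOn
    (tendsto_zero_of_hasDerivAt_of_integrableOn_Ioi (a := 0)
      (fun t _ => hasDerivAt_polynomial_mul_gdens p t)
      (integrable_polynomial_mul_gdens _).integrableOn
      (integrable_polynomial_mul_gdens _).integrableOn)
  rw [h, zero_sub]

lemma integrable_ReLU_mul_polynomial (p : Polynomial ℝ) :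
    Integrable (fun t => ReLU t * p.eval t) γ₁ := by
  refine (integrable_polynomial_gaussian (Polynomial.X * p)).mono
    (measurable_ReLU.mul (by fun_prop)).aestronglyMeasurable
    (Filter.Eventually.of_forall fun t => ?_)
  rw [Polynomial.eval_mul, Polynomial.eval_X, norm_mul, norm_mul]
  exact mul_le_mul_of_nonneg_right (abs_ReLU_le t) (norm_nonneg _)

/-- The recursion of the Hermite coefficients; it holds because
`t (He (n + 2) t - (1 - n) He n t)` times the density is the derivative of `- t² He n t` times the
density. -/
lemma reluCoef_add_two (n : ℕ) : reluCoef (n + 2) = (1 - n) * reluCoef n := by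
  have h := integral_Ioi_derivative (Polynomial.X ^ 2 * hePoly n)
  have e : Polynomial.derivative (Polynomial.X ^ 2 * hePoly n) -
      Polynomial.X * (Polynomial.X ^ 2 * hePoly n) =
      Polynomial.X * (Polynomial.C (1 - (n : ℝ)) * hePoly n - hePoly (n + 2)) := by
    have h1 := hePoly_succ (n + 1)
    rw [Polynomial.derivative_mul, derivative_hePoly, h1, Nat.add_sub_cancel]
    have h2 := hePoly_succ n
    rw [h2]
    simp only [Polynomial.derivative_X_pow, map_sub, map_one, Nat.cast_add, map_add, Nat.cast_one,
      Nat.cast_ofNat, map_ofNat]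
    ring
  rw [e, ← integral_ReLU_mul] at h
  have e2 : ∀ t : ℝ, ReLU t *
      (Polynomial.C (1 - (n : ℝ)) * hePoly n - hePoly (n + 2)).eval t =
      (1 - n) * (ReLU t * (hePoly n).eval t) - ReLU t * (hePoly (n + 2)).eval t := by
    intro t; simp; ring
  simp_rw [e2] at h
  rw [integral_sub ((integrable_ReLU_mul_polynomial _).const_mul _)
    (integrable_ReLU_mul_polynomial _), integral_const_mul] at h
  simp only [reluCoef, ← eval_hePoly]
  simp at h
  linarith

lemma reluCoef_zero : reluCoef 0 = gdens 0 := by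
  have h := integral_Ioi_derivative 1
  have h2 := integral_ReLU_mul 1
  simp only [reluCoef, He]
  simp only [Polynomial.eval_one] at h2
  rw [h2]
  simp only [Polynomial.derivative_one, mul_one, zero_sub, Polynomial.eval_neg, neg_mul,
    Polynomial.eval_one, one_mul] at h ⊢
  rw [integral_neg] at h
  linarith

lemma reluCoef_one : reluCoef 1 = 1 / 2 := by
  have h2 := integral_ReLU_mul Polynomial.X
  simp only [Polynomial.eval_X] at h2
  simp only [reluCoef, He]
  have hsq : ∫ t, t * t ∂γ₁ = 1 := by
    have := integral_He_mul_He 1 1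
    simpa [He] using this
  have hint : Integrable (fun t => ReLU t * t) γ₁ :=
    (integrable_ReLU_mul_polynomial Polynomial.X).congr
      (Filter.Eventually.of_forall fun t => by simp)
  have hneg : ∫ t, ReLU (-t) * (-t) ∂γ₁ = ∫ t, ReLU t * t ∂γ₁ := by
    have hm : Measure.map (fun x : ℝ => -x) γ₁ = γ₁ := by
      rw [γ₁, gaussianReal_map_neg]; simp
    conv_rhs => rw [← hm]
    rw [integral_map (by fun_prop) (by
      exact (measurable_ReLU.mul measurable_id).aestronglyMeasurable)]
  have hsum : ∀ t : ℝ, t * t = ReLU t * t + ReLU (-t) * (-t) := by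
    intro t
    unfold ReLU
    rcases le_total 0 t with h | h
    · rw [max_eq_right h, max_eq_left (by linarith)]; ring
    · rw [max_eq_left h, max_eq_right (by linarith)]; ring
  have hint' : Integrable (fun t => ReLU (-t) * (-t)) γ₁ := by
    have : (fun t => ReLU (-t) * (-t)) = fun t => t * t - ReLU t * t := by
      ext t; rw [hsum t]; ring
    rw [this]
    refine Integrable.sub ?_ hint
    refine (integrable_polynomial_gaussian (Polynomial.X * Polynomial.X)).congr
      (Filter.Eventually.of_forall fun t => by simp)
  rw [integral_congr_ae (Filter.Eventually.of_forall hsum), integral_add hint hint', hneg] at hsq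
  linarith

lemma reluCoef_odd (n : ℕ) : reluCoef (2 * n + 3) = 0 := by
  induction n with
  | zero => rw [show 2 * 0 + 3 = 1 + 2 from rfl, reluCoef_add_two]; simp
  | succ n ih => rw [show 2 * (n + 1) + 3 = (2 * n + 3) + 2 from by ring, reluCoef_add_two, ih,
      mul_zero]

lemma gdens_zero_sq : gdens 0 ^ 2 = 1 / (2 * Real.pi) := by
  unfold gdens gaussianPDFReal
  simp only [sub_self, NNReal.coe_one, mul_one]
  rw [mul_pow, inv_pow, Real.sq_sqrt (by positivity)]
  simp

/-- The Hermite coefficients of even degree stay away from zero, so that the corresponding moments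
of the directions of a network can be read off from its own Hermite coefficients. -/
lemma le_reluCoef_even_sq (n : ℕ) : 1 / 9 ≤ reluCoef (2 * n) ^ 2 := by
  have h0 : 1 / 9 ≤ reluCoef 0 ^ 2 := by
    rw [reluCoef_zero, gdens_zero_sq]
    have := Real.pi_lt_four
    have := Real.pi_pos
    gcongr
    linarith
  have h2 : reluCoef 2 = reluCoef 0 := by
    have := reluCoef_add_two 0; simpa using this
  have h : ∀ n : ℕ, 1 / 9 ≤ reluCoef (2 * n + 2) ^ 2 := by
    intro n
    induction n with
    | zero => rw [Nat.mul_zero, Nat.zero_add, h2]; exact h0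
    | succ n ih =>
      rw [show 2 * (n + 1) + 2 = (2 * n + 2) + 2 from by ring, reluCoef_add_two, mul_pow]
      have : (1 : ℝ) ≤ (1 - ((2 * n + 2 : ℕ) : ℝ)) ^ 2 := by
        push_cast
        nlinarith [(Nat.cast_nonneg n : (0 : ℝ) ≤ n)]
      nlinarith [sq_nonneg (reluCoef (2 * n + 2))]
  cases n with
  | zero => exact h0
  | succ n => exact h n

/-- The decay of the Hermite coefficients, which by Parseval's identity gives the rate at which the
partial sums converge. -/
lemma reluCoef_sq_le (n : ℕ) (hn : 1 ≤ n) :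
    reluCoef n ^ 2 / n.factorial * (n : ℝ) ^ 2 ≤ 1 := by
  induction n using Nat.strong_induction_on with
  | _ n ih =>
    match n with
    | 0 => omega
    | 1 => rw [reluCoef_one]; norm_num
    | 2 =>
      have h2 : reluCoef 2 = reluCoef 0 := by
        have := reluCoef_add_two 0; simpa using this
      rw [h2, reluCoef_zero, gdens_zero_sq]
      have := Real.pi_gt_three
      rw [div_div, div_mul_eq_mul_div, div_le_one (by positivity)]
      norm_num
      linarith
    | n + 3 =>
      have h := ih (n + 1) (by omega) (by omega)
      rw [show n + 3 = (n + 1) + 2 from rfl, reluCoef_add_two]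
      set c := reluCoef (n + 1)
      rw [show (n + 1 + 2).factorial = (n + 3) * ((n + 2) * (n + 1).factorial) from rfl]
      have hf : (0 : ℝ) < ((n + 1).factorial : ℝ) := by positivity
      push_cast at h ⊢
      have hc : c ^ 2 / ((n + 1).factorial : ℝ) ≤ 1 / ((n : ℝ) + 1) ^ 2 := by
        rw [le_div_iff₀ (by positivity)]; exact h
      have e : ((1 - ((n : ℝ) + 1)) * c) ^ 2 / ((n + 3) * ((n + 2) * ((n + 1).factorial : ℝ))) *
          ((n : ℝ) + 1 + 2) ^ 2 =
          c ^ 2 / ((n + 1).factorial : ℝ) * ((n : ℝ) ^ 2 * (n + 3) / (n + 2)) := by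
        field_simp
        ring
      rw [e]
      calc _ ≤ 1 / ((n : ℝ) + 1) ^ 2 * ((n : ℝ) ^ 2 * (n + 3) / (n + 2)) := by gcongr
        _ ≤ 1 := by
          rw [div_mul_div_comm, one_mul, div_le_one (by positivity)]
          nlinarith [(Nat.cast_nonneg n : (0 : ℝ) ≤ n)]

lemma reluCoef_sq_le_factorial (n : ℕ) : reluCoef n ^ 2 ≤ n.factorial := by
  rcases Nat.eq_zero_or_pos n with rfl | hn
  · rw [reluCoef_zero, gdens_zero_sq]
    have := Real.pi_gt_three
    rw [div_le_iff₀ (by positivity)]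
    simp
    linarith
  · have h := reluCoef_sq_le n hn
    have hf : (0 : ℝ) < (n.factorial : ℝ) := by positivity
    have hn' : (1 : ℝ) ≤ n := by exact_mod_cast hn
    have h1 : reluCoef n ^ 2 / n.factorial ≤ 1 := by
      have h2 : 0 ≤ reluCoef n ^ 2 / n.factorial := by positivity
      exact (le_mul_of_one_le_right h2 (one_le_pow₀ hn')).trans h
    rwa [div_le_one hf] at h1

lemma integral_mul_pow_eq_zero {g : ℝ → ℝ} (hg : MemLp g 2 γ₁)
    (h : ∀ n, ∫ t, g t * He n t 1 ∂γ₁ = 0) (n : ℕ) : ∫ t, g t * t ^ n ∂γ₁ = 0 := by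
  have hp : ∀ p : Polynomial ℝ, Integrable (fun t => g t * p.eval t) γ₁ := by
    intro p
    refine MemLp.integrable_mul (q := 2) hg ?_
    rw [memLp_two_iff_integrable_sq (by fun_prop)]
    refine (integrable_polynomial_gaussian (p ^ 2)).congr
      (Filter.Eventually.of_forall fun t => by simp)
  have key : ∀ q ∈ Submodule.span ℝ (Set.range hePoly), ∫ t, g t * q.eval t ∂γ₁ = 0 := by
    intro q hq
    induction hq using Submodule.span_induction with
    | mem x hx => obtain ⟨m, rfl⟩ := hx; simpa [eval_hePoly] using h m
    | zero => simp
    | add x y _ _ hx hy =>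
      simp only [Polynomial.eval_add, mul_add]
      rw [integral_add (hp _) (hp _), hx, hy, add_zero]
    | smul a x _ hx =>
      simp only [Polynomial.eval_smul, smul_eq_mul, mul_left_comm]
      rw [integral_const_mul, hx, mul_zero]
  simpa using key _ (X_pow_mem_span_hePoly n)

/-- Completeness of the Hermite polynomials: a square integrable function orthogonal to all of
them vanishes. The positive and the negative part of the function, times the Gaussian measure, have
entire moment generating functions with the same Taylor coefficients at zero. -/
lemma ae_eq_zero_of_integral_mul_He {g : ℝ → ℝ} (hg : MemLp g 2 γ₁)
    (h : ∀ n, ∫ t, g t * He n t 1 ∂γ₁ = 0) : g =ᵐ[γ₁] 0 := by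
  have hgi : Integrable g γ₁ := hg.integrable (by norm_num)
  obtain ⟨g', hg'm, hgg'⟩ := hg.1
  have hexp : ∀ s, MemLp (fun t => Real.exp (s * t)) 2 γ₁ := by
    intro s
    rw [memLp_two_iff_integrable_sq (by fun_prop)]
    refine (integrable_exp_mul_gaussianReal (2 * s)).congr
      (Filter.Eventually.of_forall fun t => ?_)
    simp only [← Real.exp_nat_mul]
    push_cast
    ring_nf
  have hi : ∀ s n, Integrable (fun t => g t * t ^ n) γ₁ ∧
      Integrable (fun t => g t * Real.exp (s * t)) γ₁ := by
    intro s n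
    refine ⟨MemLp.integrable_mul (q := 2) hg ?_, MemLp.integrable_mul (q := 2) hg (hexp s)⟩
    rw [memLp_two_iff_integrable_sq (by fun_prop)]
    refine (integrable_polynomial_gaussian (Polynomial.X ^ (2 * n))).congr
      (Filter.Eventually.of_forall fun t => ?_)
    simp [← pow_mul, mul_comm]
  let μ : (ℝ → ℝ) → Measure ℝ := fun f => γ₁.withDensity (fun t => ENNReal.ofReal (f t))
  have hμ : ∀ (f : ℝ → ℝ) (k : ℝ → ℝ), Measurable f → (∀ t, 0 ≤ f t) →
      ∫ t, k t ∂(μ f) = ∫ t, f t * k t ∂γ₁ := by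
    intro f k hf h0
    rw [integral_withDensity_eq_integral_toReal_smul (by fun_prop)
      (Filter.Eventually.of_forall fun _ => ENNReal.ofReal_lt_top)]
    simp [ENNReal.toReal_ofReal, h0]
  have hμi : ∀ (f : ℝ → ℝ) (k : ℝ → ℝ), Measurable f → (∀ t, 0 ≤ f t) →
      (Integrable k (μ f) ↔ Integrable (fun t => f t * k t) γ₁) := by
    intro f k hf h0
    rw [integrable_withDensity_iff_integrable_smul₀' (by fun_prop)
      (Filter.Eventually.of_forall fun _ => ENNReal.ofReal_lt_top)]
    simp [ENNReal.toReal_ofReal, h0]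
  have hg'm' : Measurable g' := hg'm.measurable
  let p : ℝ → ℝ := fun t => max (g' t) 0
  let q : ℝ → ℝ := fun t => max (-g' t) 0
  have hpm : Measurable p := by fun_prop
  have hqm : Measurable q := by fun_prop
  have hp0 : ∀ t, 0 ≤ p t := fun t => le_max_right _ _
  have hq0 : ∀ t, 0 ≤ q t := fun t => le_max_right _ _
  have hpq : ∀ t, p t - q t = g' t := by
    intro t; simp only [p, q]
    rcases le_total 0 (g' t) with h | h
    · rw [max_eq_left h, max_eq_right (by linarith)]; ring
    · rw [max_eq_right h, max_eq_left (by linarith)]; ring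
  have hple : ∀ t, |p t| ≤ |g' t| := by
    intro t; rw [abs_of_nonneg (hp0 t)]; exact max_le (le_abs_self _) (abs_nonneg _)
  have hqle : ∀ t, |q t| ≤ |g' t| := by
    intro t; rw [abs_of_nonneg (hq0 t)]; exact max_le (neg_le_abs _) (abs_nonneg _)
  have hdom : ∀ (f k : ℝ → ℝ), Measurable f → Measurable k → (∀ t, |f t| ≤ |g' t|) →
      Integrable (fun t => g t * k t) γ₁ → Integrable (fun t => f t * k t) γ₁ := by
    intro f k hf hk hle hint
    refine hint.mono (hf.mul hk).aestronglyMeasurable ?_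
    filter_upwards [hgg'] with t ht
    rw [norm_mul, norm_mul, ht]
    exact mul_le_mul_of_nonneg_right (hle t) (norm_nonneg _)
  have hfin : ∀ f : ℝ → ℝ, Measurable f → (∀ t, 0 ≤ f t) → (∀ t, |f t| ≤ |g' t|) →
      IsFiniteMeasure (μ f) := by
    intro f hf h0 hle
    refine isFiniteMeasure_withDensity_ofReal ?_
    have := hdom f 1 hf measurable_one hle (by simpa using hgi)
    simpa using this.2
  have := hfin p hpm hp0 hple
  have := hfin q hqm hq0 hqle
  have hset : ∀ f : ℝ → ℝ, Measurable f → (∀ t, 0 ≤ f t) → (∀ t, |f t| ≤ |g' t|) →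
      integrableExpSet id (μ f) = Set.univ := by
    intro f hf h0 hle
    refine Set.eq_univ_of_forall fun s => ?_
    change Integrable _ _
    rw [hμi f _ hf h0]
    exact hdom f _ hf (by fun_prop) hle (hi s 0).2
  have hmom : ∀ n : ℕ, ∫ t, id t ^ n * Real.exp (0 * id t) ∂(μ p) =
      ∫ t, id t ^ n * Real.exp (0 * id t) ∂(μ q) := by
    intro n
    rw [hμ p _ hpm hp0, hμ q _ hqm hq0]
    simp only [id, zero_mul, Real.exp_zero, mul_one]
    rw [← sub_eq_zero, ← integral_sub (hdom p _ hpm (by fun_prop) hple (hi 0 n).1)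
      (hdom q _ hqm (by fun_prop) hqle (hi 0 n).1), ← integral_mul_pow_eq_zero hg h n]
    refine integral_congr_ae ?_
    filter_upwards [hgg'] with t ht
    rw [← sub_mul, hpq, ht]
  have hmgf : mgf id (μ p) = mgf id (μ q) := by
    have h1 := hasFPowerSeriesAt_mgf (X := id) (μ := μ p) (v := 0) (by simp [hset p hpm hp0 hple])
    have h2 := hasFPowerSeriesAt_mgf (X := id) (μ := μ q) (v := 0) (by simp [hset q hqm hq0 hqle])
    simp only [hmom] at h1
    have h3 := (h1.sub h2)
    rw [sub_self] at h3
    have h4 : mgf id (μ p) =ᶠ[nhds 0] mgf id (μ q) := by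
      filter_upwards [h3.eventually_eq_zero] with s hs
      exact sub_eq_zero.mp hs
    have a1 := analyticOnNhd_mgf (X := id) (μ := μ p)
    have a2 := analyticOnNhd_mgf (X := id) (μ := μ q)
    rw [hset p hpm hp0 hple, interior_univ] at a1
    rw [hset q hqm hq0 hqle, interior_univ] at a2
    exact a1.eq_of_eventuallyEq a2 h4
  have hzero : μ p = 0 ↔ μ q = 0 := by
    have := congrFun hmgf 0
    simp only [mgf_zero'] at this
    rw [← Measure.measure_univ_eq_zero, ← Measure.measure_univ_eq_zero (μ := μ q),
      ← measureReal_eq_zero_iff, ← measureReal_eq_zero_iff, this]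
  have hc : complexMGF id (μ p) = complexMGF id (μ q) := by
    ext z
    exact eqOn_complexMGF_of_mgf' hmgf hzero (by simp [hset p hpm hp0 hple])
  have hmu : μ p = μ q := Measure.ext_of_complexMGF_id_eq hc
  have hpq' : (fun t => ENNReal.ofReal (p t)) =ᵐ[γ₁] (fun t => ENNReal.ofReal (q t)) :=
    (withDensity_eq_iff_of_sigmaFinite (by fun_prop) (by fun_prop)).mp hmu
  filter_upwards [hgg', hpq'] with t h1 h2
  rw [ENNReal.ofReal_eq_ofReal_iff (hp0 t) (hq0 t)] at h2
  rw [h1, ← hpq t, h2]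
  simp

lemma memLp_polynomial (p : Polynomial ℝ) : MemLp (fun t => p.eval t) 2 γ₁ := by
  rw [memLp_two_iff_integrable_sq (by fun_prop)]
  exact (integrable_polynomial_gaussian (p ^ 2)).congr
    (Filter.Eventually.of_forall fun t => by simp)

lemma memLp_He (n : ℕ) : MemLp (fun t => He n t 1) 2 γ₁ := by
  simpa [eval_hePoly] using memLp_polynomial (hePoly n)

lemma memLp_ReLU : MemLp ReLU 2 γ₁ := by
  refine (memLp_polynomial Polynomial.X).mono measurable_ReLU.aestronglyMeasurable
    (Filter.Eventually.of_forall fun t => ?_)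
  simpa using abs_ReLU_le t

lemma inner_toLp {f g : ℝ → ℝ} (hf : MemLp f 2 γ₁) (hg : MemLp g 2 γ₁) :
    inner ℝ (hf.toLp f) (hg.toLp g) = ∫ t, f t * g t ∂γ₁ := by
  rw [L2.inner_def]
  refine integral_congr_ae ?_
  filter_upwards [hf.coeFn_toLp, hg.coeFn_toLp] with t h1 h2
  rw [h1, h2]
  simp [mul_comm]

/-- Parseval's identity for a square integrable function and the Hermite polynomials. -/
lemma hasSum_hermite_coef_sq {f : ℝ → ℝ} (hf : MemLp f 2 γ₁) :
    HasSum (fun n : ℕ => (∫ t, f t * He n t 1 ∂γ₁) ^ 2 / n.factorial) (∫ t, f t ^ 2 ∂γ₁) := by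
  have hm : ∀ n : ℕ, MemLp (fun t => (√(n.factorial : ℝ))⁻¹ * He n t 1) 2 γ₁ :=
    fun n => (memLp_He n).const_mul _
  let e : ℕ → Lp ℝ 2 γ₁ := fun n => (hm n).toLp _
  have he : Orthonormal ℝ e := by
    rw [orthonormal_iff_ite]
    intro n m
    rw [inner_toLp]
    have : ∀ t, (√(n.factorial : ℝ))⁻¹ * He n t 1 * ((√(m.factorial : ℝ))⁻¹ * He m t 1) =
        (√(n.factorial : ℝ))⁻¹ * (√(m.factorial : ℝ))⁻¹ * (He n t 1 * He m t 1) := by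
      intro t; ring
    simp_rw [this]
    rw [integral_const_mul, integral_He_mul_He]
    split_ifs with h
    · subst h
      have : (0 : ℝ) < (n.factorial : ℝ) := by positivity
      rw [← mul_inv, Real.mul_self_sqrt this.le, inv_mul_cancel₀ this.ne']
    · simp
  have hcoef : ∀ (f : ℝ → ℝ) (hf : MemLp f 2 γ₁) n,
      inner ℝ (hf.toLp f) (e n) = (√(n.factorial : ℝ))⁻¹ * ∫ t, f t * He n t 1 ∂γ₁ := by
    intro f hf n
    rw [inner_toLp, ← integral_const_mul]
    congr 1; ext t; ring
  have hbot : (Submodule.span ℝ (Set.range e))ᗮ = ⊥ := by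
    rw [Submodule.eq_bot_iff]
    intro g hg
    have hg2 := Lp.memLp g
    have : ∀ n, ∫ t, g t * He n t 1 ∂γ₁ = 0 := by
      intro n
      have h1 : inner ℝ g (e n) = (0 : ℝ) :=
        Submodule.inner_left_of_mem_orthogonal (Submodule.subset_span (Set.mem_range_self n)) hg
      have h2 := hcoef _ hg2 n
      rw [Lp.toLp_coeFn, h1] at h2
      have h3 : (√(n.factorial : ℝ))⁻¹ ≠ 0 := by positivity
      simpa [h3] using h2.symm
    exact (Lp.eq_zero_iff_ae_eq_zero).mpr (ae_eq_zero_of_integral_mul_He hg2 this)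
  let b := HilbertBasis.mkOfOrthogonalEqBot he hbot
  have hb := b.hasSum_inner_mul_inner (hf.toLp f) (hf.toLp f)
  rw [inner_toLp] at hb
  convert! hb using 1
  · ext n
    have : b n = e n := by simp [b]
    rw [this, real_inner_comm (hf.toLp f) (e n), hcoef]
    have : (0 : ℝ) < (n.factorial : ℝ) := by positivity
    field_simp
    rw [Real.sq_sqrt this.le]
  · congr 1; ext t; ring

/-- The partial sum of the Hermite expansion of the rectified linear unit. -/
noncomputable def reluPartial (l : ℕ) (t : ℝ) : ℝ :=
  ∑ n ∈ Finset.range (l + 1), reluCoef n / n.factorial * He n t 1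

lemma memLp_reluPartial (l : ℕ) : MemLp (reluPartial l) 2 γ₁ :=
  memLp_finsetSum _ fun n _ => (memLp_He n).const_mul _

lemma sum_Ico_inv_sq_le (l m : ℕ) (hl : 1 ≤ l) :
    ∑ n ∈ Finset.Ico (l + 1) m, 1 / (n : ℝ) ^ 2 ≤ 1 / (l : ℝ) := by
  have : ∀ m, l + 1 ≤ m → ∑ n ∈ Finset.Ico (l + 1) m, 1 / (n : ℝ) ^ 2 ≤
      1 / (l : ℝ) - 1 / ((m : ℝ) - 1) := by
    intro m hm
    induction m, hm using Nat.le_induction with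
    | base => simp
    | succ m hm ih =>
      rw [Finset.sum_Ico_succ_top hm]
      have h1 : (1 : ℝ) < m := by exact_mod_cast (by omega : 1 < m)
      have h2 : 1 / (m : ℝ) ^ 2 ≤ 1 / ((m : ℝ) - 1) - 1 / m := by
        rw [div_sub_div _ _ (by linarith) (by linarith), div_le_div_iff₀ (by positivity)
          (by nlinarith)]
        nlinarith
      push_cast
      rw [add_sub_cancel_right]
      linarith
  rcases le_or_gt (l + 1) m with h | h
  · have h1 : (1 : ℝ) < m := by exact_mod_cast (by omega : 1 < m)
    have := this m h
    have h2 : 0 ≤ 1 / ((m : ℝ) - 1) := by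
      apply div_nonneg zero_le_one; linarith
    linarith
  · rw [Finset.Ico_eq_empty_of_le h.le]; simp

/-- The Hermite partial sums approximate the rectified linear unit at a polynomial rate. -/
lemma integral_ReLU_sub_partial_sq_le (l : ℕ) (hl : 1 ≤ l) :
    ∫ t, (ReLU t - reluPartial l t) ^ 2 ∂γ₁ ≤ 1 / l := by
  have hs := hasSum_hermite_coef_sq memLp_ReLU
  change HasSum (fun n => reluCoef n ^ 2 / (n.factorial : ℝ)) _ at hs
  have hR : Integrable (fun t => ReLU t ^ 2) γ₁ := memLp_ReLU.integrable_sq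
  have hP : Integrable (fun t => reluPartial l t ^ 2) γ₁ := (memLp_reluPartial l).integrable_sq
  have hRP : Integrable (fun t => ReLU t * reluPartial l t) γ₁ :=
    MemLp.integrable_mul (q := 2) memLp_ReLU (memLp_reluPartial l)
  have hRH : ∀ n, Integrable (fun t => ReLU t * He n t 1) γ₁ := fun n =>
    MemLp.integrable_mul (q := 2) memLp_ReLU (memLp_He n)
  have h1 : ∫ t, ReLU t * reluPartial l t ∂γ₁ =
      ∑ n ∈ Finset.range (l + 1), reluCoef n ^ 2 / n.factorial := by
    have : ∀ t, ReLU t * reluPartial l t =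
        ∑ n ∈ Finset.range (l + 1), reluCoef n / n.factorial * (ReLU t * He n t 1) := by
      intro t; simp only [reluPartial, Finset.mul_sum]
      exact Finset.sum_congr rfl fun n _ => by ring
    simp_rw [this]
    rw [integral_finsetSum _ fun n _ => (hRH n).const_mul _]
    refine Finset.sum_congr rfl fun n _ => ?_
    rw [integral_const_mul, ← reluCoef]
    ring
  have h2 : ∫ t, reluPartial l t ^ 2 ∂γ₁ =
      ∑ n ∈ Finset.range (l + 1), reluCoef n ^ 2 / n.factorial := by
    have : ∀ t, reluPartial l t ^ 2 = ∑ n ∈ Finset.range (l + 1), ∑ m ∈ Finset.range (l + 1),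
        reluCoef n / n.factorial * (reluCoef m / m.factorial) * (He n t 1 * He m t 1) := by
      intro t; simp only [reluPartial, pow_two, Finset.sum_mul_sum]
      exact Finset.sum_congr rfl fun n _ => Finset.sum_congr rfl fun m _ => by ring
    simp_rw [this]
    rw [integral_finsetSum _ fun n _ => integrable_finsetSum _ fun m _ =>
      (integrable_He_mul_He n m).const_mul _]
    refine Finset.sum_congr rfl fun n hn => ?_
    rw [integral_finsetSum _ fun m _ => (integrable_He_mul_He n m).const_mul _]
    simp_rw [integral_const_mul, integral_He_mul_He]
    rw [Finset.sum_eq_single n (fun m _ hm => by rw [if_neg hm.symm, mul_zero])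
      (fun h => absurd hn h), if_pos rfl]
    have : (0 : ℝ) < (n.factorial : ℝ) := by positivity
    field_simp
  have h3 : ∫ t, (ReLU t - reluPartial l t) ^ 2 ∂γ₁ = ∫ t, ReLU t ^ 2 ∂γ₁ -
      ∑ n ∈ Finset.range (l + 1), reluCoef n ^ 2 / n.factorial := by
    have : ∀ t, (ReLU t - reluPartial l t) ^ 2 =
        ReLU t ^ 2 - 2 * (ReLU t * reluPartial l t) + reluPartial l t ^ 2 := by
      intro t; ring
    simp_rw [this]
    rw [integral_add (f := fun t => ReLU t ^ 2 - 2 * (ReLU t * reluPartial l t))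
      (hR.sub (hRP.const_mul 2)) hP, integral_sub hR (hRP.const_mul 2),
      integral_const_mul, h1, h2]
    ring
  rw [h3, sub_le_iff_le_add]
  refine le_of_tendsto hs.tendsto_sum_nat (Filter.eventually_atTop.mpr ⟨l + 1, fun m hm => ?_⟩)
  rw [← Finset.sum_range_add_sum_Ico _ hm, add_comm]
  gcongr
  refine le_trans (Finset.sum_le_sum fun n hn => ?_) (sum_Ico_inv_sq_le l m hl)
  have hn1 : 1 ≤ n := by have := (Finset.mem_Ico.mp hn).1; omega
  have := reluCoef_sq_le n hn1
  have hn2 : (0 : ℝ) < n := by exact_mod_cast hn1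
  rwa [le_div_iff₀ (by positivity)]

/-! ### Hermite functions of several variables -/

lemma integrable_mul_of_memLp {Ω : Type*} [MeasurableSpace Ω] {μ : Measure Ω} {f g : Ω → ℝ}
    (hf : MemLp f 2 μ) (hg : MemLp g 2 μ) : Integrable (fun x => f x * g x) μ :=
  MemLp.integrable_mul (q := 2) hf hg

section MultivariateHermite

set_option linter.unusedSectionVars false

variable {E : Type*} [NormedAddCommGroup E] [InnerProductSpace ℝ E] [FiniteDimensional ℝ E]
  [MeasurableSpace E] [BorelSpace E] {ι : Type*} [Fintype ι]

/-- The Hermite function with multi-index `l` in the coordinates of an orthonormal basis. -/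
noncomputable def hermiteFun (b : OrthonormalBasis ι ℝ E) (l : ι → ℕ) (x : E) : ℝ :=
  ∏ i, He (l i) (inner ℝ (b i) x) 1

lemma continuous_He (n : ℕ) : Continuous fun t : ℝ => He n t 1 := by
  simp only [← eval_hePoly]; fun_prop

lemma continuous_hermiteFun (b : OrthonormalBasis ι ℝ E) (l : ι → ℕ) :
    Continuous (hermiteFun b l) :=
  continuous_finsetProd _ fun i _ => (continuous_He _).comp (by fun_prop)

lemma measurePreserving_basis (b : OrthonormalBasis ι ℝ E) :
    MeasurePreserving (fun y : ι → ℝ => ∑ i, y i • b i)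
      (Measure.pi fun _ : ι => gaussianReal 0 1) (stdGaussian E) :=
  ⟨by fun_prop, (stdGaussian_eq_map_pi_orthonormalBasis b).symm⟩

lemma integral_stdGaussian_eq (b : OrthonormalBasis ι ℝ E) {f : E → ℝ} (hf : Continuous f) :
    ∫ x, f x ∂(stdGaussian E) =
      ∫ y : ι → ℝ, f (∑ i, y i • b i) ∂(Measure.pi fun _ : ι => gaussianReal 0 1) := by
  rw [← (measurePreserving_basis b).map_eq, integral_map
    (measurePreserving_basis b).measurable.aemeasurable hf.aestronglyMeasurable]

lemma integrable_stdGaussian_iff (b : OrthonormalBasis ι ℝ E) {f : E → ℝ} (hf : Continuous f) :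
    Integrable f (stdGaussian E) ↔
      Integrable (fun y : ι → ℝ => f (∑ i, y i • b i))
        (Measure.pi fun _ : ι => gaussianReal 0 1) :=
  ((measurePreserving_basis b).integrable_comp hf.aestronglyMeasurable).symm

lemma inner_basis_sum (b : OrthonormalBasis ι ℝ E) (y : ι → ℝ) (i : ι) :
    inner ℝ (b i) (∑ j, y j • b j) = y i := by
  classical
  simp [inner_sum, inner_smul_right, b.inner_eq_ite]

lemma integrable_hermiteFun_mul (b : OrthonormalBasis ι ℝ E) (l m : ι → ℕ) :
    Integrable (fun x => hermiteFun b l x * hermiteFun b m x) (stdGaussian E) := by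
  rw [integrable_stdGaussian_iff b (f := fun x => hermiteFun b l x * hermiteFun b m x)
    ((continuous_hermiteFun b l).mul (continuous_hermiteFun b m))]
  simp only [hermiteFun, inner_basis_sum, ← Finset.prod_mul_distrib]
  exact Integrable.fintype_prod (f := fun i t => He (l i) t 1 * He (m i) t 1)
    fun i => integrable_He_mul_He _ _

/-- Orthogonality of the multivariate Hermite functions. -/
lemma integral_hermiteFun_mul [DecidableEq ι] (b : OrthonormalBasis ι ℝ E) (l m : ι → ℕ) :
    ∫ x, hermiteFun b l x * hermiteFun b m x ∂(stdGaussian E) =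
      if l = m then ∏ i, ((l i).factorial : ℝ) else 0 := by
  rw [integral_stdGaussian_eq b (f := fun x => hermiteFun b l x * hermiteFun b m x)
    ((continuous_hermiteFun b l).mul (continuous_hermiteFun b m))]
  simp only [hermiteFun, inner_basis_sum, ← Finset.prod_mul_distrib]
  rw [integral_fintype_prod_eq_prod (fun i t => He (l i) t 1 * He (m i) t 1)]
  simp_rw [integral_He_mul_He]
  split_ifs with h
  · subst h; simp
  · obtain ⟨i, hi⟩ := Function.ne_iff.mp h
    exact Finset.prod_eq_zero (Finset.mem_univ i) (if_neg hi)

lemma memLp_hermiteFun (b : OrthonormalBasis ι ℝ E) (l : ι → ℕ) :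
    MemLp (hermiteFun b l) 2 (stdGaussian E) := by
  rw [memLp_two_iff_integrable_sq (continuous_hermiteFun b l).aestronglyMeasurable]
  simpa [pow_two] using integrable_hermiteFun_mul b l l

lemma norm_sq_sum_basis (b : OrthonormalBasis ι ℝ E) (y : ι → ℝ) :
    ‖∑ i, y i • b i‖ ^ 2 = ∑ i, y i ^ 2 := by
  rw [← b.sum_sq_norm_inner_right]
  simp [inner_basis_sum]

lemma prod_He_sq_eq [DecidableEq ι] (l : ι → ℕ) (y : ι → ℝ) (j : ι) :
    y j ^ 2 * (∏ i, He (l i) (y i) 1) ^ 2 =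
      ∏ i, ((if i = j then y i ^ 2 else 1) * (He (l i) (y i) 1 * He (l i) (y i) 1)) := by
  rw [Finset.prod_mul_distrib, Finset.prod_ite_eq' Finset.univ j, if_pos (Finset.mem_univ j),
    Finset.prod_mul_distrib, pow_two (∏ i, _)]

lemma integrable_ite_sq_mul_He_sq (p : Prop) [Decidable p] (n : ℕ) :
    Integrable (fun t : ℝ => (if p then t ^ 2 else 1) * (He n t 1 * He n t 1)) γ₁ := by
  by_cases h : p
  · simpa [h] using integrable_sq_mul_He_sq n
  · simpa [h] using integrable_He_mul_He n n

lemma integrable_norm_sq_mul_hermiteFun_sq (b : OrthonormalBasis ι ℝ E) (l : ι → ℕ) :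
    Integrable (fun x => ‖x‖ ^ 2 * hermiteFun b l x ^ 2) (stdGaussian E) := by
  classical
  rw [integrable_stdGaussian_iff b (by have := continuous_hermiteFun b l; fun_prop)]
  simp only [hermiteFun, inner_basis_sum, norm_sq_sum_basis, Finset.sum_mul, prod_He_sq_eq]
  exact integrable_finsetSum _ fun j _ => Integrable.fintype_prod
    (f := fun i t => (if i = j then t ^ 2 else 1) * (He (l i) t 1 * He (l i) t 1))
    fun i => integrable_ite_sq_mul_He_sq _ _

lemma integral_norm_sq_mul_hermiteFun_sq (b : OrthonormalBasis ι ℝ E) (l : ι → ℕ) :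
    ∫ x, ‖x‖ ^ 2 * hermiteFun b l x ^ 2 ∂(stdGaussian E) =
      (∏ i, ((l i).factorial : ℝ)) * ∑ i, (2 * (l i : ℝ) + 1) := by
  classical
  rw [integral_stdGaussian_eq b (by have := continuous_hermiteFun b l; fun_prop)]
  simp only [hermiteFun, inner_basis_sum, norm_sq_sum_basis, Finset.sum_mul, prod_He_sq_eq]
  rw [integral_finsetSum _ fun j _ => Integrable.fintype_prod
    (f := fun i t => (if i = j then t ^ 2 else 1) * (He (l i) t 1 * He (l i) t 1))
    fun i => integrable_ite_sq_mul_He_sq _ _, Finset.mul_sum]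
  refine Finset.sum_congr rfl fun j _ => ?_
  rw [integral_fintype_prod_eq_prod
    (fun i t => (if i = j then t ^ 2 else 1) * (He (l i) t 1 * He (l i) t 1))]
  have : ∀ i, ∫ t, (if i = j then t ^ 2 else 1) * (He (l i) t 1 * He (l i) t 1) ∂γ₁ =
      ((l i).factorial : ℝ) * if i = j then 2 * (l i : ℝ) + 1 else 1 := by
    intro i
    split_ifs with h
    · exact integral_sq_mul_He_sq _
    · simp [integral_He_mul_He]
  simp_rw [this]
  rw [Finset.prod_mul_distrib, Finset.prod_ite_eq' Finset.univ j, if_pos (Finset.mem_univ j)]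

/-- The expansion of a Hermite polynomial of a linear form. -/
lemma He_inner_eq_sum [DecidableEq ι] (b : OrthonormalBasis ι ℝ E) (m : ℕ) (v x : E) :
    He m (inner ℝ v x) (‖v‖ ^ 2) = m.factorial * ∑ l ∈ Finset.univ.finsuppAntidiag m,
      (∏ i, (inner ℝ (b i) v ^ l i / ((l i).factorial : ℝ))) * hermiteFun b l x := by
  have h1 : (inner ℝ v x : ℝ) = ∑ i, inner ℝ (b i) v * inner ℝ (b i) x := by
    rw [← b.sum_inner_mul_inner v x]
    simp [real_inner_comm]
  have h2 : ‖v‖ ^ 2 = ∑ i, inner ℝ (b i) v ^ 2 * (1 : ℝ) := by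
    rw [← b.sum_sq_norm_inner_right v]; simp
  rw [h1, h2, He_sum]
  congr 1
  refine Finset.sum_congr rfl fun l _ => ?_
  rw [hermiteFun, ← Finset.prod_mul_distrib]
  refine Finset.prod_congr rfl fun i _ => ?_
  rw [He_smul]; ring

lemma inner_pow_eq_sum [DecidableEq ι] (b : OrthonormalBasis ι ℝ E) (m : ℕ) (u v : E) :
    (inner ℝ u v : ℝ) ^ m = m.factorial * ∑ l ∈ Finset.univ.finsuppAntidiag m,
      (∏ i, (inner ℝ (b i) u ^ l i / ((l i).factorial : ℝ))) * ∏ i, inner ℝ (b i) v ^ l i := by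
  have h1 : (inner ℝ u v : ℝ) = ∑ i, inner ℝ (b i) u * inner ℝ (b i) v := by
    rw [← b.sum_inner_mul_inner u v]
    simp [real_inner_comm]
  have h := He_sum Finset.univ (fun i => inner ℝ (b i) u * inner ℝ (b i) v) (fun _ => (0 : ℝ)) m
  rw [← h1] at h
  simp only [Finset.sum_const_zero, He_zero_right] at h
  rw [h]
  congr 1
  refine Finset.sum_congr rfl fun l _ => ?_
  rw [← Finset.prod_mul_distrib]
  exact Finset.prod_congr rfl fun i _ => by rw [mul_pow]; ring

lemma integral_He_inner_mul_hermiteFun (b : OrthonormalBasis ι ℝ E) (m : ℕ) (v : E)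
    (l : ι → ℕ) :
    ∫ x, He m (inner ℝ v x) (‖v‖ ^ 2) * hermiteFun b l x ∂(stdGaussian E) =
      if ∑ i, l i = m then m.factorial * ∏ i, inner ℝ (b i) v ^ l i else 0 := by
  classical
  simp_rw [He_inner_eq_sum b, mul_assoc, Finset.sum_mul, mul_assoc]
  rw [integral_const_mul, integral_finsetSum _ fun k _ =>
    (integrable_hermiteFun_mul b _ _).const_mul _]
  simp_rw [integral_const_mul, integral_hermiteFun_mul]
  split_ifs with h
  · congr 1
    rw [Finset.sum_eq_single (Finsupp.equivFunOnFinite.symm l)]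
    · simp only [Finsupp.equivFunOnFinite_symm_apply_apply]
      rw [if_pos (by ext; simp), ← Finset.prod_mul_distrib]
      refine Finset.prod_congr rfl fun i _ => ?_
      have : ((l i).factorial : ℝ) ≠ 0 := by positivity
      field_simp
    · intro k _ hk
      rw [if_neg, mul_zero]
      intro hkl; apply hk; ext i; simp [← hkl]
    · intro hk
      exfalso; apply hk
      simp [Finset.mem_finsuppAntidiag, h]
  · rw [Finset.sum_eq_zero, mul_zero]
    intro k hk
    rw [if_neg, mul_zero]
    rintro rfl
    exact h (Finset.mem_finsuppAntidiag.mp hk).1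

lemma memLp_He_inner (m : ℕ) (v : E) :
    MemLp (fun x => He m (inner ℝ v x) (‖v‖ ^ 2)) 2 (stdGaussian E) := by
  classical
  simp_rw [He_inner_eq_sum (stdOrthonormalBasis ℝ E)]
  exact (memLp_finsetSum _ fun l _ => (memLp_hermiteFun _ _).const_mul _).const_mul _

/-- Hermite polynomials of two linear forms have covariance `m! ⟨u, v⟩ ^ m`. -/
lemma integral_He_inner_mul_He_inner (m : ℕ) (u v : E) :
    ∫ x, He m (inner ℝ u x) (‖u‖ ^ 2) * He m (inner ℝ v x) (‖v‖ ^ 2) ∂(stdGaussian E) =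
      m.factorial * inner ℝ u v ^ m := by
  classical
  have b := stdOrthonormalBasis ℝ E
  have e : ∀ x, He m (inner ℝ u x) (‖u‖ ^ 2) * He m (inner ℝ v x) (‖v‖ ^ 2) =
      m.factorial * ∑ l ∈ Finset.univ.finsuppAntidiag m,
        (∏ i, (inner ℝ (b i) v ^ l i / ((l i).factorial : ℝ))) *
          (He m (inner ℝ u x) (‖u‖ ^ 2) * hermiteFun b l x) := by
    intro x
    rw [He_inner_eq_sum b m v, mul_left_comm, Finset.mul_sum]
    congr 1
    exact Finset.sum_congr rfl fun l _ => by ring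
  simp_rw [e]
  rw [integral_const_mul, integral_finsetSum _ fun (l : Fin (Module.finrank ℝ E) →₀ ℕ) _ =>
    (integrable_mul_of_memLp (memLp_He_inner m u) (memLp_hermiteFun b ⇑l)).const_mul _]
  simp_rw [integral_const_mul, integral_He_inner_mul_hermiteFun]
  congr 1
  rw [real_inner_comm, inner_pow_eq_sum b, Finset.mul_sum]
  refine Finset.sum_congr rfl fun l hl => ?_
  rw [if_pos (Finset.mem_finsuppAntidiag.mp hl).1]
  ring

lemma map_inner_stdGaussian {v : E} (hv : ‖v‖ = 1) :
    (stdGaussian E).map (fun x => inner ℝ v x) = gaussianReal 0 1 := by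
  have h := IsGaussian.map_eq_gaussianReal (μ := stdGaussian E) (innerSL ℝ v)
  rw [variance_dual_stdGaussian, integral_strongDual_stdGaussian] at h
  simpa [hv] using h

lemma measurePreserving_inner {v : E} (hv : ‖v‖ = 1) :
    MeasurePreserving (fun x => inner ℝ v x) (stdGaussian E) γ₁ :=
  ⟨by fun_prop, map_inner_stdGaussian hv⟩

lemma memLp_ReLU_inner {v : E} (hv : ‖v‖ = 1) :
    MemLp (fun x => ReLU (inner ℝ v x)) 2 (stdGaussian E) :=
  memLp_ReLU.comp_measurePreserving (measurePreserving_inner hv)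

lemma integral_ReLU_inner_sub_sq_le {v : E} (hv : ‖v‖ = 1) {l : ℕ} (hl : 1 ≤ l) :
    ∫ x, (ReLU (inner ℝ v x) - reluPartial l (inner ℝ v x)) ^ 2 ∂(stdGaussian E) ≤ 1 / l := by
  have h := integral_ReLU_sub_partial_sq_le l hl
  rw [← (measurePreserving_inner hv).map_eq, integral_map
    (measurePreserving_inner hv).measurable.aemeasurable] at h
  · exact h
  · rw [(measurePreserving_inner hv).map_eq]
    exact ((memLp_ReLU.sub (memLp_reluPartial l)).aestronglyMeasurable.pow 2)

lemma abs_integral_mul_le {Ω : Type*} [MeasurableSpace Ω] {μ : Measure Ω} {f g : Ω → ℝ}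
    (hf : MemLp f 2 μ) (hg : MemLp g 2 μ) :
    (∫ x, f x * g x ∂μ) ^ 2 ≤ (∫ x, f x ^ 2 ∂μ) * ∫ x, g x ^ 2 ∂μ := by
  have hfg : Integrable (fun x => f x * g x) μ := integrable_mul_of_memLp hf hg
  have h : ∀ r : ℝ, 0 ≤ (∫ x, g x ^ 2 ∂μ) * (r * r) + (2 * ∫ x, f x * g x ∂μ) * r +
      ∫ x, f x ^ 2 ∂μ := by
    intro r
    have : ∫ x, (f x + r * g x) ^ 2 ∂μ = (∫ x, g x ^ 2 ∂μ) * (r * r) +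
        (2 * ∫ x, f x * g x ∂μ) * r + ∫ x, f x ^ 2 ∂μ := by
      have e : ∀ x, (f x + r * g x) ^ 2 =
          (r * r) * g x ^ 2 + (2 * r) * (f x * g x) + f x ^ 2 := by intro x; ring
      simp_rw [e]
      rw [integral_add (f := fun x => r * r * g x ^ 2 + 2 * r * (f x * g x))
        ((hg.integrable_sq.const_mul _).add (hfg.const_mul _)) hf.integrable_sq,
        integral_add (hg.integrable_sq.const_mul _) (hfg.const_mul _), integral_const_mul,
        integral_const_mul]
      ring
    rw [← this]
    exact integral_nonneg fun x => sq_nonneg _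
  have := discrim_le_zero h
  rw [discrim] at this
  nlinarith

lemma reluPartial_inner_eq {v : E} (hv : ‖v‖ = 1) (L : ℕ) (x : E) :
    reluPartial L (inner ℝ v x) = ∑ m ∈ Finset.range (L + 1),
      reluCoef m / m.factorial * He m (inner ℝ v x) (‖v‖ ^ 2) := by
  simp [reluPartial, hv]

/-- The Hermite coefficients of a ridge function built from the rectified linear unit. -/
lemma integral_ReLU_inner_mul_hermiteFun (b : OrthonormalBasis ι ℝ E) {v : E} (hv : ‖v‖ = 1)
    (l : ι → ℕ) :
    ∫ x, ReLU (inner ℝ v x) * hermiteFun b l x ∂(stdGaussian E) =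
      reluCoef (∑ i, l i) * ∏ i, inner ℝ (b i) v ^ l i := by
  set m := ∑ i, l i with hm
  have hP : ∀ L, MemLp (fun x => reluPartial L (inner ℝ v x)) 2 (stdGaussian E) := fun L =>
    (memLp_reluPartial L).comp_measurePreserving (measurePreserving_inner hv)
  have h1 : ∀ L, m ≤ L → ∫ x, reluPartial L (inner ℝ v x) * hermiteFun b l x ∂(stdGaussian E) =
      reluCoef m * ∏ i, inner ℝ (b i) v ^ l i := by
    intro L hL
    simp_rw [reluPartial_inner_eq hv, Finset.sum_mul, mul_assoc]
    rw [integral_finsetSum _ fun n _ => (integrable_mul_of_memLp (memLp_He_inner n v)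
      (memLp_hermiteFun b l)).const_mul _]
    simp_rw [integral_const_mul, integral_He_inner_mul_hermiteFun, ← hm]
    rw [Finset.sum_eq_single m]
    · rw [if_pos rfl]
      have : (m.factorial : ℝ) ≠ 0 := by positivity
      field_simp
    · intro n _ hn; rw [if_neg hn.symm, mul_zero]
    · intro h; simp at h; omega
  rw [← sub_eq_zero]
  set D := ∫ x, ReLU (inner ℝ v x) * hermiteFun b l x ∂(stdGaussian E) -
    reluCoef m * ∏ i, inner ℝ (b i) v ^ l i with hD
  have h2 : ∀ L : ℕ, D ^ 2 ≤ 1 / ((L + m + 1 : ℕ) : ℝ) *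
      ∫ x, hermiteFun b l x ^ 2 ∂(stdGaussian E) := by
    intro L
    rw [hD, ← h1 (L + m + 1) (by omega), ← integral_sub
      (integrable_mul_of_memLp (memLp_ReLU_inner hv) (memLp_hermiteFun b l))
      (integrable_mul_of_memLp (hP _) (memLp_hermiteFun b l))]
    simp_rw [← sub_mul]
    refine (abs_integral_mul_le ((memLp_ReLU_inner hv).sub (hP _))
      (memLp_hermiteFun b l)).trans ?_
    refine mul_le_mul_of_nonneg_right ?_ (integral_nonneg fun x => sq_nonneg _)
    exact integral_ReLU_inner_sub_sq_le hv (by omega)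
  have h3 : Filter.Tendsto (fun L : ℕ => 1 / ((L + m + 1 : ℕ) : ℝ) *
      ∫ x, hermiteFun b l x ^ 2 ∂(stdGaussian E)) Filter.atTop
      (nhds (0 * ∫ x, hermiteFun b l x ^ 2 ∂(stdGaussian E))) := by
    refine Filter.Tendsto.mul_const _ ?_
    have := (tendsto_one_div_add_atTop_nhds_zero_nat (𝕜 := ℝ)).comp
      (Filter.tendsto_add_atTop_nat m)
    refine this.congr fun L => ?_
    simp
  rw [zero_mul] at h3
  have h4 := ge_of_tendsto' h3 h2
  exact pow_eq_zero_iff two_ne_zero |>.mp (le_antisymm h4 (sq_nonneg _))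

end MultivariateHermite

/-! ### Growth of moment tensors -/

section MomentGrowth

universe u

open scoped TensorProduct

/-- The squared norm of the tensor `∑ i, y i ^ ⊗ n ⊗ c i`. -/
noncomputable def momentSq {ι E H : Type*} [Fintype ι] [NormedAddCommGroup E]
    [InnerProductSpace ℝ E] [NormedAddCommGroup H] [InnerProductSpace ℝ H] (y : ι → E) (n : ℕ)
    (c : ι → H) : ℝ :=
  ∑ i, ∑ j, inner ℝ (y i) (y j) ^ n * inner ℝ (c i) (c j)

variable {ι : Type*} [Fintype ι] {E : Type u} [NormedAddCommGroup E] [InnerProductSpace ℝ E]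

/-- The tensors `∑ i, y i ^ ⊗ n ⊗ c i` live in some inner product space and depend linearly
on `c`. -/
lemma exists_moment_tensor (y : ι → E) (n : ℕ) :
    ∀ (H : Type u) [NormedAddCommGroup H] [InnerProductSpace ℝ H],
      ∃ (K : Type u) (_ : NormedAddCommGroup K) (_ : InnerProductSpace ℝ K)
        (Φ : (ι → H) →ₗ[ℝ] K), ∀ c, ‖Φ c‖ ^ 2 = momentSq y n c := by
  induction n with
  | zero =>
    intro H _ _
    refine ⟨H, inferInstance, inferInstance, ∑ i, LinearMap.proj i, fun c => ?_⟩
    have e : (∑ i, LinearMap.proj i : (ι → H) →ₗ[ℝ] H) c = ∑ i, c i := by simp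
    rw [e, ← real_inner_self_eq_norm_sq, sum_inner]
    simp [momentSq, inner_sum]
  | succ n ih =>
    intro H _ _
    obtain ⟨K, i1, i2, Φ, hΦ⟩ := ih (E ⊗[ℝ] H)
    refine ⟨K, i1, i2, Φ.comp (LinearMap.pi fun i =>
      (TensorProduct.mk ℝ E H (y i)).comp (LinearMap.proj i)), fun c => ?_⟩
    rw [LinearMap.comp_apply, hΦ]
    simp only [momentSq, LinearMap.pi_apply, LinearMap.comp_apply, LinearMap.proj_apply,
      TensorProduct.mk_apply, TensorProduct.inner_tmul, pow_succ, mul_assoc]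

lemma momentSq_nonneg {H : Type u} [NormedAddCommGroup H] [InnerProductSpace ℝ H] (y : ι → E)
    (n : ℕ) (c : ι → H) : 0 ≤ momentSq y n c := by
  obtain ⟨K, _, _, Φ, hΦ⟩ := exists_moment_tensor y n H
  rw [← hΦ]; positivity

lemma sqrt_momentSq_add_le {H : Type u} [NormedAddCommGroup H] [InnerProductSpace ℝ H]
    (y : ι → E) (n : ℕ) (c c' : ι → H) :
    √(momentSq y n (c + c')) ≤ √(momentSq y n c) + √(momentSq y n c') := by
  obtain ⟨K, _, _, Φ, hΦ⟩ := exists_moment_tensor y n H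
  rw [← hΦ, ← hΦ, ← hΦ, Real.sqrt_sq (norm_nonneg _), Real.sqrt_sq (norm_nonneg _),
    Real.sqrt_sq (norm_nonneg _), map_add]
  exact norm_add_le _ _

lemma sqrt_momentSq_sub_le {H : Type u} [NormedAddCommGroup H] [InnerProductSpace ℝ H]
    (y : ι → E) (n : ℕ) (c c' : ι → H) :
    √(momentSq y n (c - c')) ≤ √(momentSq y n c) + √(momentSq y n c') := by
  obtain ⟨K, _, _, Φ, hΦ⟩ := exists_moment_tensor y n H
  rw [← hΦ, ← hΦ, ← hΦ, Real.sqrt_sq (norm_nonneg _), Real.sqrt_sq (norm_nonneg _),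
    Real.sqrt_sq (norm_nonneg _), map_sub]
  exact norm_sub_le _ _

lemma momentSq_succ {H : Type u} [NormedAddCommGroup H] [InnerProductSpace ℝ H]
    (y : ι → E) (n : ℕ) (c : ι → H) :
    momentSq y (n + 1) c = momentSq y n (fun i => y i ⊗ₜ[ℝ] c i) := by
  simp only [momentSq, TensorProduct.inner_tmul, pow_succ, mul_assoc]

lemma sqrt_momentSq_const_tmul_le {H : Type u} [NormedAddCommGroup H] [InnerProductSpace ℝ H]
    (y : ι → E) (n : ℕ) (c : ι → H) {a : E} (ha : ‖a‖ ≤ 1) :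
    √(momentSq y n (fun i => a ⊗ₜ[ℝ] c i)) ≤ √(momentSq y n c) := by
  have : momentSq y n (fun i => a ⊗ₜ[ℝ] c i) = ‖a‖ ^ 2 * momentSq y n c := by
    simp only [momentSq, TensorProduct.inner_tmul, real_inner_self_eq_norm_sq, Finset.mul_sum]
    exact Finset.sum_congr rfl fun i _ => Finset.sum_congr rfl fun j _ => by ring
  rw [this]
  refine Real.sqrt_le_sqrt (mul_le_of_le_one_left (momentSq_nonneg y n c) ?_)
  exact pow_le_one₀ (norm_nonneg _) ha

/-- Moment tensors of all orders are controlled by those of order less than the number of nodes, at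
the cost of a factor that is polynomial in the order.  One replaces a factor `y i` by
`y a + (y i - y a)`; the tensors with the factor `y i - y a` have one node less. -/
theorem sqrt_momentSq_le {y : ι → E} (hy : ∀ i, ‖y i‖ ≤ 1) (s : Finset ι) :
    ∀ (H : Type u) [NormedAddCommGroup H] [InnerProductSpace ℝ H] (c : ι → H) (M : ℝ), 0 ≤ M →
      (∀ i ∉ s, c i = 0) → (∀ m < s.card, √(momentSq y m c) ≤ M) →
      ∀ n : ℕ, √(momentSq y n c) ≤ (2 * n + 1) ^ s.card * M := by
  classical
  induction s using Finset.induction_on with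
  | empty =>
    intro H _ _ c M hM hc _ n
    have : momentSq y n c = 0 := by
      refine Finset.sum_eq_zero fun i _ => Finset.sum_eq_zero fun j _ => ?_
      rw [hc i (by simp)]; simp
    rw [this]; simpa using hM
  | insert a s ha ih =>
    intro H _ _ c M hM hc hlow n
    rw [Finset.card_insert_of_notMem ha] at hlow ⊢
    let c' : ι → E ⊗[ℝ] H := fun i => (y i - y a) ⊗ₜ[ℝ] c i
    have hc' : ∀ i ∉ s, c' i = 0 := by
      intro i hi
      by_cases hia : i = a
      · subst hia; simp [c']
      · simp [c', hc i (by simp [hia, hi])]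
    have hsplit : (fun i => y i ⊗ₜ[ℝ] c i) = c' + fun i => y a ⊗ₜ[ℝ] c i := by
      ext i; simp [c', TensorProduct.sub_tmul]
    have hsplit' : c' = (fun i => y i ⊗ₜ[ℝ] c i) - fun i => y a ⊗ₜ[ℝ] c i := by
      rw [hsplit, add_sub_cancel_right]
    have hstep : ∀ m, √(momentSq y (m + 1) c) ≤ √(momentSq y m c) + √(momentSq y m c') := by
      intro m
      rw [momentSq_succ, hsplit, add_comm (√(momentSq y m c))]
      exact (sqrt_momentSq_add_le _ _ _ _).trans
        (add_le_add le_rfl (sqrt_momentSq_const_tmul_le y m c (hy a)))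
    have hlow' : ∀ m < s.card, √(momentSq y m c') ≤ 2 * M := by
      intro m hm
      rw [hsplit']
      have h1 := sqrt_momentSq_sub_le y m (fun i => y i ⊗ₜ[ℝ] c i) (fun i => y a ⊗ₜ[ℝ] c i)
      rw [← momentSq_succ] at h1
      have h2 := sqrt_momentSq_const_tmul_le y m c (hy a)
      have h3 := hlow (m + 1) (by omega)
      have h4 := hlow m (by omega)
      linarith
    have hb := ih (E ⊗[ℝ] H) c' (2 * M) (by positivity) hc' hlow'
    have hsum : ∀ m ≤ n, √(momentSq y m c) ≤ M + m * ((2 * n + 1) ^ s.card * (2 * M)) := by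
      intro m hm
      induction m with
      | zero => simpa using hlow 0 (by omega)
      | succ m ihm =>
        have h1 := hstep m
        have h2 := ihm (by omega)
        have h3 := hb m
        have h4 : ((2 * (m : ℝ) + 1) ^ s.card) * (2 * M) ≤ (2 * n + 1) ^ s.card * (2 * M) := by
          have : (m : ℝ) ≤ n := by exact_mod_cast (by omega : m ≤ n)
          gcongr
        push_cast
        linarith
    refine (hsum n le_rfl).trans ?_
    have h1 : (1 : ℝ) ≤ (2 * n + 1) ^ s.card := one_le_pow₀ (by
      have := (Nat.cast_nonneg n : (0 : ℝ) ≤ n); linarith)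
    rw [pow_succ]
    nlinarith

end MomentGrowth

section Gram

variable {ι : Type*} [Fintype ι] {E : Type*} [NormedAddCommGroup E] [InnerProductSpace ℝ E]

lemma posSemidef_of_pow {A : Matrix ι ι ℝ} (hA : A.PosSemidef) (n : ℕ) :
    (Matrix.of fun i j => A i j ^ n).PosSemidef := by
  induction n with
  | zero =>
    have := Matrix.posSemidef_gram (𝕜 := ℝ) (fun _ : ι => (1 : ℝ))
    convert! this using 1
    ext i j; simp [Matrix.gram]
  | succ n ih =>
    have := ih.hadamard hA
    convert! this using 1

lemma sum_sum_nonneg_of_posSemidef {A : Matrix ι ι ℝ} (hA : A.PosSemidef) (w : ι → ℝ) :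
    0 ≤ ∑ i, ∑ j, w i * w j * A i j := by
  have h := hA.dotProduct_mulVec_nonneg w
  simp only [star_trivial, dotProduct, Matrix.mulVec, Finset.mul_sum] at h
  refine h.trans_eq (Finset.sum_congr rfl fun i _ => Finset.sum_congr rfl fun j _ => by ring)

lemma sum_gram_pow_nonneg (w : ι → ℝ) (x y z : ι → E) (a b c : ℕ) :
    0 ≤ ∑ i, ∑ j, w i * w j *
      (inner ℝ (x i) (x j) ^ a * inner ℝ (y i) (y j) ^ b * inner ℝ (z i) (z j) ^ c) :=
  sum_sum_nonneg_of_posSemidef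
    (((posSemidef_of_pow (Matrix.posSemidef_gram (𝕜 := ℝ) x) a).hadamard
      (posSemidef_of_pow (Matrix.posSemidef_gram (𝕜 := ℝ) y) b)).hadamard
      (posSemidef_of_pow (Matrix.posSemidef_gram (𝕜 := ℝ) z) c)) w

/-- Let `x i = y i + z i` with every `y i` orthogonal to every `z j`.  The tensors
`∑ i, w i (x i ^ ⊗ m - y i ^ ⊗ m)` are controlled by the tensors
`∑ i, w i x i ^ ⊗ (m - 1) ⊗ z i`: the terms of the geometric sum for
`⟪x i, x j⟫ ^ m - ⟪y i, y j⟫ ^ m` are compared by means of Schur's product theorem. -/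
lemma sum_pow_sub_pow_le (w : ι → ℝ) (x y z : ι → E)
    (h : ∀ i j, (inner ℝ (x i) (x j) : ℝ) = inner ℝ (y i) (y j) + inner ℝ (z i) (z j)) (m : ℕ) :
    ∑ i, ∑ j, w i * w j * ((inner ℝ (x i) (x j) : ℝ) ^ m - inner ℝ (y i) (y j) ^ m) ≤
      m * ∑ i, ∑ j, w i * w j * (inner ℝ (x i) (x j) ^ (m - 1) * inner ℝ (z i) (z j)) := by
  have hb : ∀ b a : ℕ, ∑ i, ∑ j, w i * w j *
        ((inner ℝ (x i) (x j) : ℝ) ^ a * inner ℝ (y i) (y j) ^ b * inner ℝ (z i) (z j)) ≤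
      ∑ i, ∑ j, w i * w j * (inner ℝ (x i) (x j) ^ (a + b) * inner ℝ (z i) (z j)) := by
    intro b
    induction b with
    | zero => intro a; simp
    | succ b ih =>
      intro a
      have h1 := ih (a + 1)
      rw [show a + 1 + b = a + (b + 1) by ring] at h1
      refine le_trans ?_ h1
      rw [← sub_nonneg, ← Finset.sum_sub_distrib]
      simp_rw [← Finset.sum_sub_distrib]
      refine (sum_gram_pow_nonneg w x y z a b 2).trans_eq ?_
      refine Finset.sum_congr rfl fun i _ => Finset.sum_congr rfl fun j _ => ?_
      rw [pow_succ (inner ℝ (x i) (x j) : ℝ) a]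
      conv_rhs => rw [h i j]
      rw [h i j]
      ring
  have hgeom : ∀ i j, w i * w j * ((inner ℝ (x i) (x j) : ℝ) ^ m - inner ℝ (y i) (y j) ^ m) =
      ∑ l ∈ Finset.range m, w i * w j * ((inner ℝ (x i) (x j) : ℝ) ^ l *
        inner ℝ (y i) (y j) ^ (m - 1 - l) * inner ℝ (z i) (z j)) := by
    intro i j
    rw [← (Commute.all _ _).geom_sum₂_mul m, ← Finset.mul_sum, ← Finset.sum_mul]
    congr 2
    rw [h i j]; ring
  simp_rw [hgeom]
  have hswap : ∑ i, ∑ j, ∑ l ∈ Finset.range m, w i * w j * ((inner ℝ (x i) (x j) : ℝ) ^ l *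
        inner ℝ (y i) (y j) ^ (m - 1 - l) * inner ℝ (z i) (z j)) =
      ∑ l ∈ Finset.range m, ∑ i, ∑ j, w i * w j * ((inner ℝ (x i) (x j) : ℝ) ^ l *
        inner ℝ (y i) (y j) ^ (m - 1 - l) * inner ℝ (z i) (z j)) := by
    simp_rw [Finset.sum_comm (t := Finset.range m)]
  rw [hswap]
  refine (Finset.sum_le_sum fun l hl => hb (m - 1 - l) l).trans ?_
  have : ∀ l ∈ Finset.range m, ∑ i, ∑ j, w i * w j *
      ((inner ℝ (x i) (x j) : ℝ) ^ (l + (m - 1 - l)) * inner ℝ (z i) (z j)) =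
      ∑ i, ∑ j, w i * w j * (inner ℝ (x i) (x j) ^ (m - 1) * inner ℝ (z i) (z j)) := by
    intro l hl
    rw [show l + (m - 1 - l) = m - 1 by have := Finset.mem_range.mp hl; omega]
  rw [Finset.sum_congr rfl this]
  simp

open scoped TensorProduct in
/-- The odd moments in the situation of ridge functions with unit directions: the growth bound is
applied to the nodes `v i ⊗ v i` and the coefficients `v i ⊗ w i z i`. Only odd moments are
controlled, since the Hermite coefficients of the rectified linear unit of odd degree at least `3`
vanish. -/
lemma sum_odd_moment_le {E : Type} [NormedAddCommGroup E] [InnerProductSpace ℝ E]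
    (w : ι → ℝ) (v z : ι → E) (hv : ∀ i, ‖v i‖ = 1) {η : ℝ} (hη : 0 ≤ η)
    (hlow : ∀ s < Fintype.card ι, ∑ i, ∑ j, w i * w j *
      (inner ℝ (v i) (v j) ^ (2 * s + 1) * inner ℝ (z i) (z j)) ≤ η ^ 2) (n : ℕ) :
    ∑ i, ∑ j, w i * w j * (inner ℝ (v i) (v j) ^ (2 * n + 1) * inner ℝ (z i) (z j)) ≤
      ((2 * n + 1) ^ Fintype.card ι * η) ^ 2 := by
  let y : ι → E ⊗[ℝ] E := fun i => v i ⊗ₜ[ℝ] v i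
  let c : ι → E ⊗[ℝ] E := fun i => v i ⊗ₜ[ℝ] (w i • z i)
  have hq : ∀ m, momentSq y m c = ∑ i, ∑ j, w i * w j *
      (inner ℝ (v i) (v j) ^ (2 * m + 1) * inner ℝ (z i) (z j)) := by
    intro m
    refine Finset.sum_congr rfl fun i _ => Finset.sum_congr rfl fun j _ => ?_
    simp only [y, c, TensorProduct.inner_tmul, real_inner_smul_left, real_inner_smul_right]
    ring
  have h := sqrt_momentSq_le (y := y) (fun i => by simp [y, hv]) Finset.univ (E ⊗[ℝ] E) c η hη
    (by simp) (fun m hm => by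
      rw [hq, Real.sqrt_le_left hη]; exact hlow m (by simpa using hm)) n
  rw [hq, Finset.card_univ] at h
  exact (Real.sqrt_le_left (by positivity)).mp h

end Gram

/-! ### Greedy selection of a subspace -/

section Greedy

variable {E : Type*} [NormedAddCommGroup E] [InnerProductSpace ℝ E] {T : Type*}

/-- `res r t` is the residual of the vector with index `t` after `r` rounds of a pivoted
Gram-Schmidt process, which in round `r` removes the component along the vector `u r`, the longest
residual at that time. -/
structure IsPivotedGramSchmidt (k : ℕ) (res : ℕ → T → E) (u : ℕ → E) (idx : ℕ → T) : Prop where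
  u_eq : ∀ r < k, u r = res r (idx r)
  norm_le : ∀ r < k, ∀ t, ‖res r t‖ ≤ ‖u r‖
  res_succ : ∀ r < k, ∀ t,
    res (r + 1) t = res r t - (inner ℝ (res r t) (u r) / inner ℝ (u r) (u r) : ℝ) • u r

namespace IsPivotedGramSchmidt

variable {k : ℕ} {res : ℕ → T → E} {u : ℕ → E} {idx : ℕ → T}

lemma inner_res (h : IsPivotedGramSchmidt k res u idx) :
    ∀ s ≤ k, ∀ r < s, ∀ t, (inner ℝ (res s t) (u r) : ℝ) = 0 := by
  intro s hs
  induction s with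
  | zero => intro r hr; omega
  | succ s ih =>
    intro r hr t
    rw [h.res_succ s (by omega), inner_sub_left, inner_smul_left, RCLike.conj_to_real]
    rcases Nat.lt_succ_iff_lt_or_eq.mp hr with hrs | rfl
    · have h1 := ih (by omega) r hrs
      rw [h1 t, h.u_eq s (by omega), h1, mul_zero, sub_zero]
    · by_cases hu : u r = 0
      · simp [hu]
      · have : (inner ℝ (u r) (u r) : ℝ) ≠ 0 := inner_self_ne_zero.mpr hu
        field_simp
        ring

lemma inner_u (h : IsPivotedGramSchmidt k res u idx) {r s : ℕ} (hr : r < k) (hs : s < k)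
    (hrs : r ≠ s) : (inner ℝ (u r) (u s) : ℝ) = 0 := by
  rcases lt_or_gt_of_ne hrs with h1 | h1
  · rw [real_inner_comm, h.u_eq s hs]; exact h.inner_res s hs.le r h1 _
  · rw [h.u_eq r hr]; exact h.inner_res r hr.le s h1 _

lemma norm_res_succ_le (h : IsPivotedGramSchmidt k res u idx) {s : ℕ} (hs : s < k) (t : T) :
    ‖res (s + 1) t‖ ≤ ‖res s t‖ := by
  have h1 := h.inner_res (s + 1) hs s (Nat.lt_succ_self s) t
  have h2 : res s t = res (s + 1) t +
      (inner ℝ (res s t) (u s) / inner ℝ (u s) (u s) : ℝ) • u s := by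
    rw [h.res_succ s hs]; abel
  have h3 : ‖res (s + 1) t‖ ^ 2 ≤ ‖res s t‖ ^ 2 := by
    conv_rhs => rw [h2]
    rw [norm_add_sq_real, inner_smul_right, h1]
    have := sq_nonneg ‖(inner ℝ (res s t) (u s) / inner ℝ (u s) (u s) : ℝ) • u s‖
    linarith
  exact (sq_le_sq₀ (norm_nonneg _) (norm_nonneg _)).mp h3

lemma norm_res_le (h : IsPivotedGramSchmidt k res u idx) {r s : ℕ} (hrs : r ≤ s) (hs : s ≤ k)
    (t : T) : ‖res s t‖ ≤ ‖res r t‖ := by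
  induction s, hrs using Nat.le_induction with
  | base => exact le_rfl
  | succ s _ ih => exact (h.norm_res_succ_le (by omega) t).trans (ih (by omega))

lemma sub_mem_span (h : IsPivotedGramSchmidt k res u idx) {s : ℕ} (hs : s ≤ k) (t : T) :
    res 0 t - res s t ∈ Submodule.span ℝ (u '' Set.Iio s) := by
  induction s with
  | zero => simp
  | succ s ih =>
    rw [h.res_succ s (by omega), ← sub_add]
    refine add_mem (Submodule.span_mono (Set.image_mono (Set.Iio_subset_Iio (Nat.le_succ s)))
      (ih (by omega))) (Submodule.smul_mem _ _ (Submodule.subset_span ⟨s, ?_, rfl⟩))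
    exact Nat.lt_succ_self s

lemma inner_res_zero (h : IsPivotedGramSchmidt k res u idx) {s : ℕ} (hs : s ≤ k) (t : T) (x : E)
    (hx : ∀ r < s, (inner ℝ (u r) x : ℝ) = 0) :
    (inner ℝ (res 0 t) x : ℝ) = inner ℝ (res s t) x := by
  rw [← sub_eq_zero, ← inner_sub_left]
  have hmem := h.sub_mem_span hs t
  generalize res 0 t - res s t = v at hmem
  induction hmem using Submodule.span_induction with
  | mem y hy => obtain ⟨r, hr, rfl⟩ := hy; exact hx r hr
  | zero => simp
  | add y z _ _ h1 h2 => rw [inner_add_left, h1, h2, add_zero]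
  | smul a y _ h1 => rw [inner_smul_left, h1, mul_zero]

lemma res_idx_eq_zero (h : IsPivotedGramSchmidt k res u idx) {r s : ℕ} (hrs : r < s) (hs : s ≤ k)
    (hu : u r ≠ 0) : res s (idx r) = 0 := by
  have h1 : res (r + 1) (idx r) = 0 := by
    rw [h.res_succ r (by omega), ← h.u_eq r (by omega),
      div_self (inner_self_ne_zero.mpr hu), one_smul, sub_self]
  have h2 := h.norm_res_le (r := r + 1) (s := s) hrs hs (idx r)
  rw [h1, norm_zero] at h2
  exact norm_le_zero_iff.mp h2

/-- If the vectors are `τ`-close to a space of dimension at most `k`, then after `k` rounds all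
residuals are small.  Otherwise the `k` pivots and one more vector form a well conditioned
family, while their exact counterparts are linearly dependent. -/
theorem norm_res_final_le (h : IsPivotedGramSchmidt k res u idx) {τ : ℝ}
    {g : T → E} (W : Submodule ℝ E) [FiniteDimensional ℝ W] (hW : Module.finrank ℝ W ≤ k)
    (hgW : ∀ t, g t ∈ W) (hg : ∀ t, ‖res 0 t - g t‖ ≤ τ) (t : T) :
    ‖res k t‖ ≤ 2 ^ (k + 1) * τ := by
  have hτ : 0 ≤ τ := (norm_nonneg _).trans (hg t)
  rcases eq_or_lt_of_le (norm_nonneg (res k t)) with hρ | hρ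
  · rw [← hρ]; positivity
  set ρ := ‖res k t‖
  let idx' : ℕ → T := fun r => if r < k then idx r else t
  let u' : ℕ → E := fun r => res r (idx' r)
  have hu' : ∀ r < k, u' r = u r := by
    intro r hr; simp only [u', idx', if_pos hr, h.u_eq r hr]
  have hρu : ∀ r ≤ k, ρ ≤ ‖u' r‖ := by
    intro r hr
    rcases hr.lt_or_eq with hr | rfl
    · rw [hu' r hr]
      exact (h.norm_res_le hr.le le_rfl t).trans (h.norm_le r hr t)
    · simp [u', idx', ρ]
  obtain ⟨c, hc0, hcne⟩ : ∃ c : Fin (k + 1) → ℝ, ∑ r, c r • g (idx' r) = 0 ∧ ∃ r, c r ≠ 0 := by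
    have hdep : ¬ LinearIndependent ℝ (fun r : Fin (k + 1) => (⟨g (idx' r), hgW _⟩ : W)) := by
      intro hli
      have := hli.fintype_card_le_finrank
      rw [Fintype.card_fin] at this
      omega
    obtain ⟨c, hc, hne⟩ := Fintype.not_linearIndependent_iff.mp hdep
    refine ⟨c, ?_, hne⟩
    have := congrArg (Submodule.subtype W) hc
    simpa using this
  let C : ℕ → ℝ := fun r => if hr : r < k + 1 then c ⟨r, hr⟩ else 0
  let y := ∑ r ∈ Finset.range (k + 1), C r • res 0 (idx' r)
  let A : ℕ → ℝ := fun s => ∑ r ∈ Finset.Ico s (k + 1), |C r|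
  -- `y` is the vanishing combination of the exact vectors, formed with the perturbed ones; as the
  -- residuals at the pivots are triangular, it determines the coefficients by back-substitution.
  have hC : ∀ f : ℕ → E, ∑ r ∈ Finset.range (k + 1), C r • f r = ∑ r : Fin (k + 1), c r • f r := by
    intro f
    rw [Finset.sum_range]
    exact Finset.sum_congr rfl fun r _ => by simp only [C, dif_pos r.2]
  have hy : ‖y‖ ≤ τ * A 0 := by
    have : y = ∑ r ∈ Finset.range (k + 1), C r • (res 0 (idx' r) - g (idx' r)) := by
      simp only [smul_sub, Finset.sum_sub_distrib]
      rw [hC (fun r => g (idx' r)), hc0, sub_zero]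
    rw [this]
    refine (norm_sum_le _ _).trans ?_
    simp only [A, ← Finset.range_eq_Ico, Finset.mul_sum]
    refine Finset.sum_le_sum fun r _ => ?_
    rw [norm_smul, mul_comm, Real.norm_eq_abs]
    exact mul_le_mul_of_nonneg_right (hg _) (abs_nonneg _)
  have hstep : ∀ s ≤ k, |C s| ≤ ‖y‖ / ρ + A (s + 1) := by
    intro s hs
    have hus : 0 < ‖u' s‖ := hρ.trans_le (hρu s hs)
    have hin : ∀ r, (inner ℝ (res 0 (idx' r)) (u' s) : ℝ) = inner ℝ (res s (idx' r)) (u' s) := by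
      intro r
      refine h.inner_res_zero hs _ _ fun q hq => ?_
      rw [real_inner_comm]; exact h.inner_res s hs q hq _
    have h1 : (inner ℝ y (u' s) : ℝ) = C s * ‖u' s‖ ^ 2 +
        ∑ r ∈ Finset.Ico (s + 1) (k + 1), C r * inner ℝ (res s (idx' r)) (u' s) := by
      simp only [y, sum_inner, inner_smul_left, RCLike.conj_to_real, hin]
      rw [← Finset.sum_range_add_sum_Ico _ (show s + 1 ≤ k + 1 by omega), Finset.sum_range_succ,
        Finset.sum_eq_zero, zero_add]
      · simp only [u', real_inner_self_eq_norm_sq]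
      · intro r hr
        have hrs := Finset.mem_range.mp hr
        have hrk : r < k := by omega
        have : res s (idx' r) = 0 := by
          simp only [idx', if_pos hrk]
          refine h.res_idx_eq_zero hrs hs ?_
          rw [← hu' r hrk]
          exact norm_pos_iff.mp (hρ.trans_le (hρu r hrk.le))
        rw [this, inner_zero_left, mul_zero]
    have h2 : |∑ r ∈ Finset.Ico (s + 1) (k + 1), C r * inner ℝ (res s (idx' r)) (u' s)| ≤
        A (s + 1) * ‖u' s‖ ^ 2 := by
      refine (Finset.abs_sum_le_sum_abs _ _).trans ?_
      simp only [A, Finset.sum_mul]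
      refine Finset.sum_le_sum fun r hr => ?_
      have hsk : s < k := by have := Finset.mem_Ico.mp hr; omega
      rw [abs_mul]
      refine mul_le_mul_of_nonneg_left ?_ (abs_nonneg _)
      refine (abs_real_inner_le_norm _ _).trans ?_
      rw [pow_two]
      refine mul_le_mul_of_nonneg_right ?_ (norm_nonneg _)
      rw [hu' s hsk]
      exact h.norm_le s hsk _
    have h3 : |(inner ℝ y (u' s) : ℝ)| ≤ ‖y‖ / ρ * ‖u' s‖ ^ 2 := by
      refine (abs_real_inner_le_norm _ _).trans ?_
      rw [div_mul_eq_mul_div, le_div_iff₀ hρ, mul_assoc, pow_two]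
      gcongr
      exact hρu s hs
    have h4 : |C s| * ‖u' s‖ ^ 2 ≤ (‖y‖ / ρ + A (s + 1)) * ‖u' s‖ ^ 2 := by
      rw [← abs_of_nonneg (sq_nonneg ‖u' s‖), ← abs_mul, abs_of_nonneg (sq_nonneg ‖u' s‖)]
      have : C s * ‖u' s‖ ^ 2 = (inner ℝ y (u' s) : ℝ) -
        ∑ r ∈ Finset.Ico (s + 1) (k + 1), C r * inner ℝ (res s (idx' r)) (u' s) := by
        rw [h1]; ring
      rw [this, add_mul]
      exact (abs_sub _ _).trans (add_le_add h3 h2)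
    exact le_of_mul_le_mul_right h4 (by positivity)
  -- Solving the recursion `hstep` from the last coefficient backwards.
  have hA : ∀ j ≤ k + 1, A (k + 1 - j) ≤ (2 ^ j - 1) * (‖y‖ / ρ) := by
    intro j hj
    induction j with
    | zero => simp [A]
    | succ j ih =>
      have h1 := ih (by omega)
      have h2 := hstep (k + 1 - (j + 1)) (by omega)
      have h3 : A (k + 1 - (j + 1)) = |C (k + 1 - (j + 1))| + A (k + 1 - (j + 1) + 1) := by
        simp only [A]
        rw [Finset.sum_eq_sum_Ico_succ_bot (by omega)]
      rw [show k + 1 - (j + 1) + 1 = k + 1 - j by omega] at h2 h3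
      rw [pow_succ]
      linarith
  have hA0 : 0 < A 0 := by
    obtain ⟨r, hr⟩ := hcne
    refine Finset.sum_pos' (fun _ _ => abs_nonneg _) ⟨r, ?_, ?_⟩
    · simpa using r.2
    · simp only [C, dif_pos r.2]
      exact abs_pos.mpr hr
  have h1 := hA (k + 1) le_rfl
  rw [Nat.sub_self] at h1
  have h2 : (2 ^ (k + 1) - 1) * (‖y‖ / ρ) ≤ 2 ^ (k + 1) * (τ * A 0 / ρ) := by
    have h3 : ‖y‖ / ρ ≤ τ * A 0 / ρ := by gcongr
    have h4 : 0 ≤ ‖y‖ / ρ := by positivity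
    have h5 : (1 : ℝ) ≤ 2 ^ (k + 1) := one_le_pow₀ (by norm_num)
    nlinarith
  have h3 := h1.trans h2
  rw [mul_div_assoc', le_div_iff₀ hρ] at h3
  have h4 : A 0 * ρ ≤ A 0 * (2 ^ (k + 1) * τ) := by linarith
  exact le_of_mul_le_mul_left h4 hA0

end IsPivotedGramSchmidt

end Greedy

/-! ### Projection onto low-degree functions of few coordinates -/

section Projection

set_option linter.unusedSectionVars false

variable {E : Type*} [NormedAddCommGroup E] [InnerProductSpace ℝ E] [FiniteDimensional ℝ E]
  [MeasurableSpace E] [BorelSpace E] {J : Type*} [Fintype J] [DecidableEq J]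

/-- The multi-indices bounded by `L`. -/
def boxIndex (L : J → ℕ) : Finset (J → ℕ) := Fintype.piFinset fun j => Finset.range (L j + 1)

/-- The reproducing kernel of the span of the Hermite functions with multi-index bounded by `L`. -/
noncomputable def boxKernel (b : OrthonormalBasis J ℝ E) (L : J → ℕ) (x y : E) : ℝ :=
  ∏ j, ∑ n ∈ Finset.range (L j + 1),
    He n (inner ℝ (b j) x) 1 * He n (inner ℝ (b j) y) 1 / (n.factorial : ℝ)

/-- The orthogonal projection onto the span of the Hermite functions with multi-index bounded
by `L`. -/
noncomputable def boxProj (b : OrthonormalBasis J ℝ E) (L : J → ℕ) (f : E → ℝ) (x : E) : ℝ :=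
  ∑ l ∈ boxIndex L, (∫ y, f y * hermiteFun b l y ∂(stdGaussian E)) /
    (∏ j, ((l j).factorial : ℝ)) * hermiteFun b l x

variable (b : OrthonormalBasis J ℝ E) (L : J → ℕ)

lemma boxKernel_eq (x y : E) :
    boxKernel b L x y = ∑ l ∈ boxIndex L,
      hermiteFun b l x * hermiteFun b l y / ∏ j, ((l j).factorial : ℝ) := by
  rw [boxKernel, Finset.prod_univ_sum]
  refine Finset.sum_congr rfl fun l _ => ?_
  rw [hermiteFun, hermiteFun, ← Finset.prod_mul_distrib, ← Finset.prod_div_distrib]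

lemma continuous_boxKernel : Continuous fun p : E × E => boxKernel b L p.1 p.2 := by
  simp only [boxKernel_eq]
  refine continuous_finsetSum _ fun l _ => ?_
  have := continuous_hermiteFun b l
  fun_prop

lemma memLp_boxProj (f : E → ℝ) : MemLp (boxProj b L f) 2 (stdGaussian E) :=
  memLp_finsetSum _ fun l _ => (memLp_hermiteFun b l).const_mul _

lemma integral_mul_boxKernel {f : E → ℝ} (hf : MemLp f 2 (stdGaussian E)) (x : E) :
    ∫ y, f y * boxKernel b L x y ∂(stdGaussian E) = boxProj b L f x := by
  have e : ∀ y, f y * boxKernel b L x y = ∑ l ∈ boxIndex L,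
      (hermiteFun b l x / ∏ j, ((l j).factorial : ℝ)) * (f y * hermiteFun b l y) := by
    intro y
    rw [boxKernel_eq, Finset.mul_sum]
    exact Finset.sum_congr rfl fun l _ => by ring
  simp_rw [e]
  rw [integral_finsetSum _ fun l _ =>
    (integrable_mul_of_memLp hf (memLp_hermiteFun b l)).const_mul _, boxProj]
  refine Finset.sum_congr rfl fun l _ => ?_
  rw [integral_const_mul]; ring

lemma integral_sub_boxProj_mul_hermiteFun {f : E → ℝ} (hf : MemLp f 2 (stdGaussian E))
    {l : J → ℕ} (hl : l ∈ boxIndex L) :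
    ∫ x, (f x - boxProj b L f x) * hermiteFun b l x ∂(stdGaussian E) = 0 := by
  simp_rw [sub_mul]
  rw [integral_sub (integrable_mul_of_memLp hf (memLp_hermiteFun b l))
    (integrable_mul_of_memLp (memLp_boxProj b L f) (memLp_hermiteFun b l))]
  simp_rw [boxProj, Finset.sum_mul, mul_assoc]
  rw [integral_finsetSum _ fun m _ => (integrable_hermiteFun_mul b _ _).const_mul _]
  simp_rw [integral_const_mul, integral_hermiteFun_mul]
  rw [Finset.sum_eq_single l (fun m _ hm => by rw [if_neg hm, mul_zero])
    (fun h => absurd hl h), if_pos rfl, div_mul_cancel₀, sub_self]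
  exact Finset.prod_ne_zero_iff.mpr fun j _ => by positivity

lemma memLp_of_mem_span {G : E → ℝ}
    (hG : G ∈ Submodule.span ℝ (hermiteFun b '' (boxIndex L : Set (J → ℕ)))) :
    MemLp G 2 (stdGaussian E) := by
  induction hG using Submodule.span_induction with
  | mem x hx => obtain ⟨l, -, rfl⟩ := hx; exact memLp_hermiteFun b l
  | zero => exact MemLp.zero
  | add x y _ _ hx hy => exact hx.add hy
  | smul a x _ hx => exact hx.const_smul a

/-- The projection is the best approximation from its range. -/
lemma integral_sub_boxProj_sq_le {f G : E → ℝ} (hf : MemLp f 2 (stdGaussian E))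
    (hG : G ∈ Submodule.span ℝ (hermiteFun b '' (boxIndex L : Set (J → ℕ)))) :
    ∫ x, (f x - boxProj b L f x) ^ 2 ∂(stdGaussian E) ≤
      ∫ x, (f x - G x) ^ 2 ∂(stdGaussian E) := by
  have hP : boxProj b L f ∈ Submodule.span ℝ (hermiteFun b '' (boxIndex L : Set (J → ℕ))) := by
    have : boxProj b L f = ∑ l ∈ boxIndex L, ((∫ y, f y * hermiteFun b l y ∂(stdGaussian E)) /
      (∏ j, ((l j).factorial : ℝ))) • hermiteFun b l := by
      ext x; simp [boxProj]
    rw [this]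
    exact Submodule.sum_mem _ fun l hl =>
      Submodule.smul_mem _ _ (Submodule.subset_span ⟨l, hl, rfl⟩)
  set D := boxProj b L f - G with hD
  have hDm := sub_mem hP hG
  rw [← hD] at hDm
  have hDL := memLp_of_mem_span b L hDm
  have hfP : MemLp (fun x => f x - boxProj b L f x) 2 (stdGaussian E) :=
    hf.sub (memLp_boxProj b L f)
  have horth : ∀ D ∈ Submodule.span ℝ (hermiteFun b '' (boxIndex L : Set (J → ℕ))),
      ∫ x, (f x - boxProj b L f x) * D x ∂(stdGaussian E) = 0 := by
    intro D hDm
    induction hDm using Submodule.span_induction with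
    | mem x hx =>
      obtain ⟨l, hl, rfl⟩ := hx
      exact integral_sub_boxProj_mul_hermiteFun b L hf hl
    | zero => simp
    | add x y hx hy h1 h2 =>
      simp only [Pi.add_apply, mul_add]
      rw [integral_add (integrable_mul_of_memLp hfP (memLp_of_mem_span b L hx))
        (integrable_mul_of_memLp hfP (memLp_of_mem_span b L hy)), h1, h2, add_zero]
    | smul a x _ h1 =>
      simp only [Pi.smul_apply, smul_eq_mul, mul_left_comm _ a]
      rw [integral_const_mul, h1, mul_zero]
  have e : ∀ x, (f x - G x) ^ 2 = (f x - boxProj b L f x) ^ 2 +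
      2 * ((f x - boxProj b L f x) * D x) + D x ^ 2 := by
    intro x; simp only [hD, Pi.sub_apply]; ring
  simp_rw [e]
  rw [integral_add (f := fun x => (f x - boxProj b L f x) ^ 2 +
      2 * ((f x - boxProj b L f x) * D x))
    (hfP.integrable_sq.add ((integrable_mul_of_memLp hfP hDL).const_mul 2)) hDL.integrable_sq,
    integral_add hfP.integrable_sq ((integrable_mul_of_memLp hfP hDL).const_mul 2),
    integral_const_mul, horth D hDm]
  have : 0 ≤ ∫ x, D x ^ 2 ∂(stdGaussian E) := integral_nonneg fun x => sq_nonneg _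
  linarith

lemma integral_boxKernel_sq (y : E) :
    ∫ x, boxKernel b L x y ^ 2 ∂(stdGaussian E) =
      ∑ l ∈ boxIndex L, hermiteFun b l y ^ 2 / ∏ j, ((l j).factorial : ℝ) := by
  have e : ∀ x, boxKernel b L x y ^ 2 = ∑ l ∈ boxIndex L, ∑ m ∈ boxIndex L,
      (hermiteFun b l y / (∏ j, ((l j).factorial : ℝ)) *
        (hermiteFun b m y / ∏ j, ((m j).factorial : ℝ))) *
        (hermiteFun b l x * hermiteFun b m x) := by
    intro x
    rw [boxKernel_eq, pow_two, Finset.sum_mul_sum]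
    exact Finset.sum_congr rfl fun l _ => Finset.sum_congr rfl fun m _ => by ring
  simp_rw [e]
  rw [integral_finsetSum _ fun l _ => integrable_finsetSum _ fun m _ =>
    (integrable_hermiteFun_mul b l m).const_mul _]
  refine Finset.sum_congr rfl fun l hl => ?_
  rw [integral_finsetSum _ fun m _ => (integrable_hermiteFun_mul b l m).const_mul _]
  simp_rw [integral_const_mul, integral_hermiteFun_mul]
  rw [Finset.sum_eq_single l (fun m _ hm => by rw [if_neg hm.symm, mul_zero])
    (fun h => absurd hl h), if_pos rfl]
  have : (∏ j, ((l j).factorial : ℝ)) ≠ 0 := Finset.prod_ne_zero_iff.mpr fun j _ => by positivity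
  field_simp

lemma memLp_boxKernel (y : E) : MemLp (fun x => boxKernel b L x y) 2 (stdGaussian E) := by
  simp only [boxKernel_eq, mul_div_assoc]
  exact memLp_finsetSum _ fun l _ => (memLp_hermiteFun b l).mul_const _

lemma integrable_norm_sq_mul_boxKernel_sq (x : E) :
    Integrable (fun y => ‖y‖ ^ 2 * boxKernel b L x y ^ 2) (stdGaussian E) := by
  have e : ∀ y, ‖y‖ ^ 2 * boxKernel b L x y ^ 2 = (‖y‖ * boxKernel b L x y) ^ 2 := by
    intro y; ring
  simp_rw [e]
  refine MemLp.integrable_sq ?_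
  have e2 : (fun y => ‖y‖ * boxKernel b L x y) = fun y => ∑ l ∈ boxIndex L,
      (hermiteFun b l x / ∏ j, ((l j).factorial : ℝ)) * (‖y‖ * hermiteFun b l y) := by
    ext y
    rw [boxKernel_eq, Finset.mul_sum]
    exact Finset.sum_congr rfl fun l _ => by ring
  rw [e2]
  refine memLp_finsetSum _ fun l _ => MemLp.const_mul ?_ _
  have hc := continuous_hermiteFun b l
  rw [memLp_two_iff_integrable_sq (by fun_prop)]
  simpa only [mul_pow] using integrable_norm_sq_mul_hermiteFun_sq b l

/-- The second moment of the kernel estimator of a function bounded by the norm. -/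
lemma lintegral_norm_sq_mul_boxKernel_sq_le :
    ∫⁻ x, ∫⁻ y, ENNReal.ofReal (‖y‖ ^ 2 * boxKernel b L x y ^ 2)
      ∂(stdGaussian E) ∂(stdGaussian E) ≤
      ENNReal.ofReal ((∏ j, ((L j : ℝ) + 1)) * ∑ j, (2 * (L j : ℝ) + 1)) := by
  have hm : Measurable fun p : E × E => ENNReal.ofReal (‖p.2‖ ^ 2 * boxKernel b L p.1 p.2 ^ 2) := by
    have := continuous_boxKernel b L
    exact ENNReal.measurable_ofReal.comp (by fun_prop : Continuous _).measurable
  rw [lintegral_lintegral_swap hm.aemeasurable]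
  have h1 : ∀ y, ∫⁻ x, ENNReal.ofReal (‖y‖ ^ 2 * boxKernel b L x y ^ 2) ∂(stdGaussian E) =
      ENNReal.ofReal (∑ l ∈ boxIndex L,
        (∏ j, ((l j).factorial : ℝ))⁻¹ * (‖y‖ ^ 2 * hermiteFun b l y ^ 2)) := by
    intro y
    rw [← ofReal_integral_eq_lintegral_ofReal ((memLp_boxKernel b L y).integrable_sq.const_mul _)
      (Filter.Eventually.of_forall fun x => by positivity), integral_const_mul,
      integral_boxKernel_sq, Finset.mul_sum]
    congr 1
    exact Finset.sum_congr rfl fun l _ => by ring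
  simp_rw [h1]
  rw [← ofReal_integral_eq_lintegral_ofReal
    (integrable_finsetSum _ fun l _ => (integrable_norm_sq_mul_hermiteFun_sq b l).const_mul _)
    (Filter.Eventually.of_forall fun x => Finset.sum_nonneg fun l _ => by positivity)]
  refine ENNReal.ofReal_le_ofReal ?_
  rw [integral_finsetSum _ fun l _ => (integrable_norm_sq_mul_hermiteFun_sq b l).const_mul _]
  simp_rw [integral_const_mul, integral_norm_sq_mul_hermiteFun_sq]
  calc _ ≤ ∑ l ∈ boxIndex L, ∑ j, (2 * (L j : ℝ) + 1) := by
        refine Finset.sum_le_sum fun l hl => ?_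
        rw [inv_mul_cancel_left₀ (Finset.prod_ne_zero_iff.mpr fun j _ => by positivity)]
        refine Finset.sum_le_sum fun j _ => ?_
        have : l j ≤ L j := by
          have := Fintype.mem_piFinset.mp hl j
          simp at this; omega
        have : (l j : ℝ) ≤ L j := by exact_mod_cast this
        linarith
    _ = _ := by
        rw [Finset.sum_const, boxIndex, Fintype.card_piFinset]
        simp

/-- Hermite polynomials of linear forms supported on the chosen coordinates lie in the range of the
projection. -/
lemma He_inner_mem_span {l : ℕ} {v : E}
    (hv : ∀ j, L j = l ∨ (inner ℝ (b j) v : ℝ) = 0) {m : ℕ} (hm : m ≤ l) :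
    (fun x => He m (inner ℝ v x) (‖v‖ ^ 2)) ∈
      Submodule.span ℝ (hermiteFun b '' (boxIndex L : Set (J → ℕ))) := by
  have e : (fun x => He m (inner ℝ v x) (‖v‖ ^ 2)) = ∑ n ∈ Finset.univ.finsuppAntidiag m,
      ((m.factorial : ℝ) * ∏ j, (inner ℝ (b j) v ^ n j / ((n j).factorial : ℝ))) •
        hermiteFun b n := by
    ext x
    simp only [He_inner_eq_sum b, Finset.mul_sum, Finset.sum_apply, Pi.smul_apply, smul_eq_mul,
      mul_assoc]
  rw [e]
  refine Submodule.sum_mem _ fun n hn => ?_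
  by_cases h : ∀ j, n j ≤ L j
  · refine Submodule.smul_mem _ _ (Submodule.subset_span ⟨n, ?_, rfl⟩)
    simp only [boxIndex, Finset.mem_coe, Fintype.mem_piFinset, Finset.mem_range]
    intro j; have := h j; omega
  · push Not at h
    obtain ⟨j, hj⟩ := h
    have h1 : n j ≤ m := by
      rw [← (Finset.mem_finsuppAntidiag.mp hn).1]
      exact Finset.single_le_sum (f := fun j => n j) (fun _ _ => Nat.zero_le _) (Finset.mem_univ j)
    have h2 : (inner ℝ (b j) v : ℝ) = 0 := by
      rcases hv j with h3 | h3
      · omega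
      · exact h3
    rw [Finset.prod_eq_zero (Finset.mem_univ j), mul_zero, zero_smul]
    · exact Submodule.zero_mem _
    · rw [h2, zero_pow (by omega), zero_div]

end Projection

section SampleMean

variable {Ω : Type*} [MeasurableSpace Ω] {μ : Measure Ω} [IsProbabilityMeasure μ]

/-- The mean square error of an average of independent copies. -/
lemma lintegral_sampleMean_sub_sq_le {T : Type*} [Fintype T] {f : Ω → ℝ} (hf : MemLp f 2 μ)
    (S : Finset T) (hS : S.Nonempty) :
    ∫⁻ X : T → Ω, ENNReal.ofReal (((S.card : ℝ)⁻¹ * ∑ j ∈ S, f (X j) - ∫ x, f x ∂μ) ^ 2)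
      ∂(Measure.pi fun _ => μ) ≤ ENNReal.ofReal ((S.card : ℝ)⁻¹ * ∫ x, f x ^ 2 ∂μ) := by
  have hcard : (0 : ℝ) < S.card := by exact_mod_cast hS.card_pos
  have hmp : ∀ j : T, MeasurePreserving (Function.eval j) (Measure.pi fun _ : T => μ) μ :=
    fun j => measurePreserving_eval (fun _ => μ) j
  let Z : T → (T → Ω) → ℝ := fun j X => f (X j)
  have hZ : ∀ j, MemLp (Z j) 2 (Measure.pi fun _ : T => μ) := fun j =>
    hf.comp_measurePreserving (hmp j)
  have hind : iIndepFun Z (Measure.pi fun _ : T => μ) :=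
    iIndepFun_pi (X := fun _ => f) fun _ => hf.1.aemeasurable
  have hvar : Var[∑ j ∈ S, Z j; Measure.pi fun _ : T => μ] = S.card * Var[f; μ] := by
    rw [IndepFun.variance_sum (fun j _ => hZ j) (fun i _ j _ hij => hind.indepFun hij)]
    have : ∀ j ∈ S, Var[Z j; Measure.pi fun _ : T => μ] = Var[f; μ] := by
      intro j _
      exact (hmp j).variance_fun_comp hf.1.aemeasurable
    rw [Finset.sum_congr rfl this]; simp
  have hmean : ∫ X, (S.card : ℝ)⁻¹ * ∑ j ∈ S, f (X j) ∂(Measure.pi fun _ : T => μ) =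
      ∫ x, f x ∂μ := by
    rw [integral_const_mul, integral_finsetSum _ fun j _ => (hZ j).integrable (by norm_num)]
    have : ∀ j ∈ S, ∫ X, f (X j) ∂(Measure.pi fun _ : T => μ) = ∫ x, f x ∂μ := by
      intro j _
      conv_rhs => rw [← (hmp j).map_eq]
      rw [integral_map (hmp j).measurable.aemeasurable (by rw [(hmp j).map_eq]; exact hf.1)]
    rw [Finset.sum_congr rfl this]
    simp [hcard.ne']
  have hm2 : MemLp (fun X : T → Ω => (S.card : ℝ)⁻¹ * ∑ j ∈ S, f (X j)) 2
      (Measure.pi fun _ : T => μ) := (memLp_finsetSum S fun j _ => hZ j).const_mul _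
  have hev := evariance_eq_lintegral_ofReal (fun X : T → Ω => (S.card : ℝ)⁻¹ * ∑ j ∈ S, f (X j))
    (Measure.pi fun _ : T => μ)
  rw [hmean] at hev
  rw [← hev, ← hm2.ofReal_variance_eq]
  refine ENNReal.ofReal_le_ofReal ?_
  have h1 := variance_const_mul (S.card : ℝ)⁻¹ (∑ j ∈ S, Z j) (Measure.pi fun _ : T => μ)
  rw [hvar] at h1
  have h2 : (fun ω => (S.card : ℝ)⁻¹ * (∑ j ∈ S, Z j) ω) =
      fun X : T → Ω => (S.card : ℝ)⁻¹ * ∑ j ∈ S, f (X j) := by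
    ext X; simp [Z]
  rw [h2] at h1
  rw [h1, pow_two, mul_assoc, inv_mul_cancel_left₀ hcard.ne']
  exact mul_le_mul_of_nonneg_left (variance_le_expectation_sq hf.1) (by positivity)

end SampleMean

/-! ### The kernel of an orthogonal family -/

section QueryKernel

variable {E : Type*} [NormedAddCommGroup E] [InnerProductSpace ℝ E]

/-- The reproducing kernel of the polynomials of degree at most `l` in the linear form `u`, written
without square roots. For `u = 0` it is the constant `1`, by the convention `0 / 0 = 0`. -/
noncomputable def queryFactor (l : ℕ) (u x y : E) : ℝ :=
  ∑ n ∈ Finset.range (l + 1), He n (inner ℝ u x) (‖u‖ ^ 2) * He n (inner ℝ u y) (‖u‖ ^ 2) /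
    ((‖u‖ ^ 2) ^ n * n.factorial)

/-- The kernel by which a hypothesis is evaluated. -/
noncomputable def queryKernel {ι : Type*} [Fintype ι] (l : ℕ) (u : ι → E) (x y : E) : ℝ :=
  ∏ i, queryFactor l (u i) x y

/-- A zero pivot contributes the trivial factor: in the terms of positive degree the quotient by
zero is zero. -/
lemma queryFactor_zero (l : ℕ) (x y : E) : queryFactor l 0 x y = 1 := by
  rw [queryFactor, Finset.sum_eq_single 0]
  · simp [He]
  · intro n _ hn; simp [hn]
  · simp

lemma queryFactor_of_ne_zero (l : ℕ) {u : E} (hu : u ≠ 0) (x y : E) :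
    queryFactor l u x y = ∑ n ∈ Finset.range (l + 1),
      He n (inner ℝ ((‖u‖⁻¹ : ℝ) • u) x) 1 * He n (inner ℝ ((‖u‖⁻¹ : ℝ) • u) y) 1 /
        (n.factorial : ℝ) := by
  have hn : ‖u‖ ≠ 0 := norm_ne_zero_iff.mpr hu
  have h1 : (‖u‖⁻¹) ^ 2 * ‖u‖ ^ 2 = 1 := by rw [← mul_pow, inv_mul_cancel₀ hn, one_pow]
  refine Finset.sum_congr rfl fun n _ => ?_
  rw [real_inner_smul_left, real_inner_smul_left]
  conv_rhs => rw [← h1, He_smul, He_smul]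
  have h2 : (‖u‖⁻¹) ^ n * ‖u‖ ^ n = 1 := by rw [← mul_pow, inv_mul_cancel₀ hn, one_pow]
  have h3 : (‖u‖ ^ 2) ^ n = (‖u‖ ^ n) ^ 2 := by rw [← pow_mul, mul_comm, pow_mul]
  have h4 : ‖u‖ ^ n ≠ 0 := pow_ne_zero n hn
  rw [h3, eq_inv_of_mul_eq_one_left h2]
  field_simp

variable [FiniteDimensional ℝ E]

/-- The kernel of an orthogonal family is a box kernel in an orthonormal basis that extends the
normalised family. -/
lemma exists_boxKernel_eq {k : ℕ} {u : Fin k → E}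
    (hu : ∀ i j, i ≠ j → (inner ℝ (u i) (u j) : ℝ) = 0) (l : ℕ) :
    ∃ (J : Finset E) (b : OrthonormalBasis J ℝ E) (L : J → ℕ),
      (∀ x y, queryKernel l u x y = boxKernel b L x y) ∧
      (∀ v ∈ Submodule.span ℝ (Set.range u), ∀ j, L j = l ∨ (inner ℝ (b j) v : ℝ) = 0) ∧
      ∏ j, ((L j : ℝ) + 1) ≤ (l + 1) ^ k ∧
      ∑ j, (2 * (L j : ℝ) + 1) ≤ 2 * k * l + Module.finrank ℝ E := by
  classical
  let n : Fin k → E := fun i => (‖u i‖⁻¹ : ℝ) • u i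
  have hn1 : ∀ i, u i ≠ 0 → ‖n i‖ = 1 := by
    intro i hi
    simp [n, norm_smul, inv_mul_cancel₀ (norm_ne_zero_iff.mpr hi)]
  have hn0 : ∀ i j, i ≠ j → (inner ℝ (n i) (n j) : ℝ) = 0 := by
    intro i j hij
    simp [n, real_inner_smul_left, real_inner_smul_right, hu i j hij]
  let S : Set E := n '' {i | u i ≠ 0}
  have hS : Orthonormal ℝ ((↑) : S → E) := by
    constructor
    · rintro ⟨_, i, hi, rfl⟩; exact hn1 i hi
    · rintro ⟨_, i, hi, rfl⟩ ⟨_, j, hj, rfl⟩ hij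
      refine hn0 i j ?_
      rintro rfl; exact hij rfl
  obtain ⟨J, b, hSJ, hb⟩ := hS.exists_orthonormalBasis_extension
  let L : J → ℕ := fun j => if (j : E) ∈ S then l else 0
  have hinj : Set.InjOn n {i | u i ≠ 0} := by
    intro i hi j hj hij
    by_contra h
    have h1 := hn0 i j h
    rw [hij, real_inner_self_eq_norm_sq, hn1 j hj] at h1
    norm_num at h1
  let I : Finset (Fin k) := Finset.univ.filter fun i => u i ≠ 0
  let e : Fin k → Option J := fun i => if h : u i ≠ 0 then some ⟨n i, hSJ ⟨i, h, rfl⟩⟩ else none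
  have hIk : I.card ≤ k := by
    have := Finset.card_le_univ I; simpa using this
  let e' : I → J := fun i => ⟨n i, hSJ ⟨i, (Finset.mem_filter.mp i.2).2, rfl⟩⟩
  have he' : Function.Injective e' := by
    intro i j hij
    have : n i = n j := congrArg Subtype.val hij
    exact Subtype.ext (hinj (Finset.mem_filter.mp i.2).2 (Finset.mem_filter.mp j.2).2 this)
  have hrange : ∀ j : J, j ∉ Set.range e' → (j : E) ∉ S := by
    intro j hj hjS
    obtain ⟨i, hi, hij⟩ := hjS
    exact hj ⟨⟨i, by simp [I]; exact hi⟩, Subtype.ext hij⟩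
  have hLe : ∀ i : I, L (e' i) = l := by
    intro i
    simp only [L]
    exact if_pos ⟨i, (Finset.mem_filter.mp i.2).2, rfl⟩
  have hL0 : ∀ j : J, j ∉ Set.range e' → L j = 0 := fun j hj => if_neg (hrange j hj)
  refine ⟨J, b, L, ?_, ?_, ?_, ?_⟩
  · intro x y
    have h1 : queryKernel l u x y = ∏ i ∈ I, queryFactor l (u i) x y := by
      rw [queryKernel]
      symm
      refine Finset.prod_subset (Finset.subset_univ _) fun i _ hi => ?_
      have : u i = 0 := by simpa [I] using hi
      rw [this, queryFactor_zero]
    rw [h1, boxKernel, ← Finset.prod_coe_sort]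
    refine Finset.prod_of_injOn e' he'.injOn (fun _ _ => by simp) ?_ ?_
    · intro j _ hj
      rw [hL0 j (by simpa using hj)]
      simp [He]
    · intro i _
      rw [hLe, queryFactor_of_ne_zero l (Finset.mem_filter.mp i.2).2, hb]
  · intro v hv j
    by_cases hj : (j : E) ∈ S
    · exact Or.inl (if_pos hj)
    · right
      induction hv using Submodule.span_induction with
      | mem x hx =>
        obtain ⟨i, rfl⟩ := hx
        by_cases hi : u i = 0
        · simp [hi]
        · have h1 : u i = ‖u i‖ • b (e' ⟨i, by simp [I, hi]⟩) := by
            rw [hb]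
            simp [e', n, smul_smul, mul_inv_cancel₀ (norm_ne_zero_iff.mpr hi)]
          rw [h1, real_inner_smul_right, b.inner_eq_zero, mul_zero]
          rintro rfl
          exact hj ⟨i, hi, rfl⟩
      | zero => simp
      | add x y _ _ h1 h2 => rw [inner_add_right, h1, h2, add_zero]
      | smul a x _ h1 => rw [real_inner_smul_right, h1, mul_zero]
  · have h1 : ∏ i : I, ((l : ℝ) + 1) = ∏ j, ((L j : ℝ) + 1) := by
      refine Finset.prod_of_injOn e' he'.injOn (fun _ _ => by simp) ?_ ?_
      · intro j _ hj
        rw [hL0 j (by simpa using hj)]; simp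
      · intro i _; rw [hLe]
    rw [← h1, Finset.prod_const, Finset.card_univ, Fintype.card_coe]
    exact pow_le_pow_right₀ (by have := (Nat.cast_nonneg l : (0 : ℝ) ≤ l); linarith) hIk
  · have h1 : ∑ i : I, (2 * (l : ℝ)) = ∑ j, (2 * (L j : ℝ)) := by
      refine Finset.sum_of_injOn e' he'.injOn (fun _ _ => by simp) ?_ ?_
      · intro j _ hj
        rw [hL0 j (by simpa using hj)]; simp
      · intro i _; rw [hLe]
    rw [Finset.sum_add_distrib, ← h1, Finset.sum_const, Finset.card_univ, Fintype.card_coe,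
      Module.finrank_eq_card_basis b.toBasis]
    simp only [nsmul_eq_mul, Finset.sum_const, Finset.card_univ, mul_one]
    have : (I.card : ℝ) ≤ k := by exact_mod_cast hIk
    have := mul_le_mul_of_nonneg_right this (by positivity : (0 : ℝ) ≤ 2 * (l : ℝ))
    linarith

end QueryKernel

/-! ### Approximating a network by its part on a subspace -/

section Approximation

set_option linter.unusedSectionVars false

variable {Ω : Type*} [MeasurableSpace Ω] {μ : Measure Ω}

/-- The `L²` norm of a function, as a real number. -/
noncomputable def l2norm (μ : Measure Ω) (f : Ω → ℝ) : ℝ := √(∫ x, f x ^ 2 ∂μ)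

lemma l2norm_sq (f : Ω → ℝ) : l2norm μ f ^ 2 = ∫ x, f x ^ 2 ∂μ :=
  Real.sq_sqrt (integral_nonneg fun _ => sq_nonneg _)

lemma l2norm_nonneg (f : Ω → ℝ) : 0 ≤ l2norm μ f := Real.sqrt_nonneg _

lemma l2norm_add_le {f g : Ω → ℝ} (hf : MemLp f 2 μ) (hg : MemLp g 2 μ) :
    l2norm μ (fun x => f x + g x) ≤ l2norm μ f + l2norm μ g := by
  refine Real.sqrt_le_iff.mpr ⟨add_nonneg (l2norm_nonneg _) (l2norm_nonneg _), ?_⟩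
  have e : ∀ x, (f x + g x) ^ 2 = f x ^ 2 + 2 * (f x * g x) + g x ^ 2 := by intro x; ring
  simp_rw [e]
  have hfg := integrable_mul_of_memLp hf hg
  rw [integral_add (f := fun x => f x ^ 2 + 2 * (f x * g x))
    (hf.integrable_sq.add (hfg.const_mul 2)) hg.integrable_sq,
    integral_add hf.integrable_sq (hfg.const_mul 2), integral_const_mul, add_sq, l2norm_sq,
    l2norm_sq]
  have h1 := abs_integral_mul_le hf hg
  rw [← l2norm_sq, ← l2norm_sq, ← mul_pow] at h1
  have h2 := abs_le_of_sq_le_sq' h1 (mul_nonneg (l2norm_nonneg _) (l2norm_nonneg _))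
  linarith [h2.2]

lemma l2norm_const_mul (a : ℝ) (f : Ω → ℝ) :
    l2norm μ (fun x => a * f x) = |a| * l2norm μ f := by
  simp only [l2norm, mul_pow]
  rw [integral_const_mul, Real.sqrt_mul (sq_nonneg a), Real.sqrt_sq_eq_abs]

lemma l2norm_sum_le {ι : Type*} (s : Finset ι) {f : ι → Ω → ℝ} (hf : ∀ i ∈ s, MemLp (f i) 2 μ) :
    l2norm μ (fun x => ∑ i ∈ s, f i x) ≤ ∑ i ∈ s, l2norm μ (f i) := by
  classical
  induction s using Finset.induction_on with
  | empty => simp [l2norm]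
  | insert a s ha ih =>
    simp only [Finset.sum_insert ha]
    have hs : ∀ i ∈ s, MemLp (f i) 2 μ := fun i hi => hf i (Finset.mem_insert_of_mem hi)
    exact (l2norm_add_le (hf a (Finset.mem_insert_self a s)) (memLp_finsetSum s hs)).trans
      (add_le_add le_rfl (ih hs))

variable {E : Type} [NormedAddCommGroup E] [InnerProductSpace ℝ E] [FiniteDimensional ℝ E]
  [MeasurableSpace E] [BorelSpace E]

/-- The one-hidden-layer network in a general inner product space. -/
noncomputable def ridgeSum {k : ℕ} (w : Fin k → ℝ) (v : Fin k → E) (x : E) : ℝ :=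
  ∑ i, w i * ReLU (inner ℝ (v i) x)

lemma memLp_ridgeSum {k : ℕ} (w : Fin k → ℝ) {v : Fin k → E} (hv : ∀ i, ‖v i‖ = 1) :
    MemLp (ridgeSum w v) 2 (stdGaussian E) :=
  memLp_finsetSum _ fun i _ => (memLp_ReLU_inner (hv i)).const_mul _

lemma abs_ridgeSum_le {k : ℕ} {w : Fin k → ℝ} {v : Fin k → E} (hw : ∑ i, |w i| ≤ 1)
    (hv : ∀ i, ‖v i‖ = 1) (x : E) : |ridgeSum w v x| ≤ ‖x‖ := by
  calc |ridgeSum w v x| ≤ ∑ i, |w i * ReLU (inner ℝ (v i) x)| := Finset.abs_sum_le_sum_abs _ _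
    _ ≤ ∑ i, |w i| * ‖x‖ := by
      refine Finset.sum_le_sum fun i _ => ?_
      rw [abs_mul]
      refine mul_le_mul_of_nonneg_left ((abs_ReLU_le _).trans ?_) (abs_nonneg _)
      have := abs_real_inner_le_norm (v i) x
      rwa [hv i, one_mul] at this
    _ ≤ ‖x‖ := by
      rw [← Finset.sum_mul]
      exact mul_le_of_le_one_left (norm_nonneg x) hw

lemma l2norm_He_sub_He_sq {k : ℕ} (w : Fin k → ℝ) (v p : Fin k → E) (m : ℕ)
    (hp : ∀ i j, (inner ℝ (v i) (p j) : ℝ) = inner ℝ (p i) (p j)) :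
    l2norm (stdGaussian E) (fun x => ∑ i, w i *
      (He m (inner ℝ (v i) x) (‖v i‖ ^ 2) - He m (inner ℝ (p i) x) (‖p i‖ ^ 2))) ^ 2 =
    m.factorial * ∑ i, ∑ j, w i * w j *
      ((inner ℝ (v i) (v j) : ℝ) ^ m - inner ℝ (p i) (p j) ^ m) := by
  rw [l2norm_sq]
  let h : E → E → ℝ := fun a x => He m (inner ℝ a x) (‖a‖ ^ 2)
  have hi : ∀ a b, Integrable (fun x => h a x * h b x) (stdGaussian E) := fun a b =>
    integrable_mul_of_memLp (memLp_He_inner m a) (memLp_He_inner m b)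
  have hv : ∀ a b, ∫ x, h a x * h b x ∂(stdGaussian E) = m.factorial * inner ℝ a b ^ m :=
    fun a b => integral_He_inner_mul_He_inner m a b
  have e : ∀ x, (∑ i, w i * (He m (inner ℝ (v i) x) (‖v i‖ ^ 2) -
      He m (inner ℝ (p i) x) (‖p i‖ ^ 2))) ^ 2 = ∑ i, ∑ j, w i * w j *
      (h (v i) x * h (v j) x - h (v i) x * h (p j) x - h (v j) x * h (p i) x +
        h (p i) x * h (p j) x) := by
    intro x
    rw [pow_two, Finset.sum_mul_sum]
    exact Finset.sum_congr rfl fun i _ => Finset.sum_congr rfl fun j _ => by simp only [h]; ring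
  simp_rw [e]
  have hint : ∀ i j, Integrable (fun x => h (v i) x * h (v j) x - h (v i) x * h (p j) x -
      h (v j) x * h (p i) x + h (p i) x * h (p j) x) (stdGaussian E) := fun i j =>
    (((hi _ _).sub (hi _ _)).sub (hi _ _)).add (hi _ _)
  rw [integral_finsetSum _ fun i _ => integrable_finsetSum _ fun j _ => (hint i j).const_mul _,
    Finset.mul_sum]
  refine Finset.sum_congr rfl fun i _ => ?_
  rw [integral_finsetSum _ fun j _ => (hint i j).const_mul _, Finset.mul_sum]
  refine Finset.sum_congr rfl fun j _ => ?_
  rw [integral_const_mul, integral_add (f := fun x => h (v i) x * h (v j) x -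
      h (v i) x * h (p j) x - h (v j) x * h (p i) x)
      (((hi _ _).sub (hi _ _)).sub (hi _ _)) (hi _ _),
    integral_sub (f := fun x => h (v i) x * h (v j) x - h (v i) x * h (p j) x)
      ((hi _ _).sub (hi _ _)) (hi _ _), integral_sub (hi _ _) (hi _ _), hv, hv, hv, hv, hp i j,
    hp j i, real_inner_comm (p i) (p j)]
  ring

/-- The part of the Hermite expansion of a network of degree at most `l`, with the directions
replaced by `p`. -/
noncomputable def projPartial {k : ℕ} (w : Fin k → ℝ) (p : Fin k → E) (l : ℕ) (x : E) : ℝ :=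
  ∑ m ∈ Finset.range (l + 1), reluCoef m / m.factorial *
    ∑ i, w i * He m (inner ℝ (p i) x) (‖p i‖ ^ 2)

lemma l2norm_ridgeSum_sub_le {k : ℕ} {w : Fin k → ℝ} {v : Fin k → E} (hw : ∑ i, |w i| ≤ 1)
    (hv : ∀ i, ‖v i‖ = 1) {l : ℕ} (hl : 1 ≤ l) :
    l2norm (stdGaussian E) (fun x => ridgeSum w v x - projPartial w v l x) ≤ 1 / √(l : ℝ) := by
  have e : ∀ x, ridgeSum w v x - projPartial w v l x =
      ∑ i, w i * (ReLU (inner ℝ (v i) x) - reluPartial l (inner ℝ (v i) x)) := by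
    intro x
    simp only [ridgeSum, projPartial, reluPartial_inner_eq (hv _), mul_sub, Finset.sum_sub_distrib,
      Finset.mul_sum]
    rw [Finset.sum_comm]
    congr 1
    exact Finset.sum_congr rfl fun i _ => Finset.sum_congr rfl fun m _ => by ring
  simp_rw [e]
  refine (l2norm_sum_le _ fun i _ => (((memLp_ReLU.sub (memLp_reluPartial l)).comp_measurePreserving
    (measurePreserving_inner (hv i))).const_mul (w i))).trans ?_
  calc _ ≤ ∑ i, |w i| * (1 / √(l : ℝ)) := by
        refine Finset.sum_le_sum fun i _ => ?_
        have h1 := l2norm_const_mul (μ := stdGaussian E) (w i)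
          (fun x => ReLU (inner ℝ (v i) x) - reluPartial l (inner ℝ (v i) x))
        refine h1.le.trans (mul_le_mul_of_nonneg_left ?_ (abs_nonneg _))
        have h2 : 1 / √(l : ℝ) = √(1 / l) := by rw [Real.sqrt_div zero_le_one, Real.sqrt_one]
        rw [l2norm, h2]
        exact Real.sqrt_le_sqrt (integral_ReLU_inner_sub_sq_le (hv i) hl)
    _ ≤ 1 / √(l : ℝ) := by
        rw [← Finset.sum_mul]
        exact mul_le_of_le_one_left (by positivity) hw

lemma memLp_projPartial {k : ℕ} (w : Fin k → ℝ) (p : Fin k → E) (l : ℕ) :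
    MemLp (projPartial w p l) 2 (stdGaussian E) := by
  have h : ∀ m, MemLp (fun x => ∑ i, w i * He m (inner ℝ (p i) x) (‖p i‖ ^ 2)) 2
      (stdGaussian E) := fun m =>
    memLp_finsetSum _ fun i _ => (memLp_He_inner m (p i)).const_mul _
  exact memLp_finsetSum _ fun m _ => (h m).const_mul (reluCoef m / m.factorial)

/-- If the low odd moments of the components `z` of the directions outside a subspace are small,
then the network is well approximated by a low-degree polynomial in the components `p` inside the
subspace. -/
theorem l2norm_ridgeSum_sub_projPartial_le {k : ℕ} {w : Fin k → ℝ} {v : Fin k → E}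
    (hw : ∑ i, |w i| ≤ 1) (hv : ∀ i, ‖v i‖ = 1) (p z : Fin k → E)
    (hp : ∀ i j, (inner ℝ (v i) (p j) : ℝ) = inner ℝ (p i) (p j))
    (hz : ∀ i j, (inner ℝ (v i) (v j) : ℝ) = inner ℝ (p i) (p j) + inner ℝ (z i) (z j))
    {η : ℝ} (hη : 0 ≤ η) (h1 : ∑ i, ∑ j, w i * w j * inner ℝ (z i) (z j) ≤ η ^ 2)
    (hlow : ∀ s < k, ∑ i, ∑ j, w i * w j *
      (inner ℝ (v i) (v j) ^ (2 * s + 1) * inner ℝ (z i) (z j)) ≤ η ^ 2) {l : ℕ} (hl : 1 ≤ l) :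
    l2norm (stdGaussian E) (fun x => ridgeSum w v x - projPartial w p l x) ≤
      1 / √(l : ℝ) + (l + 1) ^ (k + 2) * η := by
  have e : ∀ x, ridgeSum w v x - projPartial w p l x = (ridgeSum w v x - projPartial w v l x) +
      ∑ m ∈ Finset.range (l + 1), reluCoef m / m.factorial * ∑ i, w i *
        (He m (inner ℝ (v i) x) (‖v i‖ ^ 2) - He m (inner ℝ (p i) x) (‖p i‖ ^ 2)) := by
    intro x
    simp only [projPartial, mul_sub, Finset.sum_sub_distrib]
    ring
  have hmem : ∀ m, MemLp (fun x => ∑ i, w i * (He m (inner ℝ (v i) x) (‖v i‖ ^ 2) -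
      He m (inner ℝ (p i) x) (‖p i‖ ^ 2))) 2 (stdGaussian E) := fun m =>
    memLp_finsetSum _ fun i _ => ((memLp_He_inner m _).sub (memLp_He_inner m _)).const_mul _
  simp_rw [e]
  refine (l2norm_add_le ((memLp_ridgeSum w hv).sub (memLp_projPartial w v l))
    (memLp_finsetSum _ fun m _ => (hmem m).const_mul _)).trans
    (add_le_add (l2norm_ridgeSum_sub_le hw hv hl) ?_)
  refine (l2norm_sum_le _ fun m _ => (hmem m).const_mul _).trans ?_
  have hl1 : (1 : ℝ) ≤ l := by exact_mod_cast hl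
  have hterm : ∀ m ∈ Finset.range (l + 1), l2norm (stdGaussian E) (fun x =>
      reluCoef m / m.factorial * ∑ i, w i * (He m (inner ℝ (v i) x) (‖v i‖ ^ 2) -
        He m (inner ℝ (p i) x) (‖p i‖ ^ 2))) ≤ (l + 1) ^ (k + 1) * η := by
    intro m hm
    have hml : m ≤ l := by have := Finset.mem_range.mp hm; omega
    rw [l2norm_const_mul]
    set a := ∑ i, ∑ j, w i * w j * ((inner ℝ (v i) (v j) : ℝ) ^ m - inner ℝ (p i) (p j) ^ m)
      with ha
    have hsq := l2norm_He_sub_He_sq w v p m hp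
    have hf : (0 : ℝ) < (m.factorial : ℝ) := by positivity
    -- It suffices to bound `a` in the degrees in which the coefficient does not vanish.
    have hred : a ≤ ((l + 1) ^ (k + 1) * η) ^ 2 → |reluCoef m / m.factorial| *
        l2norm (stdGaussian E) (fun x => ∑ i, w i * (He m (inner ℝ (v i) x) (‖v i‖ ^ 2) -
        He m (inner ℝ (p i) x) (‖p i‖ ^ 2))) ≤ (l + 1) ^ (k + 1) * η := by
      intro hle
      refine abs_le_of_sq_le_sq' ?_ (by positivity) |>.2
      rw [mul_pow, hsq, sq_abs, div_pow]
      have h2 : reluCoef m ^ 2 / (m.factorial : ℝ) ^ 2 * (m.factorial * a) =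
          reluCoef m ^ 2 / m.factorial * a := by field_simp
      rw [h2]
      have h3 : reluCoef m ^ 2 / m.factorial ≤ 1 := by
        rw [div_le_one hf]; exact reluCoef_sq_le_factorial m
      have ha0 : 0 ≤ a := by
        have : 0 ≤ (m.factorial : ℝ) * a := by rw [← hsq]; positivity
        exact nonneg_of_mul_nonneg_right this hf
      exact (mul_le_of_le_one_left ha0 h3).trans hle
    -- In even degree `m > 0` the tensors of order `m` are controlled by those of odd order `m - 1`;
    -- in odd degree `m ≥ 3` the coefficient vanishes.
    rcases Nat.even_or_odd' m with ⟨n, rfl | rfl⟩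
    · rcases Nat.eq_zero_or_pos n with rfl | hn
      · apply hred
        simp [ha]; positivity
      · obtain ⟨n, rfl⟩ : ∃ n', n = n' + 1 := ⟨n - 1, by omega⟩
        apply hred
        have h2 := sum_pow_sub_pow_le w v p z hz (2 * (n + 1))
        rw [show 2 * (n + 1) - 1 = 2 * n + 1 by omega] at h2
        have h3 := sum_odd_moment_le w v z hv hη (by simpa using hlow) n
        rw [Fintype.card_fin] at h3
        refine h2.trans ((mul_le_mul_of_nonneg_left h3 (by positivity)).trans ?_)
        have hnl : (2 * (n : ℝ) + 1) ≤ l + 1 := by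
          have : 2 * n ≤ l := by omega
          have : (2 * (n : ℝ)) ≤ l := by exact_mod_cast this
          linarith
        have hnl' : ((2 * (n + 1) : ℕ) : ℝ) ≤ (l + 1) ^ 2 := by
          have : ((2 * (n + 1) : ℕ) : ℝ) ≤ l := by exact_mod_cast hml
          nlinarith
        calc ((2 * (n + 1) : ℕ) : ℝ) * ((2 * n + 1) ^ k * η) ^ 2
            ≤ (l + 1) ^ 2 * ((l + 1) ^ k * η) ^ 2 := by gcongr
          _ = _ := by ring
    · rcases Nat.eq_zero_or_pos n with rfl | hn
      · apply hred
        have h2 := sum_pow_sub_pow_le w v p z hz 1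
        simp only [Nat.sub_self, pow_zero, one_mul, Nat.cast_one] at h2
        refine h2.trans (h1.trans ?_)
        refine pow_le_pow_left₀ hη (le_mul_of_one_le_left hη (one_le_pow₀ (by linarith))) 2
      · obtain ⟨n, rfl⟩ : ∃ n', n = n' + 1 := ⟨n - 1, by omega⟩
        rw [show 2 * (n + 1) + 1 = 2 * n + 3 by ring, reluCoef_odd]
        simp; positivity
  refine (Finset.sum_le_sum hterm).trans ?_
  rw [Finset.sum_const, Finset.card_range, nsmul_eq_mul]
  push_cast
  apply le_of_eq; ring

end Approximation

/-! ### The subspace found from low-degree Hermite coefficients -/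

section Directions

variable {d k : ℕ}

/-- The vector of the Hermite coefficients of a network with multi-indices `α + e b`. -/
noncomputable def coefVec (w : Fin k → ℝ) (v : Fin k → EuclideanSpace ℝ (Fin d))
    (α : Fin d → ℕ) : EuclideanSpace ℝ (Fin d) :=
  reluCoef (∑ b, α b + 1) • ∑ i, (w i * ∏ b, v i b ^ α b) • v i

lemma integral_ridgeSum_mul_hermiteFun (w : Fin k → ℝ) {v : Fin k → EuclideanSpace ℝ (Fin d)}
    (hv : ∀ i, ‖v i‖ = 1) (α : Fin d → ℕ) (b : Fin d) :
    ∫ x, ridgeSum w v x * hermiteFun (EuclideanSpace.basisFun (Fin d) ℝ)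
      (fun b' => α b' + if b' = b then 1 else 0) x ∂(stdGaussian (EuclideanSpace ℝ (Fin d))) =
      coefVec w v α b := by
  simp only [ridgeSum, Finset.sum_mul, mul_assoc]
  rw [integral_finsetSum _ fun i _ =>
    (integrable_mul_of_memLp (memLp_ReLU_inner (hv i)) (memLp_hermiteFun _ _)).const_mul (w i)]
  simp only [integral_const_mul, integral_ReLU_inner_mul_hermiteFun _ (hv _), coefVec,
    PiLp.smul_apply, smul_eq_mul, WithLp.ofLp_sum, Finset.sum_apply, WithLp.ofLp_smul,
    Pi.smul_apply, Finset.mul_sum]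
  refine Finset.sum_congr rfl fun i _ => ?_
  rw [Finset.sum_add_distrib, Finset.sum_ite_eq' Finset.univ b]
  simp only [Finset.mem_univ, if_true, pow_add, Finset.prod_mul_distrib,
    EuclideanSpace.basisFun_inner, pow_ite, pow_one, pow_zero,
    Finset.prod_ite_eq' Finset.univ b]
  ring

/-- The moments as sums of squares over all words `a`, by expanding the powers of the inner product
in coordinates. -/
lemma sum_inner_pow_mul_inner_eq (w : Fin k → ℝ) (v z : Fin k → EuclideanSpace ℝ (Fin d))
    (n : ℕ) : ∑ i, ∑ j, w i * w j * ((inner ℝ (v i) (v j) : ℝ) ^ n * inner ℝ (z i) (z j)) =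
      ∑ a : Fin n → Fin d, ‖∑ i, (w i * ∏ l, v i (a l)) • z i‖ ^ 2 := by
  have h1 : ∀ a : Fin n → Fin d, ‖∑ i, (w i * ∏ l, v i (a l)) • z i‖ ^ 2 =
      ∑ i, ∑ j, w i * w j * ((∏ l, (v i (a l) * v j (a l))) * inner ℝ (z i) (z j)) := by
    intro a
    rw [← real_inner_self_eq_norm_sq, sum_inner]
    refine Finset.sum_congr rfl fun i _ => ?_
    rw [inner_sum]
    refine Finset.sum_congr rfl fun j _ => ?_
    rw [real_inner_smul_left, real_inner_smul_right, Finset.prod_mul_distrib]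
    ring
  simp_rw [h1]
  symm
  rw [Finset.sum_comm]
  refine Finset.sum_congr rfl fun i _ => ?_
  rw [Finset.sum_comm]
  refine Finset.sum_congr rfl fun j _ => ?_
  have h2 : (inner ℝ (v i) (v j) : ℝ) = ∑ b, v i b * v j b := by
    simp [PiLp.inner_apply, mul_comm]
  rw [h2, Fintype.sum_pow, Finset.sum_mul, Finset.mul_sum]

lemma prod_word_eq (x : EuclideanSpace ℝ (Fin d)) {n : ℕ} (a : Fin n → Fin d) :
    ∏ l, x (a l) = ∏ b, x b ^ (Finset.univ.filter fun l => a l = b).card := by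
  rw [← Finset.prod_fiberwise Finset.univ a]
  refine Finset.prod_congr rfl fun b _ => ?_
  rw [← Finset.prod_const]
  refine Finset.prod_congr rfl fun l hl => ?_
  rw [(Finset.mem_filter.mp hl).2]

lemma sum_word_card {n : ℕ} (a : Fin n → Fin d) :
    ∑ b, (Finset.univ.filter fun l => a l = b).card = n := by
  have := Finset.card_eq_sum_card_fiberwise (s := Finset.univ) (t := Finset.univ) (f := a)
    (by simp)
  simpa using this.symm

/-- The components `v i - P v i` outside a subspace have small moments of degree `n` if all the
coefficient vectors of this degree are close to the subspace. The degree is such that the Hermite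
coefficient of degree `n + 1` of the rectified linear unit does not vanish. -/
lemma sum_inner_pow_mul_inner_le (w : Fin k → ℝ) (v : Fin k → EuclideanSpace ℝ (Fin d))
    (Q : EuclideanSpace ℝ (Fin d) →ₗ[ℝ] EuclideanSpace ℝ (Fin d)) {θ : ℝ} {n : ℕ}
    (hn : 1 / 9 ≤ reluCoef (n + 1) ^ 2)
    (h : ∀ α : Fin d → ℕ, ∑ b, α b = n → ‖Q (coefVec w v α)‖ ≤ θ) :
    ∑ i, ∑ j, w i * w j * ((inner ℝ (v i) (v j) : ℝ) ^ n * inner ℝ (Q (v i)) (Q (v j))) ≤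
      d ^ n * (3 * θ) ^ 2 := by
  rw [sum_inner_pow_mul_inner_eq w v (fun i => Q (v i)) n]
  have h1 : ∀ a : Fin n → Fin d, ‖∑ i, (w i * ∏ l, v i (a l)) • Q (v i)‖ ^ 2 ≤ (3 * θ) ^ 2 := by
    intro a
    set α : Fin d → ℕ := fun b => (Finset.univ.filter fun l => a l = b).card
    have hα := h α (sum_word_card a)
    have e : Q (coefVec w v α) =
        reluCoef (n + 1) • ∑ i, (w i * ∏ l, v i (a l)) • Q (v i) := by
      rw [coefVec, map_smul, map_sum, show ∑ b, α b = n from sum_word_card a]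
      congr 1
      refine Finset.sum_congr rfl fun i _ => ?_
      rw [map_smul, prod_word_eq]
    rw [e, norm_smul] at hα
    have h2 := pow_le_pow_left₀ (by positivity) hα 2
    rw [mul_pow, Real.norm_eq_abs, sq_abs] at h2
    have h3 := mul_le_mul_of_nonneg_right hn
      (sq_nonneg ‖∑ i, (w i * ∏ l, v i (a l)) • Q (v i)‖)
    linarith
  calc _ ≤ ∑ _a : Fin n → Fin d, (3 * θ) ^ 2 := Finset.sum_le_sum fun a _ => h1 a
    _ = _ := by simp [Finset.card_univ]

/-- If pivoted Gram-Schmidt is applied to estimates of the coefficient vectors, then the network is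
well approximated by its projection onto the low-degree polynomials on the span of the pivots. -/
theorem integral_ridgeSum_sub_boxProj_sq_le {w : Fin k → ℝ} {v : Fin k → EuclideanSpace ℝ (Fin d)}
    (hd : 0 < d) (hw : ∑ i, |w i| ≤ 1) (hv : ∀ i, ‖v i‖ = 1) {T : Type*}
    {res : ℕ → T → EuclideanSpace ℝ (Fin d)} {u : ℕ → EuclideanSpace ℝ (Fin d)} {idx : ℕ → T}
    (hP : IsPivotedGramSchmidt k res u idx) (α : T → Fin d → ℕ)
    (hα : ∀ β : Fin d → ℕ, ∑ b, β b ≤ 2 * k - 1 → ∃ t, α t = β) {τ : ℝ} (hτ : 0 ≤ τ)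
    (hres : ∀ t, ‖res 0 t - coefVec w v (α t)‖ ≤ τ) {l : ℕ} (hl : 1 ≤ l)
    {J : Type*} [Fintype J] [DecidableEq J]
    (b : OrthonormalBasis J ℝ (EuclideanSpace ℝ (Fin d))) (L : J → ℕ)
    (hL : ∀ x ∈ Submodule.span ℝ (Set.range fun r : Fin k => u r),
      ∀ j, L j = l ∨ (inner ℝ (b j) x : ℝ) = 0) :
    ∫ x, (ridgeSum w v x - boxProj b L (ridgeSum w v) x) ^ 2
      ∂(stdGaussian (EuclideanSpace ℝ (Fin d))) ≤
      (1 / √(l : ℝ) + (l + 1) ^ (k + 2) * (d ^ k * (3 * ((2 ^ (k + 1) + 1) * τ)))) ^ 2 := by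
  set U := Submodule.span ℝ (Set.range fun r : Fin k => u r)
  let P : EuclideanSpace ℝ (Fin d) →L[ℝ] EuclideanSpace ℝ (Fin d) := U.starProjection
  let Q : EuclideanSpace ℝ (Fin d) →ₗ[ℝ] EuclideanSpace ℝ (Fin d) :=
    LinearMap.id - (P : EuclideanSpace ℝ (Fin d) →ₗ[ℝ] EuclideanSpace ℝ (Fin d))
  have hQ : ∀ x, Q x = x - P x := fun x => rfl
  have hPU : ∀ x, P x ∈ U := fun x => U.starProjection_apply_mem x
  have hQU : ∀ x, ∀ y ∈ U, (inner ℝ (Q x) y : ℝ) = 0 := fun x y hy =>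
    U.starProjection_inner_eq_zero x y hy
  have hQ0 : ∀ x ∈ U, Q x = 0 := by
    intro x hx
    rw [hQ, sub_eq_zero]
    exact (Submodule.starProjection_eq_self_iff.mpr hx).symm
  have hQn : ∀ x, ‖Q x‖ ≤ ‖x‖ := by
    intro x
    have h1 : ‖x‖ ^ 2 = ‖Q x‖ ^ 2 + ‖P x‖ ^ 2 := by
      have h2 : x = Q x + P x := by rw [hQ]; abel
      conv_lhs => rw [h2]
      rw [norm_add_sq_real, hQU x _ (hPU x)]; ring
    exact abs_le_of_sq_le_sq' (by nlinarith [sq_nonneg ‖P x‖]) (norm_nonneg x) |>.2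
  have himg : u '' Set.Iio k = Set.range fun r : Fin k => u r := by
    ext x
    constructor
    · rintro ⟨r, hr, rfl⟩; exact ⟨⟨r, hr⟩, rfl⟩
    · rintro ⟨r, rfl⟩; exact ⟨r, r.2, rfl⟩
  have hfin : ∀ t, ‖res k t‖ ≤ 2 ^ (k + 1) * τ := by
    refine hP.norm_res_final_le (Submodule.span ℝ (Set.range v)) ?_
      (g := fun t => coefVec w v (α t)) (fun t => ?_) hres
    · exact (finrank_range_le_card (R := ℝ) v).trans_eq (Fintype.card_fin k)
    · exact Submodule.smul_mem _ _ (Submodule.sum_mem _ fun i _ => Submodule.smul_mem _ _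
        (Submodule.subset_span ⟨i, rfl⟩))
  -- `Q` annihilates everything that the process has removed from the estimates.
  have hθ : ∀ t, ‖Q (coefVec w v (α t))‖ ≤ (2 ^ (k + 1) + 1) * τ := by
    intro t
    have h1 : Q (res 0 t) = Q (res k t) := by
      have h2 := hP.sub_mem_span le_rfl t
      rw [himg] at h2
      have := hQ0 _ h2
      rwa [map_sub, sub_eq_zero] at this
    have h2 : Q (coefVec w v (α t)) = Q (res k t) - Q (res 0 t - coefVec w v (α t)) := by
      rw [map_sub, h1]; abel
    rw [h2]
    calc _ ≤ ‖Q (res k t)‖ + ‖Q (res 0 t - coefVec w v (α t))‖ := norm_sub_le _ _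
      _ ≤ 2 ^ (k + 1) * τ + τ :=
        add_le_add ((hQn _).trans (hfin t)) ((hQn _).trans (hres t))
      _ = _ := by ring
  have hd1 : (1 : ℝ) ≤ d := by exact_mod_cast hd
  set θ := (2 ^ (k + 1) + 1) * τ with hθdef
  have hmom : ∀ n ≤ 2 * k - 1, 1 / 9 ≤ reluCoef (n + 1) ^ 2 →
      ∑ i, ∑ j, w i * w j * ((inner ℝ (v i) (v j) : ℝ) ^ n * inner ℝ (Q (v i)) (Q (v j))) ≤
        (d ^ k * (3 * θ)) ^ 2 := by
    intro n hn hc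
    refine (sum_inner_pow_mul_inner_le (θ := θ) w v Q hc fun β hβ => ?_).trans ?_
    · obtain ⟨t, rfl⟩ := hα β (hβ.le.trans hn)
      exact hθ t
    · rw [mul_pow (_ ^ k), ← pow_mul]
      refine mul_le_mul_of_nonneg_right (pow_le_pow_right₀ hd1 (by omega)) (sq_nonneg _)
  have hmain := l2norm_ridgeSum_sub_projPartial_le hw hv (fun i => P (v i)) (fun i => Q (v i))
    (fun i j => ?_) (fun i j => ?_) (η := d ^ k * (3 * θ)) (by positivity) ?_ ?_ hl
  · refine (integral_sub_boxProj_sq_le b L (memLp_ridgeSum w hv)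
      (G := projPartial w (fun i => P (v i)) l) ?_).trans ?_
    · have e : projPartial w (fun i => P (v i)) l = ∑ m ∈ Finset.range (l + 1),
          (reluCoef m / m.factorial) • ∑ i, w i • fun x =>
            He m (inner ℝ (P (v i)) x) (‖P (v i)‖ ^ 2) := by
        ext x
        simp [projPartial, Finset.sum_apply]
      rw [e]
      refine Submodule.sum_mem _ fun m hm => Submodule.smul_mem _ _ (Submodule.sum_mem _ fun i _ =>
        Submodule.smul_mem _ _ (He_inner_mem_span b L (hL _ (hPU _)) ?_))
      have := Finset.mem_range.mp hm
      omega
    · rw [← l2norm_sq]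
      exact pow_le_pow_left₀ (l2norm_nonneg _) hmain 2
  · have h1 := hQU (v i) _ (hPU (v j))
    rw [hQ, inner_sub_left, sub_eq_zero] at h1
    exact h1
  · have e1 : v i = P (v i) + Q (v i) := by rw [hQ]; abel
    have e2 : v j = P (v j) + Q (v j) := by rw [hQ]; abel
    conv_lhs => rw [e1, e2]
    rw [inner_add_left, inner_add_right, inner_add_right, hQU (v i) _ (hPU (v j)),
      real_inner_comm (Q (v j)) (P (v i)), hQU (v j) _ (hPU (v i))]
    ring
  · have := hmom 0 (Nat.zero_le _) (by rw [zero_add, reluCoef_one]; norm_num)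
    simpa using this
  · intro s hs
    refine hmom (2 * s + 1) (by omega) ?_
    rw [show 2 * s + 1 + 1 = 2 * (s + 1) by ring]
    exact le_reluCoef_even_sq _

end Directions

/-! ### A table of multi-indices -/

/-- An enumeration of the multi-indices of degree at most `m` in `d` variables, along the `d`-ary
heap: the multi-index in position `t * d + a + 1` is the one in position `t` plus `e a`. Positions
that would have degree larger than `m` are filled with the zero multi-index. -/
def wordIndex (d m : ℕ) : ℕ → ℕ → ℕ
  | 0 => fun _ => 0
  | t + 1 => fun b =>
    if ∑ a ∈ Finset.range d, wordIndex d m (t / d) a < m then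
      wordIndex d m (t / d) b + if b = t % d then 1 else 0
    else 0
  termination_by t => t
  decreasing_by all_goals exact Nat.lt_succ_of_le (Nat.div_le_self t d)

lemma wordIndex_zero (d m b : ℕ) : wordIndex d m 0 b = 0 := by rw [wordIndex]

lemma wordIndex_child (d m t : ℕ) {a : ℕ} (ha : a < d) (b : ℕ) :
    wordIndex d m (t * d + a + 1) b =
      if ∑ a ∈ Finset.range d, wordIndex d m t a < m then
        wordIndex d m t b + if b = a then 1 else 0 else 0 := by
  rw [wordIndex]
  have h1 : (t * d + a) / d = t := by
    rw [mul_comm, Nat.mul_add_div (by omega), Nat.div_eq_of_lt ha, add_zero]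
  have h2 : (t * d + a) % d = a := by
    rw [mul_comm, Nat.mul_add_mod, Nat.mod_eq_of_lt ha]
  rw [h1, h2]

lemma sum_wordIndex_le {d : ℕ} (hd : 0 < d) (m t : ℕ) :
    ∑ a ∈ Finset.range d, wordIndex d m t a ≤ m := by
  cases t with
  | zero => simp [wordIndex_zero]
  | succ t =>
    have ht : t + 1 = t / d * d + t % d + 1 := by rw [Nat.div_add_mod']
    rw [ht]
    simp only [wordIndex_child d m (t / d) (Nat.mod_lt t hd)]
    split_ifs with h
    · rw [Finset.sum_add_distrib, Finset.sum_ite_eq' (Finset.range d) (t % d),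
        if_pos (Finset.mem_range.mpr (Nat.mod_lt t hd))]
      omega
    · simp

/-- The multi-indices of degree `n ≤ m` all appear among the first `(d + 1) ^ n` positions. -/
lemma exists_wordIndex_eq {d m : ℕ} (n : ℕ) (hn : n ≤ m) :
    ∀ β : Fin d → ℕ, ∑ b, β b = n → ∃ t < (d + 1) ^ n, ∀ b : Fin d, wordIndex d m t b = β b := by
  induction n with
  | zero =>
    intro β hβ
    refine ⟨0, by simp, fun b => ?_⟩
    rw [wordIndex_zero]
    have := Finset.sum_eq_zero_iff.mp hβ b (Finset.mem_univ b)
    exact this.symm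
  | succ n ih =>
    intro β hβ
    obtain ⟨b₀, hb₀⟩ : ∃ b, 0 < β b := by
      by_contra! h
      have : ∑ b, β b = 0 := Finset.sum_eq_zero fun b _ => Nat.le_zero.mp (h b)
      omega
    have hβ' : ∀ b, β b = (β b - if b = b₀ then 1 else 0) + if b = b₀ then 1 else 0 := by
      intro b
      split_ifs with h
      · subst h; omega
      · rfl
    have hs : ∑ b, (β b - if b = b₀ then 1 else 0) = n := by
      have h1 : ∑ b, β b = ∑ b, (β b - if b = b₀ then 1 else 0) + ∑ b, if b = b₀ then 1 else 0 := by
        rw [← Finset.sum_add_distrib]; exact Finset.sum_congr rfl fun b _ => hβ' b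
      rw [Finset.sum_ite_eq' Finset.univ b₀, if_pos (Finset.mem_univ _)] at h1
      omega
    obtain ⟨t, ht, htb⟩ := ih (by omega) _ hs
    refine ⟨t * d + b₀ + 1, ?_, fun b => ?_⟩
    · have h1 := b₀.2
      calc t * d + b₀ + 1 ≤ (t + 1) * d := by rw [add_mul]; omega
        _ ≤ (d + 1) ^ n * d := Nat.mul_le_mul_right d ht
        _ < (d + 1) ^ n * (d + 1) := Nat.mul_lt_mul_of_pos_left (Nat.lt_succ_self d) (by positivity)
        _ = _ := (pow_succ _ _).symm
    · rw [wordIndex_child d m t b₀.2, if_pos]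
      · rw [htb b, hβ' b]
        simp only [Fin.val_inj, ← hβ']
      · rw [← Fin.sum_univ_eq_sum_range (fun a => wordIndex d m t a)]
        rw [Finset.sum_congr rfl fun b _ => htb b, hs]
        omega

lemma exists_wordIndex_eq_of_le {d m : ℕ} (β : Fin d → ℕ) (hβ : ∑ b, β b ≤ m) :
    ∃ t < (d + 1) ^ m, ∀ b : Fin d, wordIndex d m t b = β b := by
  obtain ⟨t, ht, h⟩ := exists_wordIndex_eq _ hβ β rfl
  exact ⟨t, ht.trans_le (Nat.pow_le_pow_right (Nat.succ_pos d) hβ), h⟩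

/-! ### Pivoted Gram-Schmidt -/

section Pivot

variable {E : Type*} [NormedAddCommGroup E] [InnerProductSpace ℝ E]

/-- The position of the longest among the first `n` vectors, the first such position if there are
several. -/
noncomputable def pivot (R : ℕ → E) : ℕ → ℕ
  | 0 => 0
  | n + 1 => if inner ℝ (R (pivot R n)) (R (pivot R n)) < (inner ℝ (R n) (R n) : ℝ) then n
    else pivot R n

/-- Remove from all vectors the component along `u`. -/
noncomputable def deflate (u : E) (R : ℕ → E) (t : ℕ) : E :=
  R t - (inner ℝ (R t) u / inner ℝ u u : ℝ) • u

/-- The residuals of a sequence of vectors after `r` rounds of pivoted Gram-Schmidt, the pivots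
being chosen among the first `N` vectors. -/
noncomputable def gsResidual (R : ℕ → E) (N : ℕ) : ℕ → ℕ → E
  | 0 => R
  | r + 1 => deflate (gsResidual R N r (pivot (gsResidual R N r) N)) (gsResidual R N r)

/-- The pivot vector of round `r`. -/
noncomputable def pivotVec (R : ℕ → E) (N r : ℕ) : E :=
  gsResidual R N r (pivot (gsResidual R N r) N)

lemma pivot_lt (R : ℕ → E) {n : ℕ} (hn : 0 < n) : pivot R n < n := by
  induction n with
  | zero => omega
  | succ n ih =>
    rw [pivot]
    split_ifs
    · omega
    · rcases Nat.eq_zero_or_pos n with rfl | h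
      · simp [pivot]
      · exact (ih h).trans (Nat.lt_succ_self n)

lemma inner_self_le_pivot (R : ℕ → E) (n : ℕ) :
    ∀ t < n, (inner ℝ (R t) (R t) : ℝ) ≤ inner ℝ (R (pivot R n)) (R (pivot R n)) := by
  induction n with
  | zero => intro t ht; omega
  | succ n ih =>
    intro t ht
    rw [pivot]
    split_ifs with h
    · rcases Nat.lt_succ_iff_lt_or_eq.mp ht with h1 | rfl
      · exact (ih t h1).trans h.le
      · exact le_rfl
    · rcases Nat.lt_succ_iff_lt_or_eq.mp ht with h1 | rfl
      · exact ih t h1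
      · exact not_lt.mp h

lemma isPivotedGramSchmidt_gsResidual (R : ℕ → E) {N : ℕ} (hN : 0 < N) (k : ℕ) :
    IsPivotedGramSchmidt k (fun r (t : Fin N) => gsResidual R N r t) (pivotVec R N)
      (fun r => ⟨pivot (gsResidual R N r) N, pivot_lt _ hN⟩) where
  u_eq r _ := rfl
  norm_le r _ t := by
    have h := inner_self_le_pivot (gsResidual R N r) N t t.2
    rw [real_inner_self_eq_norm_sq, real_inner_self_eq_norm_sq] at h
    exact abs_le_of_sq_le_sq' h (norm_nonneg _) |>.2
  res_succ r _ t := rfl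

variable [MeasurableSpace E] [BorelSpace E] [SecondCountableTopology E]

/-- The pivots are discontinuous functions of the vectors, but measurable. -/
lemma measurable_gsResidual {Ω : Type*} [MeasurableSpace Ω] {R : Ω → ℕ → E}
    (hR : ∀ t, Measurable fun ω => R ω t) (N r : ℕ) :
    (∀ t, Measurable fun ω => gsResidual (R ω) N r t) ∧
      Measurable fun ω => pivotVec (R ω) N r := by
  have hp : ∀ {S : Ω → ℕ → E}, (∀ t, Measurable fun ω => S ω t) →
      ∀ n, (Measurable fun ω => pivot (S ω) n) ∧ Measurable fun ω => S ω (pivot (S ω) n) := by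
    intro S hS n
    have hc : ∀ {q : Ω → ℕ}, Measurable q → Measurable fun ω => S ω (q ω) := fun {q} hq =>
      (measurable_from_prod_countable_left (f := fun p : Ω × ℕ => S p.1 p.2) hS).comp
        (measurable_id.prodMk hq)
    have h1 : Measurable fun ω => pivot (S ω) n := by
      induction n with
      | zero => exact measurable_const
      | succ n ih =>
        simp only [pivot]
        exact Measurable.ite (measurableSet_lt ((hc ih).inner (hc ih)) ((hS n).inner (hS n)))
          measurable_const ih
    exact ⟨h1, hc h1⟩
  induction r with
  | zero => exact ⟨hR, (hp hR N).2⟩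
  | succ r ih =>
    have h1 : ∀ t, Measurable fun ω => gsResidual (R ω) N (r + 1) t := by
      intro t
      have hu := ih.2
      exact (ih.1 t).sub ((((ih.1 t).inner hu).div (hu.inner hu)).smul hu)
    exact ⟨h1, (hp h1 N).2⟩

end Pivot

/-! ### The two halves of the sample are independent -/

section Blocks

variable {Ω T : Type*} [MeasurableSpace Ω] [Fintype T] (p : T → Prop) [DecidablePred p]

/-- Exchanging some of the coordinates of a random vector with independent identically distributed
coordinates for fresh copies preserves the distribution. -/
lemma measurePreserving_merge (μ : Measure Ω) [IsProbabilityMeasure μ] :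
    MeasurePreserving (fun q : (T → Ω) × (T → Ω) => fun i => if p i then q.1 i else q.2 i)
      ((Measure.pi fun _ => μ).prod (Measure.pi fun _ => μ)) (Measure.pi fun _ => μ) := by
  have hm : Measurable (fun q : (T → Ω) × (T → Ω) => fun i => if p i then q.1 i else q.2 i) := by
    refine measurable_pi_lambda _ fun i => ?_
    split_ifs <;> fun_prop
  refine ⟨hm, (Measure.pi_eq fun s hs => ?_).symm⟩
  rw [Measure.map_apply hm (MeasurableSet.univ_pi hs)]
  have e : (fun q : (T → Ω) × (T → Ω) => fun i => if p i then q.1 i else q.2 i) ⁻¹'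
      (Set.univ.pi s) = (Set.univ.pi fun i => if p i then s i else Set.univ) ×ˢ
        (Set.univ.pi fun i => if p i then Set.univ else s i) := by
    ext q
    simp only [Set.mem_preimage, Set.mem_univ_pi, Set.mem_prod]
    rw [← forall_and]
    refine forall_congr' fun i => ?_
    split_ifs <;> simp
  rw [e, Measure.prod_prod, Measure.pi_pi, Measure.pi_pi, ← Finset.prod_mul_distrib]
  refine Finset.prod_congr rfl fun i _ => ?_
  split_ifs <;> simp

/-- A bound for the conditional mean given some of the coordinates bounds the mean. -/
lemma lintegral_pi_le_of_merge (μ : Measure Ω) [IsProbabilityMeasure μ] {D : (T → Ω) → ENNReal}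
    (hD : Measurable D) {V : ENNReal}
    (h : ∀ X : T → Ω, ∫⁻ X' : T → Ω, D (fun i => if p i then X i else X' i)
      ∂(Measure.pi fun _ => μ) ≤ V) : ∫⁻ X, D X ∂(Measure.pi fun _ => μ) ≤ V := by
  have hmp := measurePreserving_merge p μ
  rw [← hmp.lintegral_comp hD, lintegral_prod (fun q : (T → Ω) × (T → Ω) =>
    D fun i => if p i then q.1 i else q.2 i) (hD.comp hmp.measurable).aemeasurable]
  calc _ ≤ ∫⁻ _ : T → Ω, V ∂(Measure.pi fun _ => μ) := lintegral_mono h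
    _ = V := by simp

end Blocks

/-! ### Measurability of the hypothesis -/

lemma continuous_He_prod (n : ℕ) : Continuous fun p : ℝ × ℝ => He n p.1 p.2 := by
  induction n using Nat.strong_induction_on with
  | _ n ih =>
    match n with
    | 0 => simpa [He] using continuous_const
    | 1 => simpa [He] using continuous_fst
    | n + 2 =>
      have h1 := ih n (by omega)
      have h2 := ih (n + 1) (by omega)
      simp only [He]
      fun_prop

lemma measurable_queryKernel {E Ω : Type*} [NormedAddCommGroup E] [InnerProductSpace ℝ E]
    [MeasurableSpace E] [BorelSpace E] [SecondCountableTopology E] [MeasurableSpace Ω] {k : ℕ}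
    (l : ℕ) {u : Ω → Fin k → E} {x y : Ω → E} (hu : ∀ r, Measurable fun ω => u ω r)
    (hx : Measurable x) (hy : Measurable y) :
    Measurable fun ω => queryKernel l (u ω) (x ω) (y ω) := by
  refine Finset.measurable_fun_prod _ fun r _ => Finset.measurable_fun_sum _ fun n _ => ?_
  have h1 : Measurable fun ω => ‖u ω r‖ ^ 2 := (hu r).norm.pow_const 2
  have h2 : ∀ {z : Ω → E}, Measurable z →
      Measurable fun ω => He n (inner ℝ (u ω r) (z ω)) (‖u ω r‖ ^ 2) := fun {z} hz =>
    (continuous_He_prod n).measurable.comp (((hu r).inner hz).prodMk h1)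
  exact ((h2 hx).mul (h2 hy)).div ((h1.pow_const n).mul_const _)

/-! ### The estimator and its error -/

lemma card_filter_lt {N h : ℕ} (hN : h ≤ N) :
    (Finset.univ.filter fun j : Fin N => (j : ℕ) < h).card = h := by
  rw [Fin.card_filter_val_lt, min_eq_right hN]

lemma card_filter_not_lt {N h : ℕ} (hN : h ≤ N) :
    (Finset.univ.filter fun j : Fin N => ¬ (j : ℕ) < h).card = N - h := by
  have h1 := Finset.card_filter_add_card_filter_not (s := (Finset.univ : Finset (Fin N)))
    (fun j : Fin N => (j : ℕ) < h)
  rw [card_filter_lt hN, Finset.card_univ, Fintype.card_fin] at h1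
  omega

lemma measurable_average_sub_sq {E : Type*} [MeasurableSpace E] {N : ℕ} (h : ℕ) (μ : Measure E)
    [SFinite μ] {f : E → ℝ} (hf : Measurable f) {K : E → E → ℝ}
    (hK : Measurable fun p : E × E => K p.1 p.2) :
    Measurable fun q : (Fin N → E) × E => ENNReal.ofReal ((((N - h : ℕ) : ℝ)⁻¹ *
      ∑ j ∈ Finset.univ.filter (fun j : Fin N => ¬ (j : ℕ) < h), f (q.1 j) * K q.2 (q.1 j) -
      ∫ y, f y * K q.2 y ∂μ) ^ 2) := by
  have h1 : Measurable fun x : E => ∫ y, f y * K x y ∂μ := by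
    have h2 : StronglyMeasurable fun p : E × E => f p.2 * K p.1 p.2 :=
      ((hf.comp measurable_snd).mul hK).stronglyMeasurable
    exact h2.integral_prod_right.measurable
  have h3 : ∀ j, Measurable fun q : (Fin N → E) × E => f (q.1 j) * K q.2 (q.1 j) := by
    intro j
    have hj : Measurable fun q : (Fin N → E) × E => q.1 j :=
      (measurable_pi_apply j).comp measurable_fst
    exact (hf.comp hj).mul (hK.comp (measurable_snd.prodMk hj))
  have h4 : Measurable fun q : (Fin N → E) × E => ((N - h : ℕ) : ℝ)⁻¹ *
      ∑ j ∈ Finset.univ.filter (fun j : Fin N => ¬ (j : ℕ) < h), f (q.1 j) * K q.2 (q.1 j) :=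
    (Finset.measurable_fun_sum _ fun j _ => h3 j).const_mul _
  exact ((h4.sub (h1.comp measurable_snd)).pow_const 2).ennreal_ofReal

/-- For fixed orthogonal directions, the average over the samples from `h` on is close in mean
square to the projection onto the low-degree polynomials on their span. -/
lemma lintegral_average_sub_sq_le {E : Type*} [NormedAddCommGroup E] [InnerProductSpace ℝ E]
    [FiniteDimensional ℝ E] [MeasurableSpace E] [BorelSpace E] {N k h l : ℕ} (hN : h < N)
    {f : E → ℝ} (hf : Measurable f)
    (hfn : ∀ x, |f x| ≤ ‖x‖) {u : Fin k → E}
    (hu : ∀ i j, i ≠ j → (inner ℝ (u i) (u j) : ℝ) = 0) :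
    ∫⁻ X : Fin N → E, ∫⁻ x, ENNReal.ofReal ((((N - h : ℕ) : ℝ)⁻¹ *
      ∑ j ∈ Finset.univ.filter (fun j : Fin N => ¬ (j : ℕ) < h), f (X j) * queryKernel l u x (X j) -
      ∫ y, f y * queryKernel l u x y ∂(stdGaussian E)) ^ 2)
      ∂(stdGaussian E)
      ∂(Measure.pi fun _ => stdGaussian (E)) ≤
      ENNReal.ofReal (((N - h : ℕ) : ℝ)⁻¹ * ((l + 1) ^ k * (2 * k * l + Module.finrank ℝ E))) := by
  classical
  obtain ⟨J, b, L, hK, -, hL1, hL2⟩ := exists_boxKernel_eq hu l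
  simp only [hK]
  have hS : (Finset.univ.filter fun j : Fin N => ¬ (j : ℕ) < h).Nonempty := by
    rw [← Finset.card_pos, card_filter_not_lt hN.le]; omega
  have hKc := continuous_boxKernel b L
  have hmem : ∀ x, MemLp (fun y => f y * boxKernel b L x y) 2
      (stdGaussian E) := by
    intro x
    have hm : Measurable fun y => f y * boxKernel b L x y :=
      hf.mul (hKc.comp (by fun_prop : Continuous fun y => (x, y))).measurable
    refine (memLp_two_iff_integrable_sq hm.aestronglyMeasurable).mpr
      ((integrable_norm_sq_mul_boxKernel_sq b L x).mono (hm.pow_const 2).aestronglyMeasurable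
        (Filter.Eventually.of_forall fun y => ?_))
    simp only [Real.norm_eq_abs, abs_mul, abs_pow, sq_abs, mul_pow, abs_norm]
    have := pow_le_pow_left₀ (abs_nonneg _) (hfn y) 2
    rw [sq_abs] at this
    gcongr
  have hmeas : Measurable fun q : (Fin N → E) × E =>
      ENNReal.ofReal ((((N - h : ℕ) : ℝ)⁻¹ *
      ∑ j ∈ Finset.univ.filter (fun j : Fin N => ¬ (j : ℕ) < h),
        f (q.1 j) * boxKernel b L q.2 (q.1 j) -
      ∫ y, f y * boxKernel b L q.2 y ∂(stdGaussian E)) ^ 2) :=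
    measurable_average_sub_sq h (stdGaussian E) hf hKc.measurable
  rw [lintegral_lintegral_swap (f := fun (X : Fin N → E) x =>
    ENNReal.ofReal ((((N - h : ℕ) : ℝ)⁻¹ *
      ∑ j ∈ Finset.univ.filter (fun j : Fin N => ¬ (j : ℕ) < h),
        f (X j) * boxKernel b L x (X j) -
      ∫ y, f y * boxKernel b L x y ∂(stdGaussian E)) ^ 2))
    hmeas.aemeasurable]
  have hn0 : (0 : ℝ) ≤ ((N - h : ℕ) : ℝ)⁻¹ := by positivity
  calc _ ≤ ∫⁻ x, ENNReal.ofReal (((N - h : ℕ) : ℝ)⁻¹) * ∫⁻ y, ENNReal.ofReal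
        (‖y‖ ^ 2 * boxKernel b L x y ^ 2) ∂(stdGaussian E)
        ∂(stdGaussian E) := by
        refine lintegral_mono fun x => ?_
        have h1 := lintegral_sampleMean_sub_sq_le (hmem x) _ hS
        rw [card_filter_not_lt hN.le] at h1
        refine h1.trans ?_
        rw [ENNReal.ofReal_mul hn0, ← ofReal_integral_eq_lintegral_ofReal
          (integrable_norm_sq_mul_boxKernel_sq b L x)
          (Filter.Eventually.of_forall fun y => by positivity)]
        refine mul_le_mul_right (ENNReal.ofReal_le_ofReal ?_) _
        refine integral_mono (hmem x).integrable_sq (integrable_norm_sq_mul_boxKernel_sq b L x)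
          fun y => ?_
        simp only [mul_pow]
        have := pow_le_pow_left₀ (abs_nonneg _) (hfn y) 2
        rw [sq_abs] at this
        gcongr
    _ ≤ _ := by
        rw [lintegral_const_mul' _ _ ENNReal.ofReal_ne_top, ENNReal.ofReal_mul hn0]
        refine mul_le_mul_right ((lintegral_norm_sq_mul_boxKernel_sq_le b L).trans
          (ENNReal.ofReal_le_ofReal (mul_le_mul hL1 hL2
            (Finset.sum_nonneg fun i _ => by positivity) (by positivity)))) _

section Estimator

variable {d N : ℕ}

/-- The estimates of the vectors of Hermite coefficients, from the first `h` samples. -/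
noncomputable def rowEst (m h : ℕ) (f : EuclideanSpace ℝ (Fin d) → ℝ)
    (X : Fin N → EuclideanSpace ℝ (Fin d)) (t : ℕ) : EuclideanSpace ℝ (Fin d) :=
  WithLp.toLp 2 fun b => (h : ℝ)⁻¹ * ∑ j ∈ Finset.univ.filter (fun j : Fin N => (j : ℕ) < h),
    f (X j) * hermiteFun (EuclideanSpace.basisFun (Fin d) ℝ)
      (fun b' => wordIndex d m t b' + if b' = b then 1 else 0) (X j)

/-- The pivots of the estimated coefficient vectors. -/
noncomputable def dirEst (m h : ℕ) (f : EuclideanSpace ℝ (Fin d) → ℝ)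
    (X : Fin N → EuclideanSpace ℝ (Fin d)) (r : ℕ) : EuclideanSpace ℝ (Fin d) :=
  pivotVec (rowEst m h f X) N r

/-- The output of the algorithm: the empirical version, over the samples from `h` on, of the
projection onto the low-degree polynomials on the span of the estimated directions. -/
noncomputable def netEst (k l m h : ℕ) (f : EuclideanSpace ℝ (Fin d) → ℝ)
    (X : Fin N → EuclideanSpace ℝ (Fin d)) (x : EuclideanSpace ℝ (Fin d)) : ℝ :=
  ((N - h : ℕ) : ℝ)⁻¹ * ∑ j ∈ Finset.univ.filter (fun j : Fin N => ¬ (j : ℕ) < h),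
    f (X j) * queryKernel l (fun r : Fin k => dirEst m h f X r) x (X j)

variable {f : EuclideanSpace ℝ (Fin d) → ℝ}

lemma measurable_rowEst (m h : ℕ) (hf : Measurable f) (t : ℕ) :
    Measurable fun X : Fin N → EuclideanSpace ℝ (Fin d) => rowEst m h f X t := by
  refine (WithLp.measurable_toLp 2 _).comp (measurable_pi_lambda _ fun b => ?_)
  refine Measurable.const_mul (Finset.measurable_fun_sum _ fun j _ => ?_) _
  exact (hf.comp (measurable_pi_apply j)).mul
    ((continuous_hermiteFun _ _).measurable.comp (measurable_pi_apply j))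

lemma measurable_dirEst (m h : ℕ) (hf : Measurable f) (r : ℕ) :
    Measurable fun X : Fin N → EuclideanSpace ℝ (Fin d) => dirEst m h f X r :=
  (measurable_gsResidual (fun t => measurable_rowEst m h hf t) N r).2

lemma measurable_netEst (k l m h : ℕ) (hf : Measurable f) :
    Measurable fun q : (Fin N → EuclideanSpace ℝ (Fin d)) × EuclideanSpace ℝ (Fin d) =>
      netEst k l m h f q.1 q.2 := by
  refine Measurable.const_mul (Finset.measurable_fun_sum _ fun j _ => ?_) _
  have hj : Measurable fun q : (Fin N → EuclideanSpace ℝ (Fin d)) × EuclideanSpace ℝ (Fin d) =>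
    q.1 j := (measurable_pi_apply j).comp measurable_fst
  exact (hf.comp hj).mul (measurable_queryKernel l
    (fun r => (measurable_dirEst m h hf r).comp measurable_fst) measurable_snd hj)

lemma memLp_mul_hermiteFun {E ι : Type*} [NormedAddCommGroup E] [InnerProductSpace ℝ E]
    [FiniteDimensional ℝ E] [MeasurableSpace E] [BorelSpace E] [Fintype ι] {f : E → ℝ}
    (hf : Measurable f) (hfn : ∀ x, |f x| ≤ ‖x‖) (b : OrthonormalBasis ι ℝ E) (a : ι → ℕ) :
    MemLp (fun x => f x * hermiteFun b a x) 2 (stdGaussian E) := by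
  have hm := hf.mul (continuous_hermiteFun b a).measurable
  refine (memLp_two_iff_integrable_sq hm.aestronglyMeasurable).mpr
    ((integrable_norm_sq_mul_hermiteFun_sq b a).mono (hm.pow_const 2).aestronglyMeasurable
      (Filter.Eventually.of_forall fun x => ?_))
  simp only [Pi.mul_apply, Real.norm_eq_abs, abs_mul, abs_pow, sq_abs, mul_pow, abs_norm]
  have := pow_le_pow_left₀ (abs_nonneg _) (hfn x) 2
  rw [sq_abs] at this
  gcongr

lemma integral_mul_hermiteFun_sq_le {E ι : Type*} [NormedAddCommGroup E] [InnerProductSpace ℝ E]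
    [FiniteDimensional ℝ E] [MeasurableSpace E] [BorelSpace E] [Fintype ι] {f : E → ℝ}
    (hf : Measurable f) (hfn : ∀ x, |f x| ≤ ‖x‖) (b : OrthonormalBasis ι ℝ E) (a : ι → ℕ) {n : ℕ}
    (ha : ∑ i, a i ≤ n) :
    ∫ x, (f x * hermiteFun b a x) ^ 2 ∂(stdGaussian E) ≤
      n.factorial * (2 * n + Fintype.card ι) := by
  calc ∫ x, (f x * hermiteFun b a x) ^ 2 ∂(stdGaussian E)
      ≤ ∫ x, ‖x‖ ^ 2 * hermiteFun b a x ^ 2 ∂(stdGaussian E) := by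
        refine integral_mono (memLp_mul_hermiteFun hf hfn b a).integrable_sq
          (integrable_norm_sq_mul_hermiteFun_sq b a) fun x => ?_
        simp only [mul_pow]
        have := pow_le_pow_left₀ (abs_nonneg _) (hfn x) 2
        rw [sq_abs] at this
        gcongr
    _ ≤ _ := by
        rw [integral_norm_sq_mul_hermiteFun_sq]
        have h1 : (∏ i, ((a i).factorial : ℝ)) ≤ n.factorial := by
          have h2 := Nat.le_of_dvd (Nat.factorial_pos _)
            (Nat.prod_factorial_dvd_factorial_sum Finset.univ a)
          exact_mod_cast h2.trans (Nat.factorial_le ha)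
        have h3 : ∑ i, (2 * (a i : ℝ) + 1) ≤ 2 * n + Fintype.card ι := by
          rw [Finset.sum_add_distrib, ← Finset.mul_sum]
          have : (∑ i, (a i : ℝ)) ≤ n := by exact_mod_cast ha
          simp only [Finset.sum_const, Finset.card_univ, nsmul_eq_mul, mul_one]
          linarith
        exact mul_le_mul h1 h3 (Finset.sum_nonneg fun i _ => by positivity) (by positivity)

lemma measurable_ridgeSum {E : Type} [NormedAddCommGroup E] [InnerProductSpace ℝ E]
    [FiniteDimensional ℝ E] [MeasurableSpace E] [BorelSpace E] {k : ℕ} (w : Fin k → ℝ)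
    (v : Fin k → E) : Measurable (ridgeSum w v) := by
  have := continuous_ReLU
  unfold ridgeSum
  fun_prop

/-- The coefficient vectors are estimated well, in mean square. -/
lemma lintegral_rowEst_sub_sq_le {k m h : ℕ} (hd : 0 < d) (hh : 0 < h) (hN : h ≤ N) {w : Fin k → ℝ}
    {v : Fin k → EuclideanSpace ℝ (Fin d)} (hw : ∑ i, |w i| ≤ 1) (hv : ∀ i, ‖v i‖ = 1)
    (t : ℕ) (b : Fin d) :
    ∫⁻ X : Fin N → EuclideanSpace ℝ (Fin d), ENNReal.ofReal
      ((rowEst m h (ridgeSum w v) X t b - coefVec w v (fun b => wordIndex d m t b) b) ^ 2)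
      ∂(Measure.pi fun _ => stdGaussian (EuclideanSpace ℝ (Fin d))) ≤
      ENNReal.ofReal ((h : ℝ)⁻¹ * ((m + 1).factorial * (2 * (m + 1 : ℕ) + d))) := by
  have hf := measurable_ridgeSum w v
  have hfn := abs_ridgeSum_le hw hv
  have hS : (Finset.univ.filter fun j : Fin N => (j : ℕ) < h).Nonempty := by
    rw [← Finset.card_pos, card_filter_lt hN]; exact hh
  have h1 := lintegral_sampleMean_sub_sq_le
    (memLp_mul_hermiteFun hf hfn (EuclideanSpace.basisFun (Fin d) ℝ)
      (fun b' => wordIndex d m t b' + if b' = b then 1 else 0)) _ hS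
  rw [integral_ridgeSum_mul_hermiteFun w hv (fun b => wordIndex d m t b) b, card_filter_lt hN] at h1
  refine h1.trans (ENNReal.ofReal_le_ofReal (mul_le_mul_of_nonneg_left ?_ (by positivity)))
  have h2 := integral_mul_hermiteFun_sq_le hf hfn (EuclideanSpace.basisFun (Fin d) ℝ)
    (fun b' => wordIndex d m t b' + if b' = b then 1 else 0) (n := m + 1) ?_
  · simpa using h2
  · rw [Finset.sum_add_distrib, Finset.sum_ite_eq' Finset.univ b, if_pos (Finset.mem_univ _),
      Fin.sum_univ_eq_sum_range (fun b => wordIndex d m t b)]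
    have := sum_wordIndex_le hd m t
    omega

/-- With high probability all the relevant coefficient vectors are estimated well. -/
lemma measure_rowEst_le {k m h M : ℕ} (hd : 0 < d) (hh : 0 < h) (hN : h ≤ N) {w : Fin k → ℝ}
    {v : Fin k → EuclideanSpace ℝ (Fin d)} (hw : ∑ i, |w i| ≤ 1) (hv : ∀ i, ‖v i‖ = 1) {τ : ℝ}
    (hτ : 0 < τ) (hM : (M : ℝ) * d * ((h : ℝ)⁻¹ * ((m + 1).factorial * (2 * (m + 1 : ℕ) + d))) ≤
      τ ^ 2 / 20) :
    (Measure.pi fun _ : Fin N => stdGaussian (EuclideanSpace ℝ (Fin d)))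
      {X | ¬ ∀ t < M, ‖rowEst m h (ridgeSum w v) X t -
        coefVec w v (fun b => wordIndex d m t b)‖ ≤ τ} ≤ 1 / 20 := by
  have hf := measurable_ridgeSum w v
  let D : (Fin N → EuclideanSpace ℝ (Fin d)) → ENNReal := fun X =>
    ∑ t ∈ Finset.range M, ∑ b, ENNReal.ofReal
      ((rowEst m h (ridgeSum w v) X t b - coefVec w v (fun b => wordIndex d m t b) b) ^ 2)
  have hterm : ∀ t b, Measurable fun X : Fin N → EuclideanSpace ℝ (Fin d) => ENNReal.ofReal
      ((rowEst m h (ridgeSum w v) X t b - coefVec w v (fun b => wordIndex d m t b) b) ^ 2) := by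
    intro t b
    have h1 : Measurable fun X : Fin N → EuclideanSpace ℝ (Fin d) =>
        rowEst m h (ridgeSum w v) X t b :=
      (by fun_prop : Measurable fun x : EuclideanSpace ℝ (Fin d) => x b).comp
        (measurable_rowEst m h hf t)
    exact ((h1.sub_const _).pow_const 2).ennreal_ofReal
  have hD : Measurable D := Finset.measurable_fun_sum _ fun t _ =>
    Finset.measurable_fun_sum _ fun b _ => hterm t b
  obtain ⟨V, hV⟩ : ∃ V, V = (h : ℝ)⁻¹ * ((m + 1).factorial * (2 * (m + 1 : ℕ) + d)) := ⟨_, rfl⟩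
  rw [← hV] at hM
  have hint : ∫⁻ X, D X ∂(Measure.pi fun _ : Fin N => stdGaussian (EuclideanSpace ℝ (Fin d))) ≤
      ENNReal.ofReal (τ ^ 2 / 20) := by
    rw [lintegral_finsetSum _ fun t _ => Finset.measurable_fun_sum _ fun b _ => hterm t b]
    calc _ ≤ ∑ _t ∈ Finset.range M, ∑ _b : Fin d, ENNReal.ofReal V := by
          refine Finset.sum_le_sum fun t _ => ?_
          rw [lintegral_finsetSum _ fun b _ => hterm t b]
          rw [hV]
          exact Finset.sum_le_sum fun b _ => lintegral_rowEst_sub_sq_le hd hh hN hw hv t b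
      _ = ENNReal.ofReal (M * d * V) := by
          rw [ENNReal.ofReal_mul (by positivity), ENNReal.ofReal_mul (by positivity)]
          simp only [Finset.sum_const, Finset.card_range, Finset.card_univ, Fintype.card_fin,
            nsmul_eq_mul, ENNReal.ofReal_natCast, mul_assoc]
      _ ≤ _ := ENNReal.ofReal_le_ofReal hM
  have hsub : {X | ¬ ∀ t < M, ‖rowEst m h (ridgeSum w v) X t -
        coefVec w v (fun b => wordIndex d m t b)‖ ≤ τ} ⊆ {X | ENNReal.ofReal (τ ^ 2) ≤ D X} := by
    intro X hX
    simp only [Set.mem_ofPred_eq] at hX ⊢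
    push Not at hX
    obtain ⟨t, ht, hlt⟩ := hX
    calc ENNReal.ofReal (τ ^ 2) ≤ ENNReal.ofReal (‖rowEst m h (ridgeSum w v) X t -
        coefVec w v (fun b => wordIndex d m t b)‖ ^ 2) :=
          ENNReal.ofReal_le_ofReal (pow_le_pow_left₀ hτ.le hlt.le 2)
      _ = ∑ b, ENNReal.ofReal ((rowEst m h (ridgeSum w v) X t b -
            coefVec w v (fun b => wordIndex d m t b) b) ^ 2) := by
          rw [EuclideanSpace.norm_sq_eq, ENNReal.ofReal_sum_of_nonneg fun _ _ => by positivity]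
          simp
      _ ≤ D X := Finset.single_le_sum (f := fun t => ∑ b, ENNReal.ofReal
          ((rowEst m h (ridgeSum w v) X t b - coefVec w v (fun b => wordIndex d m t b) b) ^ 2))
          (fun _ _ => zero_le) (Finset.mem_range.mpr ht)
  have hτ2 : ENNReal.ofReal (τ ^ 2) ≠ 0 := by simp; positivity
  refine (measure_mono hsub).trans ((meas_ge_le_lintegral_div hD.aemeasurable hτ2
    ENNReal.ofReal_ne_top).trans ?_)
  refine (ENNReal.div_le_div_right hint _).trans ?_
  rw [← ENNReal.ofReal_div_of_pos (by positivity)]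
  have : τ ^ 2 / 20 / τ ^ 2 = 1 / 20 := by field_simp
  rw [this, ENNReal.ofReal_div_of_pos (by norm_num)]
  simp

/-- The estimated coefficient vectors depend only on the first `h` samples. -/
lemma rowEst_merge (m h : ℕ) (f : EuclideanSpace ℝ (Fin d) → ℝ)
    (X X' : Fin N → EuclideanSpace ℝ (Fin d)) :
    rowEst m h f (fun i => if (i : ℕ) < h then X i else X' i) = rowEst m h f X := by
  funext t
  simp only [rowEst]
  congr 1
  funext b
  congr 1
  refine Finset.sum_congr rfl fun j hj => ?_
  rw [if_pos (Finset.mem_filter.mp hj).2]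

/-- The mean square distance of the output to the projection of the target onto the low-degree
polynomials on the span of the estimated directions. -/
lemma lintegral_netEst_sub_sq_le {k h l m : ℕ} (hN : h < N) (hf : Measurable f)
    (hfn : ∀ x, |f x| ≤ ‖x‖) :
    (Measurable fun X : Fin N → EuclideanSpace ℝ (Fin d) => ∫⁻ x, ENNReal.ofReal
      ((netEst k l m h f X x - ∫ y, f y * queryKernel l (fun r : Fin k => dirEst m h f X r) x y
        ∂(stdGaussian (EuclideanSpace ℝ (Fin d)))) ^ 2)
      ∂(stdGaussian (EuclideanSpace ℝ (Fin d)))) ∧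
    ∫⁻ X : Fin N → EuclideanSpace ℝ (Fin d), ∫⁻ x, ENNReal.ofReal
      ((netEst k l m h f X x - ∫ y, f y * queryKernel l (fun r : Fin k => dirEst m h f X r) x y
        ∂(stdGaussian (EuclideanSpace ℝ (Fin d)))) ^ 2)
      ∂(stdGaussian (EuclideanSpace ℝ (Fin d)))
      ∂(Measure.pi fun _ => stdGaussian (EuclideanSpace ℝ (Fin d))) ≤
      ENNReal.ofReal (((N - h : ℕ) : ℝ)⁻¹ * ((l + 1) ^ k * (2 * k * l + d))) := by
  have hmeas : Measurable fun X : Fin N → EuclideanSpace ℝ (Fin d) => ∫⁻ x, ENNReal.ofReal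
      ((netEst k l m h f X x - ∫ y, f y * queryKernel l (fun r : Fin k => dirEst m h f X r) x y
        ∂(stdGaussian (EuclideanSpace ℝ (Fin d)))) ^ 2)
      ∂(stdGaussian (EuclideanSpace ℝ (Fin d))) := by
    have h1 : Measurable fun q : (Fin N → EuclideanSpace ℝ (Fin d)) × EuclideanSpace ℝ (Fin d) =>
        ∫ y, f y * queryKernel l (fun r : Fin k => dirEst m h f q.1 r) q.2 y
          ∂(stdGaussian (EuclideanSpace ℝ (Fin d))) := by
      have h2 : StronglyMeasurable fun p : ((Fin N → EuclideanSpace ℝ (Fin d)) ×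
          EuclideanSpace ℝ (Fin d)) × EuclideanSpace ℝ (Fin d) =>
          f p.2 * queryKernel l (fun r : Fin k => dirEst m h f p.1.1 r) p.1.2 p.2 :=
        ((hf.comp measurable_snd).mul (measurable_queryKernel l
          (fun r => (measurable_dirEst m h hf r).comp (measurable_fst.comp measurable_fst))
          (measurable_snd.comp measurable_fst) measurable_snd)).stronglyMeasurable
      exact h2.integral_prod_right.measurable
    exact Measurable.lintegral_prod_right'
      (((measurable_netEst k l m h hf).sub h1).pow_const 2).ennreal_ofReal
  refine ⟨hmeas, lintegral_pi_le_of_merge (fun j : Fin N => (j : ℕ) < h) _ hmeas fun X => ?_⟩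
  have hd : ∀ X' : Fin N → EuclideanSpace ℝ (Fin d),
      dirEst m h f (fun i => if (i : ℕ) < h then X i else X' i) = dirEst m h f X := by
    intro X'
    funext r
    simp only [dirEst, rowEst_merge]
  simp only [netEst, hd]
  have hle := lintegral_average_sub_sq_le (l := l) hN hf hfn
    (u := fun r : Fin k => dirEst m h f X r) fun i j hij =>
      (isPivotedGramSchmidt_gsResidual (rowEst m h f X) (by omega) k).inner_u i.2 j.2
        (Fin.val_injective.ne hij)
  rw [finrank_euclideanSpace_fin] at hle
  refine le_trans (le_of_eq ?_) hle
  refine lintegral_congr fun X' => lintegral_congr fun x => ?_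
  have e : ∑ j ∈ Finset.univ.filter (fun j : Fin N => ¬ (j : ℕ) < h),
      f (if (j : ℕ) < h then X j else X' j) * queryKernel l (fun r : Fin k => dirEst m h f X r) x
        (if (j : ℕ) < h then X j else X' j) =
      ∑ j ∈ Finset.univ.filter (fun j : Fin N => ¬ (j : ℕ) < h),
        f (X' j) * queryKernel l (fun r : Fin k => dirEst m h f X r) x (X' j) :=
    Finset.sum_congr rfl fun j hj => by rw [if_neg (Finset.mem_filter.mp hj).2]
  rw [e]

lemma eLpNorm_two_eq_ofReal_l2norm {Ω : Type*} [MeasurableSpace Ω] {μ : Measure Ω} {g : Ω → ℝ}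
    (hg : MemLp g 2 μ) : eLpNorm g 2 μ = ENNReal.ofReal (l2norm μ g) := by
  rw [hg.eLpNorm_eq_integral_rpow_norm (by norm_num) (by norm_num), l2norm, Real.sqrt_eq_rpow]
  simp

/-- The estimator has small error with high probability, provided that the numbers of samples in
the two parts are large enough. -/
theorem measure_netEst_le {k h l : ℕ} (hd : 0 < d) (hh : 0 < h) (hN : h < N)
    (hl : 1 ≤ l) {w : Fin k → ℝ} {v : Fin k → EuclideanSpace ℝ (Fin d)} (hw : ∑ i, |w i| ≤ 1)
    (hv : ∀ i, ‖v i‖ = 1) {τ ε : ℝ} (hτ : 0 < τ) (hε : 0 < ε)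
    (hM : (d + 1) ^ (2 * k) ≤ N)
    (h1 : ((d + 1 : ℝ) ^ (2 * k)) * d * ((h : ℝ)⁻¹ *
      ((2 * k + 1).factorial * (2 * (2 * k + 1 : ℕ) + d))) ≤ τ ^ 2 / 20)
    (h2 : 1 / √(l : ℝ) + (l + 1) ^ (k + 2) * (d ^ k * (3 * ((2 ^ (k + 1) + 1) * τ))) ≤ ε / 2)
    (h3 : ((N - h : ℕ) : ℝ)⁻¹ * ((l + 1) ^ k * (2 * k * l + d)) ≤ (ε / 2) ^ 2 / 20) :
    (Measure.pi fun _ : Fin N => stdGaussian (EuclideanSpace ℝ (Fin d)))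
      {X | ¬ (MemLp (fun x => netEst k l (2 * k) h (ridgeSum w v) X x - ridgeSum w v x) 2
            (stdGaussian (EuclideanSpace ℝ (Fin d))) ∧
          eLpNorm (fun x => netEst k l (2 * k) h (ridgeSum w v) X x - ridgeSum w v x) 2
            (stdGaussian (EuclideanSpace ℝ (Fin d))) ≤ ENNReal.ofReal ε)} ≤ 1 / 10 := by
  classical
  set f := ridgeSum w v with hfdef
  have hf : Measurable f := measurable_ridgeSum w v
  have hfn := abs_ridgeSum_le hw hv
  obtain ⟨hDm, hDle⟩ := lintegral_netEst_sub_sq_le (k := k) (l := l) (m := 2 * k) hN hf hfn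
  set D : (Fin N → EuclideanSpace ℝ (Fin d)) → ENNReal := fun X => ∫⁻ x, ENNReal.ofReal
      ((netEst k l (2 * k) h f X x - ∫ y, f y * queryKernel l
        (fun r : Fin k => dirEst (2 * k) h f X r) x y
        ∂(stdGaussian (EuclideanSpace ℝ (Fin d)))) ^ 2)
      ∂(stdGaussian (EuclideanSpace ℝ (Fin d))) with hD
  have hA := measure_rowEst_le (N := N) (m := 2 * k) (M := (d + 1) ^ (2 * k)) hd hh hN.le hw hv hτ
    (by push_cast at h1 ⊢; exact h1)
  have hB : (Measure.pi fun _ : Fin N => stdGaussian (EuclideanSpace ℝ (Fin d)))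
      {X | ENNReal.ofReal ((ε / 2) ^ 2) ≤ D X} ≤ 1 / 20 := by
    have h0 : ENNReal.ofReal ((ε / 2) ^ 2) ≠ 0 := by simp; positivity
    refine (meas_ge_le_lintegral_div hDm.aemeasurable h0 ENNReal.ofReal_ne_top).trans ?_
    refine (ENNReal.div_le_div_right (hDle.trans (ENNReal.ofReal_le_ofReal h3)) _).trans ?_
    rw [← ENNReal.ofReal_div_of_pos (by positivity)]
    have : (ε / 2) ^ 2 / 20 / (ε / 2) ^ 2 = 1 / 20 := by field_simp
    rw [this, ENNReal.ofReal_div_of_pos (by norm_num)]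
    simp
  -- The two bad events: a poor estimate of a coefficient vector, and a large sampling error of the
  -- projection.
  refine (measure_mono (t := {X | ¬ ∀ t < (d + 1) ^ (2 * k), ‖rowEst (2 * k) h f X t -
        coefVec w v (fun b => wordIndex d (2 * k) t b)‖ ≤ τ} ∪
      {X | ENNReal.ofReal ((ε / 2) ^ 2) ≤ D X}) fun X hX => ?_).trans
    ((measure_union_le _ _).trans ((add_le_add hA hB).trans_eq ?_))
  · by_contra hcon
    simp only [Set.mem_union, Set.mem_ofPred_eq, not_or, not_not, not_le] at hcon hX
    obtain ⟨hr, hDX⟩ := hcon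
    apply hX
    have hN0 : 0 < N := by omega
    have hP := isPivotedGramSchmidt_gsResidual (rowEst (2 * k) h f X) hN0 k
    obtain ⟨J, b, L, hK, hspan, -, -⟩ := exists_boxKernel_eq
      (u := fun r : Fin k => dirEst (2 * k) h f X r)
      (fun i j hij => hP.inner_u i.2 j.2 (Fin.val_injective.ne hij)) l
    have hproj := integral_ridgeSum_sub_boxProj_sq_le hd hw hv hP
      (fun t b => wordIndex d (2 * k) t b) (fun β hβ => ?_) hτ.le (fun t => ?_) hl b L hspan
    · have hgm := memLp_boxProj b L f
      have hfm : MemLp f 2 (stdGaussian (EuclideanSpace ℝ (Fin d))) := memLp_ridgeSum w hv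
      have hnm : MemLp (netEst k l (2 * k) h f X) 2
          (stdGaussian (EuclideanSpace ℝ (Fin d))) := by
        refine MemLp.const_mul (f := fun x => ∑ j ∈ Finset.univ.filter
          (fun j : Fin N => ¬ (j : ℕ) < h), f (X j) *
            queryKernel l (fun r : Fin k => dirEst (2 * k) h f X r) x (X j)) ?_ _
        refine memLp_finsetSum _ fun j _ => ?_
        simp only [hK]
        exact (memLp_boxKernel b L (X j)).const_mul _
      have hDX' : l2norm (stdGaussian (EuclideanSpace ℝ (Fin d)))
          (fun x => netEst k l (2 * k) h f X x - boxProj b L f x) ≤ ε / 2 := by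
        refine Real.sqrt_le_iff.mpr ⟨by positivity, ?_⟩
        simp only [hD, hK, integral_mul_boxKernel b L hfm] at hDX
        have hi : Integrable (fun x => (netEst k l (2 * k) h f X x - boxProj b L f x) ^ 2)
            (stdGaussian (EuclideanSpace ℝ (Fin d))) := (hnm.sub hgm).integrable_sq
        rw [← ofReal_integral_eq_lintegral_ofReal hi
          (Filter.Eventually.of_forall fun x => sq_nonneg _)] at hDX
        exact ((ENNReal.ofReal_lt_ofReal_iff (by positivity)).mp hDX).le
      have hproj' : l2norm (stdGaussian (EuclideanSpace ℝ (Fin d)))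
          (fun x => boxProj b L f x - f x) ≤ ε / 2 := by
        refine Real.sqrt_le_iff.mpr ⟨by positivity, ?_⟩
        have e : ∀ x, (boxProj b L f x - f x) ^ 2 = (f x - boxProj b L f x) ^ 2 := by
          intro x; ring
        simp_rw [e]
        exact hproj.trans (pow_le_pow_left₀ (by positivity) h2 2)
      have hm : MemLp (fun x => netEst k l (2 * k) h f X x - f x) 2
          (stdGaussian (EuclideanSpace ℝ (Fin d))) := hnm.sub hfm
      refine ⟨hm, ?_⟩
      rw [eLpNorm_two_eq_ofReal_l2norm hm]
      refine ENNReal.ofReal_le_ofReal ?_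
      have hsum := l2norm_add_le (hnm.sub hgm) (hgm.sub hfm)
      have e : (fun x => netEst k l (2 * k) h f X x - f x) = fun x =>
          (netEst k l (2 * k) h f X - boxProj b L f) x + (boxProj b L f - f) x := by
        funext x; simp
      rw [e]
      exact (hsum.trans (add_le_add hDX' hproj')).trans_eq (add_halves ε)
    · obtain ⟨t, ht, htb⟩ := exists_wordIndex_eq_of_le (m := 2 * k) β (by omega)
      exact ⟨⟨t, ht.trans_le hM⟩, funext htb⟩
    · -- The multi-index in position `t` also occurs among the first `(d + 1) ^ (2 * k)` positions.
      obtain ⟨s, hs, hsb⟩ := exists_wordIndex_eq_of_le (m := 2 * k)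
        (fun b : Fin d => wordIndex d (2 * k) t b) (by
          rw [Fin.sum_univ_eq_sum_range (fun b => wordIndex d (2 * k) t b)]
          exact sum_wordIndex_le hd _ _)
      have e1 : rowEst (2 * k) h f X t = rowEst (2 * k) h f X s := by
        simp only [rowEst, hsb]
      have e2 : (fun b : Fin d => wordIndex d (2 * k) t b) =
          fun b : Fin d => wordIndex d (2 * k) s b :=
        funext fun b => (hsb b).symm
      change ‖rowEst (2 * k) h f X t - _‖ ≤ τ
      rw [e1, e2]
      exact hr s hs
  · have e1 : (1 / 20 : ENNReal) = ENNReal.ofReal (1 / 20) := by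
      rw [ENNReal.ofReal_div_of_pos (by norm_num)]; simp
    have e2 : (1 / 10 : ENNReal) = ENNReal.ofReal (1 / 10) := by
      rw [ENNReal.ofReal_div_of_pos (by norm_num)]; simp
    rw [e1, e2, ← ENNReal.ofReal_add (by norm_num) (by norm_num)]
    norm_num

end Estimator

/-! ### The sample size suffices -/

section SampleSize

lemma pow_le_pow_mul_of_le {B : ℝ} (hB : 1 ≤ B) {k a b : ℕ} (hk : 0 < k) (c : ℕ)
    (h : a + b ≤ c := by omega) : B ^ (a * k + b) ≤ B ^ (c * k) := by
  refine pow_le_pow_right₀ hB ?_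
  calc a * k + b ≤ a * k + b * k := Nat.add_le_add_left (Nat.le_mul_of_pos_right b hk) _
    _ = (a + b) * k := (add_mul _ _ _).symm
    _ ≤ c * k := Nat.mul_le_mul_right k h

set_option maxHeartbeats 1000000 in
/-- All the quantities in the error analysis are bounded by powers `B ^ (a * k)` of
`B = d * k / ε`, with small constants `a`, while `N ≥ B ^ (100 * k)`; the accuracy of the
coefficient vectors is taken to be `τ = B ^ (-30 * k)`. -/
theorem exists_accuracy {d k N : ℕ} {ε C : ℝ} (hd : 0 < d) (hk : 0 < k) (hε : 0 < ε)
    (hε1 : ε ≤ 1 / 2) (hC : 100 ≤ C)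
    (hN : N = ⌈((d : ℝ) * (k : ℝ) / ε) ^ (C * (k : ℝ))⌉₊) :
    2 * k + 1 ≤ N ∧ d ≤ N ∧ (d + 1) ^ (2 * k) ≤ N ∧ 16 ≤ N * ε * ε ∧
    ∀ h l : ℕ, h = (N + 1) / 2 → 16 ≤ l * ε * ε → ((l : ℝ) - 1) * ε * ε ≤ 16 →
      0 < h ∧ h < N ∧ 1 ≤ l ∧ l + 1 ≤ N ∧ ∃ τ : ℝ, 0 < τ ∧
        ((d + 1 : ℝ) ^ (2 * k)) * d * ((h : ℝ)⁻¹ *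
          ((2 * k + 1).factorial * (2 * (2 * k + 1 : ℕ) + d))) ≤ τ ^ 2 / 20 ∧
        1 / √(l : ℝ) + (l + 1) ^ (k + 2) * (d ^ k * (3 * ((2 ^ (k + 1) + 1) * τ))) ≤ ε / 2 ∧
        ((N - h : ℕ) : ℝ)⁻¹ * ((l + 1) ^ k * (2 * k * l + d)) ≤ (ε / 2) ^ 2 / 20 := by
  have hd1 : (1 : ℝ) ≤ d := by exact_mod_cast hd
  have hk1 : (1 : ℝ) ≤ k := by exact_mod_cast hk
  obtain ⟨B, hBdef⟩ : ∃ B : ℝ, B = (d : ℝ) * k / ε := ⟨_, rfl⟩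
  rw [← hBdef] at hN
  have hBε : B * ε = d * k := by rw [hBdef]; field_simp
  have hB2 : 2 ≤ B := by
    by_contra! h
    nlinarith
  have hB1 : 1 ≤ B := by linarith
  have hB0 : 0 < B := by linarith
  have hdB : (d : ℝ) ≤ B := by nlinarith
  have hkB : (k : ℝ) ≤ B := by nlinarith
  have hεB : 1 ≤ B * ε := by rw [hBε]; nlinarith
  have hNB : B ^ (100 * k) ≤ N := by
    have h1 : B ^ ((100 * k : ℕ) : ℝ) ≤ B ^ (C * (k : ℝ)) := by
      refine Real.rpow_le_rpow_of_exponent_le hB1 ?_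
      push_cast
      exact mul_le_mul_of_nonneg_right hC (by positivity)
    rw [Real.rpow_natCast] at h1
    rw [hN]
    exact h1.trans (Nat.le_ceil _)
  have hpow : ∀ {a b : ℕ}, a ≤ b → B ^ a ≤ B ^ b := fun h => pow_le_pow_right₀ hB1 h
  have hc : ∀ n : ℕ, (2 : ℝ) ^ n ≤ B ^ n := fun n => pow_le_pow_left₀ (by norm_num) hB2 n
  have hN_of : ∀ a : ℕ, a ≤ 100 → ∀ x : ℝ, x ≤ B ^ a → x ≤ N := fun a ha x hx =>
    hx.trans ((hpow (by nlinarith)).trans hNB)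
  have h2k : (2 * k + 1 : ℝ) ≤ B ^ 3 := by
    have := hc 2
    nlinarith [sq_nonneg (B - 2)]
  have hd2 : (d + 1 : ℝ) ≤ B ^ 2 := by nlinarith
  have hd2k : ((d : ℝ) + 1) ^ (2 * k) ≤ B ^ (4 * k) := by
    calc ((d : ℝ) + 1) ^ (2 * k) ≤ (B ^ 2) ^ (2 * k) := pow_le_pow_left₀ (by positivity) hd2 _
      _ = B ^ (4 * k) := by rw [← pow_mul]; congr 1; ring
  have hεε : 1 ≤ B ^ 2 * ε * ε := by nlinarith
  have h16 : (16 : ℝ) ≤ B ^ 4 := by have := hc 4; linarith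
  have hNε : 16 ≤ N * ε * ε := by
    have h1 : B ^ 6 ≤ N := hN_of 6 (by norm_num) _ le_rfl
    have h2 : B ^ 6 * ε * ε ≤ N * ε * ε := by gcongr
    have h3 : B ^ 6 * ε * ε = B ^ 4 * (B ^ 2 * ε * ε) := by ring
    nlinarith
  refine ⟨?_, ?_, ?_, hNε, ?_⟩
  · exact_mod_cast hN_of 3 (by norm_num) _ h2k
  · have h1 : (d : ℝ) ≤ N := hN_of 1 (by norm_num) _ (by simpa using hdB)
    exact_mod_cast h1
  · have h1 : ((d : ℝ) + 1) ^ (2 * k) ≤ N := hd2k.trans ((hpow (by nlinarith)).trans hNB)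
    exact_mod_cast h1
  intro h l hh hl1 hl2
  have hN2 : (2 : ℝ) ≤ N := hN_of 1 (by norm_num) _ (by simpa using hB2)
  have hN2' : 2 ≤ N := by exact_mod_cast hN2
  have hN0 : (0 : ℝ) < N := by linarith
  have hhpos : 0 < h := by omega
  have hhN : h < N := by omega
  have hl0 : 1 ≤ l := by
    rcases Nat.eq_zero_or_pos l with rfl | h0
    · norm_num at hl1
    · exact h0
  have hlB : (l + 1 : ℝ) ≤ B ^ 7 := by
    -- `l ≤ 16 / ε ^ 2 + 1 ≤ 16 * B ^ 2 + 1`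
    have h1 : (l : ℝ) - 1 ≤ 16 * B ^ 2 := by
      by_contra! hcon
      have h2 : 16 * B ^ 2 * ε * ε < ((l : ℝ) - 1) * ε * ε := by gcongr
      nlinarith
    have h2 : (32 : ℝ) ≤ B ^ 5 := by have := hc 5; linarith
    have h3 : B ^ 7 = B ^ 5 * B ^ 2 := by ring
    nlinarith [sq_nonneg (B - 2)]
  have hhinv : (h : ℝ)⁻¹ ≤ B / N := by
    have h1 : (N : ℝ) ≤ 2 * h := by
      have : N ≤ 2 * h := by omega
      exact_mod_cast this
    rw [inv_eq_one_div, div_le_div_iff₀ (by exact_mod_cast hhpos) hN0]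
    have h0 : (0 : ℝ) ≤ h := by positivity
    nlinarith
  have hNhinv : ((N - h : ℕ) : ℝ)⁻¹ ≤ B ^ 2 / N := by
    have h1 : (N : ℝ) ≤ 4 * (N - h : ℕ) := by
      have : N ≤ 4 * (N - h) := by omega
      exact_mod_cast this
    have h0 : (0 : ℝ) < (N - h : ℕ) := by
      have : 0 < N - h := by omega
      exact_mod_cast this
    rw [inv_eq_one_div, div_le_div_iff₀ h0 hN0]
    have := hc 2
    nlinarith
  refine ⟨hhpos, hhN, hl0, ?_, (B ^ (30 * k))⁻¹, by positivity, ?_, ?_, ?_⟩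
  · exact_mod_cast hN_of 7 (by norm_num) _ hlB
  · have hfac : ((2 * k + 1).factorial : ℝ) ≤ B ^ (6 * k + 3) := by
      calc ((2 * k + 1).factorial : ℝ) ≤ ((2 * k + 1 : ℕ) : ℝ) ^ (2 * k + 1) := by
            exact_mod_cast Nat.factorial_le_pow (2 * k + 1)
        _ ≤ (B ^ 3) ^ (2 * k + 1) := pow_le_pow_left₀ (by positivity) (by push_cast; exact h2k) _
        _ = B ^ (6 * k + 3) := by rw [← pow_mul]; congr 1; ring
    have hlin : (2 * (2 * k + 1 : ℕ) + d : ℝ) ≤ B ^ 5 := by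
      push_cast
      have h4 : (16 : ℝ) * B ≤ B ^ 4 * B := by gcongr
      have h5 : B ^ 5 = B ^ 4 * B := by ring
      linarith
    calc ((d + 1 : ℝ) ^ (2 * k)) * d * ((h : ℝ)⁻¹ *
          ((2 * k + 1).factorial * (2 * (2 * k + 1 : ℕ) + d)))
        ≤ B ^ (4 * k) * B * (B / N * (B ^ (6 * k + 3) * B ^ 5)) := by gcongr
      _ = B ^ (10 * k + 10) / N := by rw [pow_add B (10 * k)]; ring
      _ ≤ B ^ (20 * k) / N := by
          exact div_le_div_of_nonneg_right (pow_le_pow_mul_of_le hB1 hk 20) hN0.le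
      _ ≤ ((B ^ (30 * k))⁻¹) ^ 2 / 20 := by
          rw [inv_pow, ← pow_mul, div_le_div_iff₀ hN0 (by norm_num), inv_mul_eq_div,
            le_div_iff₀ (by positivity)]
          have h20 : (20 : ℝ) ≤ B ^ 5 := by have := hc 5; linarith
          calc B ^ (20 * k) * 20 * B ^ (30 * k * 2) ≤ B ^ (20 * k) * B ^ 5 * B ^ (30 * k * 2) := by
                gcongr
            _ = B ^ (80 * k + 5) := by ring
            _ ≤ B ^ (100 * k) := pow_le_pow_mul_of_le hB1 hk 100
            _ ≤ N := hNB
  · have h1 : 1 / √(l : ℝ) ≤ ε / 4 := by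
      have hs : 4 / ε ≤ √(l : ℝ) := by
        refine Real.le_sqrt_of_sq_le ?_
        rw [div_pow, div_le_iff₀ (by positivity)]
        linarith
      have hl' : 0 < √(l : ℝ) := lt_of_lt_of_le (by positivity) hs
      rw [div_le_div_iff₀ hl' (by norm_num)]
      rw [div_le_iff₀ hε] at hs
      linarith
    have h2 : ((l : ℝ) + 1) ^ (k + 2) * (d ^ k * (3 * ((2 ^ (k + 1) + 1) * (B ^ (30 * k))⁻¹))) ≤
        ε / 4 := by
      have e1 : ((2 : ℝ) ^ (k + 1) + 1) ≤ B ^ (k + 2) := by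
        refine le_trans ?_ (hc (k + 2))
        have : (1 : ℝ) ≤ 2 ^ k := one_le_pow₀ (by norm_num)
        rw [pow_succ, pow_add]; linarith
      have e2 : (3 : ℝ) ≤ B ^ 2 := by have := hc 2; linarith
      calc ((l : ℝ) + 1) ^ (k + 2) * (d ^ k * (3 * ((2 ^ (k + 1) + 1) * (B ^ (30 * k))⁻¹)))
          ≤ (B ^ 7) ^ (k + 2) * (B ^ k * (B ^ 2 * (B ^ (k + 2) * (B ^ (30 * k))⁻¹))) := by gcongr
        _ = B ^ (9 * k + 18) * (B ^ (30 * k))⁻¹ := by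
            rw [pow_add B (9 * k), pow_add, pow_add, ← pow_mul]; ring
        _ ≤ ε / 4 := by
            rw [← div_eq_mul_inv, div_le_iff₀ (by positivity)]
            have h3 : B ^ (9 * k + 21) ≤ B ^ (30 * k) := pow_le_pow_mul_of_le hB1 hk 30
            have h4 : (4 : ℝ) ≤ B ^ 2 := by have := hc 2; linarith
            calc B ^ (9 * k + 18) ≤ B ^ (9 * k + 18) * (B * ε * (B ^ 2 / 4)) := by
                  refine le_mul_of_one_le_right (by positivity) ?_
                  have : 1 ≤ B ^ 2 / 4 := by linarith
                  nlinarith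
              _ = ε / 4 * B ^ (9 * k + 21) := by
                  rw [pow_add B (9 * k) 18, pow_add B (9 * k) 21]; ring
              _ ≤ _ := by gcongr
    linarith
  · have hlin : (2 * k * l + d : ℝ) ≤ B ^ 11 := by
      have h1 : (2 * k : ℝ) ≤ B ^ 3 := by linarith
      have h2 : (l : ℝ) ≤ B ^ 7 := by linarith
      have h3 : (2 * k * l : ℝ) ≤ B ^ 3 * B ^ 7 := by gcongr
      have h4 : B ^ 11 = B ^ 3 * B ^ 7 * B := by ring
      have h5 : B ≤ B ^ 10 := by simpa using hpow (show 1 ≤ 10 by norm_num)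
      have h6 : B ^ 10 = B ^ 3 * B ^ 7 := by ring
      have h7 : 0 < B ^ 3 * B ^ 7 := by positivity
      nlinarith
    calc ((N - h : ℕ) : ℝ)⁻¹ * ((l + 1) ^ k * (2 * k * l + d))
        ≤ B ^ 2 / N * ((B ^ 7) ^ k * B ^ 11) := by gcongr
      _ = B ^ (7 * k + 13) / N := by rw [← pow_mul, pow_add]; ring
      _ ≤ (ε / 2) ^ 2 / 20 := by
          rw [div_le_iff₀ hN0]
          have h80 : (80 : ℝ) ≤ B ^ 7 := by have := hc 7; linarith
          calc B ^ (7 * k + 13) ≤ B ^ (7 * k + 13) * ((B ^ 2 * ε * ε) * (B ^ 7 / 80)) := by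
                refine le_mul_of_one_le_right (by positivity) ?_
                have : 1 ≤ B ^ 7 / 80 := by linarith
                nlinarith
            _ = (ε / 2) ^ 2 / 20 * B ^ (7 * k + 22) := by
                rw [pow_add B (7 * k) 13, pow_add B (7 * k) 22]; ring
            _ ≤ (ε / 2) ^ 2 / 20 * B ^ (100 * k) := by
                exact mul_le_mul_of_nonneg_left (pow_le_pow_mul_of_le hB1 hk 100) (by positivity)
            _ ≤ _ := by gcongr

end SampleSize

/-! ### Programs with bounded loops -/

namespace RealRAM

/-- Programs in which the only loops are counting loops. The loop `loop a j c` runs the body `c`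
for all values `0, 1, 2, …` of the counter, which is the cell `(0, 0)` of the natural-number array
`a`, below the input parameter in the cell `(0, j)` of the natural-number array `0`. -/
inductive Cmd where
  | skip
  | setNat (a : ℕ) (i j e : NatExp)
  | setReal (a : ℕ) (i j : NatExp) (e : RealExp)
  | seq (c d : Cmd)
  | ite (b : Test) (c d : Cmd)
  | loop (a j : ℕ) (c : Cmd)

namespace Cmd

/-- Translation into the language of the real RAM. -/
def compile : Cmd → Prog
  | skip => .skip
  | setNat a i j e => .setNat a i j e
  | setReal a i j e => .setReal a i j e
  | seq c d => .seq c.compile d.compile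
  | ite b c d => .ite b c.compile d.compile
  | loop a j c => .seq (.setNat a (.lit 0) (.lit 0) (.lit 0))
      (.while (.natLt (.cell a (.lit 0) (.lit 0)) (.cell 0 (.lit 0) (.lit j)))
        (.seq c.compile (.setNat a (.lit 0) (.lit 0) (.add (.cell a (.lit 0) (.lit 0)) (.lit 1)))))

open Classical in
/-- The effect of a program on the memory. -/
noncomputable def den : Cmd → State → State
  | skip, σ => σ
  | setNat a i j e, σ => σ.setNat a (i.eval σ) (j.eval σ) (e.eval σ)
  | setReal a i j e, σ => σ.setReal a (i.eval σ) (j.eval σ) (e.eval σ)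
  | seq c d, σ => d.den (c.den σ)
  | ite b c d, σ => if b.holds σ then c.den σ else d.den σ
  | loop a j c, σ =>
      Nat.rec (σ.setNat a 0 0 0) (fun i τ => (c.den τ).setNat a 0 0 (i + 1)) (σ.nat 0 0 j)

/-- A bound for the running time if all parameters are at most `L`. -/
def cost (L : ℕ) : Cmd → ℕ
  | skip => 1
  | setNat _ i j e => i.cost + j.cost + e.cost + 1
  | setReal _ i j e => i.cost + j.cost + e.cost + 1
  | seq c d => c.cost L + d.cost L
  | ite b c d => b.cost + (c.cost L + d.cost L)
  | loop _ _ c => 11 + L * (15 + c.cost L)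

/-- The natural-number arrays to which a program may write. -/
def natWrites : Cmd → List ℕ
  | skip => []
  | setNat a _ _ _ => [a]
  | setReal _ _ _ _ => []
  | seq c d => c.natWrites ++ d.natWrites
  | ite _ c d => c.natWrites ++ d.natWrites
  | loop a _ c => a :: c.natWrites

/-- The real arrays to which a program may write. -/
def realWrites : Cmd → List ℕ
  | skip => []
  | setNat _ _ _ _ => []
  | setReal a _ _ _ => [a]
  | seq c d => c.realWrites ++ d.realWrites
  | ite _ c d => c.realWrites ++ d.realWrites
  | loop _ _ c => c.realWrites

/-- No loop body writes to its counter. -/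
def ok : Cmd → Bool
  | skip => true
  | setNat _ _ _ _ => true
  | setReal _ _ _ _ => true
  | seq c d => c.ok && d.ok
  | ite _ c d => c.ok && d.ok
  | loop a _ c => decide (a ∉ c.natWrites) && c.ok

end Cmd

@[simp] lemma State.setNat_real (σ : State) (a i j n : ℕ) : (σ.setNat a i j n).real = σ.real := rfl

@[simp] lemma State.setReal_nat (σ : State) (a i j : ℕ) (r : ℝ) :
    (σ.setReal a i j r).nat = σ.nat := rfl

lemma State.setNat_nat_of_ne (σ : State) {a b : ℕ} (h : b ≠ a) (i j n : ℕ) :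
    (σ.setNat a i j n).nat b = σ.nat b := by
  funext i' j'
  exact if_neg fun h' => h h'.1

lemma State.setReal_real_of_ne (σ : State) {a b : ℕ} (h : b ≠ a) (i j : ℕ) (r : ℝ) :
    (σ.setReal a i j r).real b = σ.real b := by
  funext i' j'
  exact if_neg fun h' => h h'.1

@[simp] lemma State.setNat_nat_apply (σ : State) (a i j n i' j' : ℕ) :
    (σ.setNat a i j n).nat a i' j' = if i' = i ∧ j' = j then n else σ.nat a i' j' := by
  simp [State.setNat]

@[simp] lemma State.setReal_real_apply (σ : State) (a i j : ℕ) (r : ℝ) (i' j' : ℕ) :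
    (σ.setReal a i j r).real a i' j' = if i' = i ∧ j' = j then r else σ.real a i' j' := by
  simp [State.setReal]

/-- The memory `τ` differs from `σ` only in arrays to which the program `c` may write. -/
structure Frame (c : Cmd) (σ τ : State) : Prop where
  nat : ∀ a, a ∉ c.natWrites → τ.nat a = σ.nat a
  real : ∀ a, a ∉ c.realWrites → τ.real a = σ.real a

namespace Cmd

theorem frame_den (c : Cmd) : ∀ σ : State, Frame c σ (c.den σ) := by
  induction c with
  | skip => exact fun σ => ⟨fun _ _ => rfl, fun _ _ => rfl⟩
  | setNat a i j e =>
    exact fun σ => ⟨fun b hb => State.setNat_nat_of_ne σ (by simpa [natWrites] using hb) _ _ _,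
      fun _ _ => rfl⟩
  | setReal a i j e =>
    exact fun σ => ⟨fun _ _ => rfl,
      fun b hb => State.setReal_real_of_ne σ (by simpa [realWrites] using hb) _ _ _⟩
  | seq c d ihc ihd =>
    intro σ
    constructor
    · intro a ha
      simp only [natWrites, List.mem_append, not_or] at ha
      exact ((ihd _).nat a ha.2).trans ((ihc σ).nat a ha.1)
    · intro a ha
      simp only [realWrites, List.mem_append, not_or] at ha
      exact ((ihd _).real a ha.2).trans ((ihc σ).real a ha.1)
  | ite b c d ihc ihd =>
    intro σ
    constructor
    · intro a ha
      simp only [natWrites, List.mem_append, not_or] at ha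
      simp only [den]
      split_ifs
      · exact (ihc σ).nat a ha.1
      · exact (ihd σ).nat a ha.2
    · intro a ha
      simp only [realWrites, List.mem_append, not_or] at ha
      simp only [den]
      split_ifs
      · exact (ihc σ).real a ha.1
      · exact (ihd σ).real a ha.2
  | loop a j c ih =>
    intro σ
    constructor
    · intro b hb
      simp only [natWrites, List.mem_cons, not_or] at hb
      simp only [den]
      generalize σ.nat 0 0 j = n
      induction n with
      | zero => exact State.setNat_nat_of_ne σ hb.1 _ _ _
      | succ n ihn =>
        exact (State.setNat_nat_of_ne _ hb.1 _ _ _).trans (((ih _).nat b hb.2).trans ihn)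
    · intro b hb
      simp only [realWrites] at hb
      simp only [den]
      generalize σ.nat 0 0 j = n
      induction n with
      | zero => rfl
      | succ n ihn => exact ((ih _).real b hb).trans ihn

lemma den_nat (c : Cmd) (σ : State) {a : ℕ} (ha : a ∉ c.natWrites) : (c.den σ).nat a = σ.nat a :=
  (c.frame_den σ).nat a ha

lemma den_real (c : Cmd) (σ : State) {a : ℕ} (ha : a ∉ c.realWrites) :
    (c.den σ).real a = σ.real a :=
  (c.frame_den σ).real a ha

lemma den_ite_pos {b : Test} {σ : State} (h : b.holds σ) (c d : Cmd) :
    (ite b c d).den σ = c.den σ := if_pos h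

lemma den_ite_neg {b : Test} {σ : State} (h : ¬ b.holds σ) (c d : Cmd) :
    (ite b c d).den σ = d.den σ := if_neg h

/-- The translation of a program computes its effect, within the stated time. -/
theorem exec_compile (c : Cmd) (hok : c.ok = true) (h0 : 0 ∉ c.natWrites) (L : ℕ) :
    ∀ σ : State, (∀ j, σ.nat 0 0 j ≤ L) →
      ∃ t ≤ c.cost L, Exec c.compile σ t (c.den σ) := by
  induction c with
  | skip => exact fun σ _ => ⟨1, le_rfl, Exec.skip σ⟩
  | setNat a i j e => exact fun σ _ => ⟨_, le_rfl, Exec.setNat a i j e σ⟩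
  | setReal a i j e => exact fun σ _ => ⟨_, le_rfl, Exec.setReal a i j e σ⟩
  | seq c d ihc ihd =>
    intro σ hσ
    simp only [ok, Bool.and_eq_true] at hok
    simp only [natWrites, List.mem_append, not_or] at h0
    obtain ⟨s, hs, hc⟩ := ihc hok.1 h0.1 σ hσ
    obtain ⟨t, ht, hd⟩ := ihd hok.2 h0.2 (c.den σ) (by rw [c.den_nat σ h0.1]; exact hσ)
    exact ⟨s + t, Nat.add_le_add hs ht, Exec.seq hc hd⟩
  | ite b c d ihc ihd =>
    intro σ hσ
    simp only [ok, Bool.and_eq_true] at hok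
    simp only [natWrites, List.mem_append, not_or] at h0
    simp only [cost, den]
    split_ifs with hb
    · obtain ⟨s, hs, hc⟩ := ihc hok.1 h0.1 σ hσ
      exact ⟨b.cost + s, by omega, Exec.iteTrue hb hc⟩
    · obtain ⟨s, hs, hd⟩ := ihd hok.2 h0.2 σ hσ
      exact ⟨b.cost + s, by omega, Exec.iteFalse hb hd⟩
  | loop a j c ih =>
    intro σ hσ
    simp only [ok, Bool.and_eq_true, decide_eq_true_eq] at hok
    simp only [natWrites, List.mem_cons, not_or] at h0
    let st : ℕ → State := fun i =>
      Nat.rec (σ.setNat a 0 0 0) (fun i τ => (c.den τ).setNat a 0 0 (i + 1)) i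
    have hst0 : ∀ i, (st i).nat 0 = σ.nat 0 := by
      intro i
      induction i with
      | zero => exact State.setNat_nat_of_ne σ h0.1 _ _ _
      | succ i ihi =>
        exact (State.setNat_nat_of_ne _ h0.1 _ _ _).trans ((c.den_nat _ h0.2).trans ihi)
    have hsta : ∀ i, (st i).nat a 0 0 = i := by
      intro i
      cases i <;> simp [st]
    set n := σ.nat 0 0 j with hn
    let b : Test := .natLt (.cell a (.lit 0) (.lit 0)) (.cell 0 (.lit 0) (.lit j))
    have hb : ∀ i, b.holds (st i) ↔ i < n := by
      intro i
      simp only [b, Test.holds, NatExp.eval, hst0, hsta, hn]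
    let p : Prog := .seq c.compile
      (.setNat a (.lit 0) (.lit 0) (.add (.cell a (.lit 0) (.lit 0)) (.lit 1)))
    have hw : ∀ m i, i + m = n →
        ∃ t ≤ 7 + m * (15 + c.cost L), Exec (.while b p) (st i) t (st n) := by
      intro m
      induction m with
      | zero =>
        intro i hi
        obtain rfl : i = n := by omega
        exact ⟨7, by omega, Exec.whileFalse (by rw [hb]; omega)⟩
      | succ m ihm =>
        intro i hi
        obtain ⟨t, ht, he⟩ := ihm (i + 1) (by omega)
        obtain ⟨s, hs, hc⟩ := ih hok.2 h0.2 (st i) (by rw [hst0]; exact hσ)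
        have hinc := Exec.setNat a (.lit 0) (.lit 0) (.add (.cell a (.lit 0) (.lit 0)) (.lit 1))
          (c.den (st i))
        have e : (c.den (st i)).setNat a ((NatExp.lit 0).eval (c.den (st i)))
            ((NatExp.lit 0).eval (c.den (st i)))
            ((NatExp.add (.cell a (.lit 0) (.lit 0)) (.lit 1)).eval (c.den (st i))) =
            st (i + 1) := by
          simp only [NatExp.eval, c.den_nat _ hok.1, hsta]
          rfl
        rw [e] at hinc
        refine ⟨_, ?_, Exec.whileTrue ((hb i).mpr (by omega)) (Exec.seq hc hinc) he⟩
        simp only [NatExp.cost, Test.cost, b]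
        rw [add_mul, one_mul]
        omega
    obtain ⟨t, ht, he⟩ := hw n 0 (by omega)
    have hinit := Exec.setNat a (.lit 0) (.lit 0) (.lit 0) σ
    refine ⟨_, ?_, Exec.seq hinit he⟩
    have := Nat.mul_le_mul_right (15 + c.cost L) (hσ j)
    rw [← hn] at this
    simp only [NatExp.cost, cost]
    omega

/-- The running time is polynomial in the parameters. -/
theorem exists_cost_le (c : Cmd) : ∃ p, ∀ L, 1 ≤ L → c.cost L ≤ p * L ^ p := by
  have hmono : ∀ {L p q r : ℕ}, 1 ≤ L → p ≤ q → p ≤ r → p * L ^ p ≤ q * L ^ r :=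
    fun hL h1 h2 => Nat.mul_le_mul h1 (Nat.pow_le_pow_right hL h2)
  have hconst : ∀ {L p : ℕ}, 1 ≤ L → p ≤ p * L ^ p := fun hL =>
    Nat.le_mul_of_pos_right _ (Nat.pow_pos hL)
  induction c with
  | skip => exact ⟨1, fun L hL => hconst hL⟩
  | setNat a i j e => exact ⟨_, fun L hL => hconst hL⟩
  | setReal a i j e => exact ⟨_, fun L hL => hconst hL⟩
  | seq c d ihc ihd =>
    obtain ⟨p, hp⟩ := ihc
    obtain ⟨q, hq⟩ := ihd
    refine ⟨p + q, fun L hL => ?_⟩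
    rw [add_mul]
    exact Nat.add_le_add ((hp L hL).trans (hmono hL le_rfl (by omega)))
      ((hq L hL).trans (hmono hL le_rfl (by omega)))
  | ite b c d ihc ihd =>
    obtain ⟨p, hp⟩ := ihc
    obtain ⟨q, hq⟩ := ihd
    refine ⟨b.cost + (p + q), fun L hL => ?_⟩
    rw [add_mul, add_mul]
    exact Nat.add_le_add (Nat.le_mul_of_pos_right _ (Nat.pow_pos hL))
      (Nat.add_le_add ((hp L hL).trans (hmono hL le_rfl (by omega)))
        ((hq L hL).trans (hmono hL le_rfl (by omega))))
  | loop a j c ih =>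
    obtain ⟨p, hp⟩ := ih
    refine ⟨26 + p, fun L hL => ?_⟩
    have h1 : 11 ≤ 11 * L ^ (26 + p) := Nat.le_mul_of_pos_right _ (Nat.pow_pos hL)
    have h2 : L * 15 ≤ 15 * L ^ (26 + p) := by
      rw [mul_comm]
      exact Nat.mul_le_mul_left _ (Nat.le_self_pow (by omega) L)
    have h3 : L * c.cost L ≤ p * L ^ (26 + p) := by
      calc L * c.cost L ≤ L * (p * L ^ p) := Nat.mul_le_mul_left _ (hp L hL)
        _ = p * L ^ (p + 1) := by ring
        _ ≤ _ := Nat.mul_le_mul_left _ (Nat.pow_le_pow_right hL (by omega))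
    calc 11 + L * (15 + c.cost L) = 11 + (L * 15 + L * c.cost L) := by ring
      _ ≤ 11 * L ^ (26 + p) + (15 * L ^ (26 + p) + p * L ^ (26 + p)) :=
        Nat.add_le_add h1 (Nat.add_le_add h2 h3)
      _ = _ := by ring

/-- Induction over the rounds of a counting loop. An invariant may refer to the arrays that the loop
does not write, whose contents are those of `σ`. -/
theorem loop_induction {a j : ℕ} {c : Cmd} {σ : State} (P : ℕ → State → Prop)
    (h0 : P 0 (σ.setNat a 0 0 0))
    (hs : ∀ i < σ.nat 0 0 j, ∀ τ, Frame (loop a j c) σ τ → τ.nat a 0 0 = i → P i τ →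
      P (i + 1) ((c.den τ).setNat a 0 0 (i + 1))) :
    P (σ.nat 0 0 j) ((loop a j c).den σ) := by
  simp only [den]
  have key : ∀ n ≤ σ.nat 0 0 j, ∀ τ,
      τ = Nat.rec (σ.setNat a 0 0 0) (fun i τ => (c.den τ).setNat a 0 0 (i + 1)) n →
      Frame (loop a j c) σ τ ∧ τ.nat a 0 0 = n ∧ P n τ := by
    intro n
    induction n with
    | zero =>
      rintro - τ rfl
      refine ⟨⟨fun b hb => State.setNat_nat_of_ne σ ?_ _ _ _, fun _ _ => rfl⟩, by simp, h0⟩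
      rintro rfl
      exact hb (by simp [natWrites])
    | succ n ih =>
      rintro hn τ rfl
      obtain ⟨hF, hi, hP⟩ := ih (by omega) _ rfl
      refine ⟨⟨fun b hb => ?_, fun b hb => ?_⟩, by simp, hs n (by omega) _ hF hi hP⟩
      · have hb' := hb
        simp only [natWrites, List.mem_cons, not_or] at hb'
        exact (State.setNat_nat_of_ne _ hb'.1 _ _ _).trans
          ((c.den_nat _ hb'.2).trans (hF.nat b hb))
      · exact (c.den_real _ hb).trans (hF.real b hb)
  exact (key _ le_rfl _ rfl).2.2

/-- The cell `(0, 0)` of a natural-number array. -/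
abbrev nv (a : ℕ) : NatExp := .cell a (.lit 0) (.lit 0)

/-- The cell `(0, 0)` of a real array. -/
abbrev rv (a : ℕ) : RealExp := .cell a (.lit 0) (.lit 0)

/-- Store the sum of `e` over a counting loop in the real array `r`; the expression `e` is evaluated
after running `c`. -/
def sumLoop (r a j : ℕ) (c : Cmd) (e : RealExp) : Cmd :=
  seq (setReal r (.lit 0) (.lit 0) (.ofNat (.lit 0)))
    (loop a j (seq c (setReal r (.lit 0) (.lit 0) (.add (rv r) e))))

/-- Store the product of `e` over a counting loop in the real array `r`; the expression `e` is
evaluated after running `c`. -/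
def prodLoop (r a j : ℕ) (c : Cmd) (e : RealExp) : Cmd :=
  seq (setReal r (.lit 0) (.lit 0) (.ofNat (.lit 1)))
    (loop a j (seq c (setReal r (.lit 0) (.lit 0) (.mul (rv r) e))))

/-- The value stored by a summation loop, given the value of `e` after each run of the body. -/
lemma den_sumLoop {r a j : ℕ} {c : Cmd} {e : RealExp} {σ : State} (hr : r ∉ c.realWrites)
    (g : ℕ → ℝ) (h : ∀ i < σ.nat 0 0 j, ∀ τ, Frame (sumLoop r a j c e) σ τ → τ.nat a 0 0 = i →
      e.eval (c.den τ) = g i) :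
    ((sumLoop r a j c e).den σ).real r 0 0 = ∑ i ∈ Finset.range (σ.nat 0 0 j), g i := by
  refine loop_induction (σ := σ.setReal r 0 0 ((0 : ℕ) : ℝ))
    (fun n τ => τ.real r 0 0 = ∑ i ∈ Finset.range n, g i) (by simp) fun i hi τ hF hτ hP => ?_
  have hF' : Frame (sumLoop r a j c e) σ τ := by
    constructor
    · intro b hb
      exact hF.nat b (by simpa [sumLoop, natWrites] using hb)
    · intro b hb
      simp only [sumLoop, realWrites, List.mem_append, not_or, List.mem_singleton] at hb
      rw [hF.real b (by simpa [realWrites] using hb.2), State.setReal_real_of_ne _ hb.1]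
  simp only [den, State.setNat_real, NatExp.eval, RealExp.eval, State.setReal_real_apply, and_self,
    if_true, c.den_real _ hr, hP, h i hi τ hF' hτ, Finset.sum_range_succ]

lemma den_prodLoop {r a j : ℕ} {c : Cmd} {e : RealExp} {σ : State} (hr : r ∉ c.realWrites)
    (g : ℕ → ℝ) (h : ∀ i < σ.nat 0 0 j, ∀ τ, Frame (prodLoop r a j c e) σ τ → τ.nat a 0 0 = i →
      e.eval (c.den τ) = g i) :
    ((prodLoop r a j c e).den σ).real r 0 0 = ∏ i ∈ Finset.range (σ.nat 0 0 j), g i := by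
  refine loop_induction (σ := σ.setReal r 0 0 ((1 : ℕ) : ℝ))
    (fun n τ => τ.real r 0 0 = ∏ i ∈ Finset.range n, g i) (by simp) fun i hi τ hF hτ hP => ?_
  have hF' : Frame (prodLoop r a j c e) σ τ := by
    constructor
    · intro b hb
      exact hF.nat b (by simpa [prodLoop, natWrites] using hb)
    · intro b hb
      simp only [prodLoop, realWrites, List.mem_append, not_or, List.mem_singleton] at hb
      rw [hF.real b (by simpa [realWrites] using hb.2), State.setReal_real_of_ne _ hb.1]
  simp only [den, State.setNat_real, NatExp.eval, RealExp.eval, State.setReal_real_apply, and_self,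
    if_true, c.den_real _ hr, hP, h i hi τ hF' hτ, Finset.prod_range_succ]

/-- Store in the real array `r` the inner product of two rows of the real arrays `A` and `B`; the
numbers of the rows are in the cells `(0, 0)` of the natural-number arrays `p` and `q`. -/
def dot (r A p B q : ℕ) : Cmd :=
  sumLoop r 16 0 skip (.mul (.cell A (nv p) (nv 16)) (.cell B (nv q) (nv 16)))

lemma den_dot {r A p B q : ℕ} {σ : State} (hA : A ≠ r) (hB : B ≠ r) (hp : p ≠ 16) (hq : q ≠ 16) :
    ((dot r A p B q).den σ).real r 0 0 =
      ∑ b ∈ Finset.range (σ.nat 0 0 0), σ.real A (σ.nat p 0 0) b * σ.real B (σ.nat q 0 0) b := by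
  refine den_sumLoop (by simp [realWrites]) _ fun i _ τ hF hτ => ?_
  simp only [den, RealExp.eval, NatExp.eval, hτ]
  rw [hF.real A (by simpa [sumLoop, realWrites] using hA),
    hF.real B (by simpa [sumLoop, realWrites] using hB),
    hF.nat p (by simpa [sumLoop, natWrites] using hp),
    hF.nat q (by simpa [sumLoop, natWrites] using hq)]

/-- Store in the real array `10` the value of the Hermite polynomial whose degree is in the
natural-number array `7`, at the point in the real array `12` and with variance in the real
array `13`. -/
def hermite : Cmd :=
  seq (setReal 10 (.lit 0) (.lit 0) (.ofNat (.lit 1)))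
    (seq (setReal 11 (.lit 0) (.lit 0) (.ofNat (.lit 1)))
      (loop 14 2 (ite (.natLt (nv 14) (nv 7))
        (seq (setReal 14 (.lit 0) (.lit 0)
            (.sub (.mul (rv 12) (rv 10)) (.mul (.mul (.ofNat (nv 14)) (rv 13)) (rv 11))))
          (seq (setReal 11 (.lit 0) (.lit 0) (rv 10)) (setReal 10 (.lit 0) (.lit 0) (rv 14))))
        skip)))

lemma den_hermite {σ : State} (hn : σ.nat 7 0 0 ≤ σ.nat 0 0 2) :
    (hermite.den σ).real 10 0 0 =
      He (σ.nat 7 0 0) (σ.real 12 0 0) (σ.real 13 0 0) := by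
  set n := σ.nat 7 0 0 with hndef
  set x := σ.real 12 0 0 with hx
  set s := σ.real 13 0 0 with hs
  have key := loop_induction (a := 14) (j := 2) (c := ite (.natLt (nv 14) (nv 7))
        (seq (setReal 14 (.lit 0) (.lit 0)
            (.sub (.mul (rv 12) (rv 10)) (.mul (.mul (.ofNat (nv 14)) (rv 13)) (rv 11))))
          (seq (setReal 11 (.lit 0) (.lit 0) (rv 10)) (setReal 10 (.lit 0) (.lit 0) (rv 14))))
        skip) (σ := (σ.setReal 10 0 0 ((1 : ℕ) : ℝ)).setReal 11 0 0 ((1 : ℕ) : ℝ))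
    (fun i τ => τ.real 10 0 0 = He (min i n) x s ∧ τ.real 11 0 0 = He (min i n - 1) x s) ?_ ?_
  · have h1 := key.1
    rw [show min (((σ.setReal 10 0 0 ((1 : ℕ) : ℝ)).setReal 11 0 0 ((1 : ℕ) : ℝ)).nat 0 0 2) n = n
      from min_eq_right hn] at h1
    exact h1
  · simp [State.setReal_real_of_ne, He]
  · rintro i - τ hF hτ ⟨h10, h11⟩
    have e7 : τ.nat 7 = σ.nat 7 := hF.nat 7 (by decide)
    have e12 : τ.real 12 = σ.real 12 := by
      rw [hF.real 12 (by decide)]; simp [State.setReal_real_of_ne]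
    have e13 : τ.real 13 = σ.real 13 := by
      rw [hF.real 13 (by decide)]; simp [State.setReal_real_of_ne]
    simp only [den, Test.holds, NatExp.eval, hτ, e7, ← hndef]
    split_ifs with h
    · rw [min_eq_left h.le] at h10 h11
      rw [min_eq_left (by omega : i + 1 ≤ n)]
      simp only [RealExp.eval, NatExp.eval, State.setNat_real, State.setReal_real_apply, and_self,
        if_true, ne_eq, Nat.reduceEqDiff, not_false_eq_true, State.setReal_real_of_ne,
        h10, h11, hτ, e12, e13, ← hx, ← hs, He_succ, Nat.add_sub_cancel]
    · rw [min_eq_right (by omega)] at h10 h11 ⊢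
      exact ⟨h10, h11⟩

end Cmd

end RealRAM

/-! ### Estimation of the coefficient vectors as a program

The natural-number arrays `1` to `7` hold the size of the first half of the sample, the truncation
degree, the last used position of the table of multi-indices, this table, the degrees of its
entries, the current pivot and a scratch degree; the arrays from `10` on are loop counters. The real
arrays `5` and `6` hold the residual vectors and the pivot vectors, the arrays from `10` on are
scratch cells. -/

namespace RealRAM

namespace Cmd

/-- Compute `⌈N / 2⌉`. -/
def halfCmd : Cmd :=
  loop 10 2 (ite (.natLt (.add (nv 1) (nv 1)) (.cell 0 (.lit 0) (.lit 2)))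
    (setNat 1 (.lit 0) (.lit 0) (.add (nv 1) (.lit 1))) skip)

lemma den_halfCmd {σ : State} (h : σ.nat 1 0 0 = 0) :
    (halfCmd.den σ).nat 1 0 0 = (σ.nat 0 0 2 + 1) / 2 := by
  have key := loop_induction (a := 10) (j := 2)
    (c := ite (.natLt (.add (nv 1) (nv 1)) (.cell 0 (.lit 0) (.lit 2)))
      (setNat 1 (.lit 0) (.lit 0) (.add (nv 1) (.lit 1))) skip) (σ := σ)
    (fun i τ => τ.nat 1 0 0 = min i ((σ.nat 0 0 2 + 1) / 2)) ?_ ?_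
  · refine Eq.trans key (min_eq_right ?_)
    omega
  · simp [State.setNat_nat_of_ne, h]
  · intro i hi τ hF hτ hP
    have e0 : τ.nat 0 = σ.nat 0 := hF.nat 0 (by decide)
    simp only [den, Test.holds, NatExp.eval, e0, hP]
    split_ifs with hlt
    · simp [State.setNat_nat_of_ne]
      omega
    · simp [State.setNat_nat_of_ne, hP]
      omega

/-- Compute the least `l` with `16 ≤ l * ε ^ 2`. -/
def truncCmd : Cmd :=
  loop 10 2 (ite (.realLt (.mul (.mul (.ofNat (nv 2)) (rv 0)) (rv 0)) (.ofNat (.lit 16)))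
    (setNat 2 (.lit 0) (.lit 0) (.add (nv 2) (.lit 1))) skip)

lemma den_truncCmd {σ : State} (h : σ.nat 2 0 0 = 0)
    (hN : 16 ≤ (σ.nat 0 0 2 : ℝ) * σ.real 0 0 0 * σ.real 0 0 0) :
    16 ≤ ((truncCmd.den σ).nat 2 0 0 : ℝ) * σ.real 0 0 0 * σ.real 0 0 0 ∧
      (((truncCmd.den σ).nat 2 0 0 : ℝ) - 1) * σ.real 0 0 0 * σ.real 0 0 0 < 16 := by
  have key := loop_induction (a := 10) (j := 2)
    (c := ite (.realLt (.mul (.mul (.ofNat (nv 2)) (rv 0)) (rv 0)) (.ofNat (.lit 16)))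
      (setNat 2 (.lit 0) (.lit 0) (.add (nv 2) (.lit 1))) skip) (σ := σ)
    (fun i τ => (τ.nat 2 0 0 = i ∨ 16 ≤ (τ.nat 2 0 0 : ℝ) * σ.real 0 0 0 * σ.real 0 0 0) ∧
      ((τ.nat 2 0 0 : ℝ) - 1) * σ.real 0 0 0 * σ.real 0 0 0 < 16) ?_ ?_
  · refine ⟨?_, key.2⟩
    rcases key.1 with h1 | h1
    · change (truncCmd.den σ).nat 2 0 0 = _ at h1
      rw [h1]; exact hN
    · exact h1
  · simp [State.setNat_nat_of_ne, h]
    nlinarith [mul_self_nonneg (σ.real 0 0 0)]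
  · rintro i hi τ hF hτ ⟨h1, h2⟩
    have e0 : τ.real 0 = σ.real 0 := hF.real 0 (by decide)
    simp only [den, Test.holds, RealExp.eval, NatExp.eval, e0]
    split_ifs with hlt
    · simp [State.setNat_nat_of_ne]
      refine ⟨?_, by push_cast at hlt; exact hlt⟩
      rcases h1 with h1 | h1
      · exact Or.inl h1
      · push_cast at hlt; linarith
    · simp [State.setNat_nat_of_ne]
      refine ⟨Or.inr ?_, h2⟩
      push_cast at hlt; linarith

/-- Copy the row of the parent in the table of multi-indices. -/
def tableCopy : Cmd := loop 12 0 (setNat 4 (nv 3) (nv 12) (.cell 4 (nv 10) (nv 12)))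

/-- Append one entry to the table of multi-indices. -/
def tableStep : Cmd :=
  seq (setNat 3 (.lit 0) (.lit 0) (.add (nv 3) (.lit 1)))
    (ite (.natLt (.cell 5 (nv 10) (.lit 0))
        (.add (.cell 0 (.lit 0) (.lit 1)) (.cell 0 (.lit 0) (.lit 1))))
      (seq tableCopy
        (seq (setNat 4 (nv 3) (nv 11) (.add (.cell 4 (nv 3) (nv 11)) (.lit 1)))
          (setNat 5 (nv 3) (.lit 0) (.add (.cell 5 (nv 10) (.lit 0)) (.lit 1)))))
      skip)

/-- Compute the table of multi-indices. -/
def tableCmd : Cmd := loop 10 2 (loop 11 0 tableStep)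

lemma den_tableCopy {σ : State} (h : σ.nat 10 0 0 ≠ σ.nat 3 0 0) (s b : ℕ) :
    (tableCopy.den σ).nat 4 s b = if s = σ.nat 3 0 0 ∧ b < σ.nat 0 0 0 then
      σ.nat 4 (σ.nat 10 0 0) b else σ.nat 4 s b := by
  refine loop_induction (a := 12) (j := 0)
    (c := setNat 4 (nv 3) (nv 12) (.cell 4 (nv 10) (nv 12))) (σ := σ)
    (fun i τ => ∀ s b, τ.nat 4 s b = if s = σ.nat 3 0 0 ∧ b < i then
      σ.nat 4 (σ.nat 10 0 0) b else σ.nat 4 s b) ?_ ?_ s b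
  · simp [State.setNat_nat_of_ne]
  · intro i hi τ hF hτ hP s b
    have e3 : τ.nat 3 = σ.nat 3 := hF.nat 3 (by decide)
    have e10 : τ.nat 10 = σ.nat 10 := hF.nat 10 (by decide)
    simp only [den, NatExp.eval, e3, e10, hτ, State.setNat_nat_apply, ne_eq, Nat.reduceEqDiff,
      not_false_eq_true, State.setNat_nat_of_ne, hP]
    by_cases hs : s = σ.nat 3 0 0
    · subst hs
      rcases lt_trichotomy b i with hb | rfl | hb
      · simp [hb, hb.ne, Nat.lt_succ_of_lt hb]
      · simp [h]
      · simp [hb.ne', hb.not_gt, show ¬ b < i + 1 by omega]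
    · simp [hs]

/-- The table of multi-indices is filled up to position `c`. -/
structure TableFilled (d m c : ℕ) (τ : State) : Prop where
  counter : τ.nat 3 0 0 = c
  degree : ∀ s ≤ c, τ.nat 5 s 0 = ∑ a ∈ Finset.range d, wordIndex d m s a
  entry : ∀ s ≤ c, ∀ b < d, τ.nat 4 s b = wordIndex d m s b
  degree_zero : ∀ s, c < s → τ.nat 5 s 0 = 0
  entry_zero : ∀ s, c < s → ∀ b, τ.nat 4 s b = 0

lemma TableFilled.setNat {d m c : ℕ} {τ : State} (h : TableFilled d m c τ) {a : ℕ} (h3 : 3 ≠ a)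
    (h4 : 4 ≠ a) (h5 : 5 ≠ a) (n : ℕ) : TableFilled d m c (τ.setNat a 0 0 n) := by
  constructor <;> simp only [State.setNat_nat_of_ne _ h3, State.setNat_nat_of_ne _ h4,
    State.setNat_nat_of_ne _ h5]
  exacts [h.counter, h.degree, h.entry, h.degree_zero, h.entry_zero]

lemma TableFilled.step {d m t a : ℕ} {τ : State} (h : TableFilled d m (t * d + a) τ)
    (h10 : τ.nat 10 0 0 = t) (h11 : τ.nat 11 0 0 = a) (ha : a < d) (hd : τ.nat 0 0 0 = d)
    (hm : τ.nat 0 0 1 + τ.nat 0 0 1 = m) : TableFilled d m (t * d + a + 1) (tableStep.den τ) := by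
  have htd : t ≤ t * d := Nat.le_mul_of_pos_right t (by omega)
  have hdeg : τ.nat 5 t 0 = ∑ a ∈ Finset.range d, wordIndex d m t a := h.degree t (by omega)
  simp only [tableStep, den, Test.holds, NatExp.eval, ne_eq, Nat.reduceEqDiff, not_false_eq_true,
    State.setNat_nat_of_ne, h10, h.counter, hm, hdeg]
  set σ := τ.setNat 3 0 0 (t * d + a + 1) with hσ
  split_ifs with hlt
  · have hcopy := den_tableCopy (σ := σ) (by simp [hσ, State.setNat_nat_of_ne, h10]; omega)
    simp only [hσ, State.setNat_nat_apply, and_self, if_true, ne_eq, Nat.reduceEqDiff,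
      not_false_eq_true, State.setNat_nat_of_ne, h10, hd] at hcopy
    rw [← hσ] at hcopy
    have e3 : (tableCopy.den σ).nat 3 0 0 = t * d + a + 1 := by
      rw [tableCopy.den_nat σ (by decide)]; simp [hσ]
    have e5 : (tableCopy.den σ).nat 5 = τ.nat 5 := by
      rw [tableCopy.den_nat σ (by decide)]; simp [hσ, State.setNat_nat_of_ne]
    have e10 : (tableCopy.den σ).nat 10 = τ.nat 10 := by
      rw [tableCopy.den_nat σ (by decide)]; simp [hσ, State.setNat_nat_of_ne]
    have e11 : (tableCopy.den σ).nat 11 = τ.nat 11 := by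
      rw [tableCopy.den_nat σ (by decide)]; simp [hσ, State.setNat_nat_of_ne]
    have hdegc : ∑ b ∈ Finset.range d, wordIndex d m (t * d + a + 1) b =
        ∑ b ∈ Finset.range d, wordIndex d m t b + 1 := by
      simp only [wordIndex_child d m t ha, if_pos hlt, Finset.sum_add_distrib,
        Finset.sum_ite_eq', Finset.mem_range, ha, if_true]
    constructor <;> simp only [ne_eq, Nat.reduceEqDiff, not_false_eq_true, State.setNat_nat_of_ne,
      State.setNat_nat_apply, e3, e5, e10, e11, h10, h11, hcopy, and_true, hdeg]
    · intro s hs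
      split_ifs with hsc
      · rw [hsc, hdegc]
      · exact h.degree s (by omega)
    · intro s hs b hb
      by_cases hsc : s = t * d + a + 1
      · subst hsc
        rw [wordIndex_child d m t ha, if_pos hlt, h.entry t (by omega) a ha,
          h.entry t (by omega) b hb]
        by_cases hba : b = a
        · simp [hba, ha]
        · simp [hba, hb]
      · simp only [hsc, false_and, if_false]
        exact h.entry s (by omega) b hb
    · intro s hs
      rw [if_neg (by omega)]
      exact h.degree_zero s (by omega)
    · intro s hs b
      rw [if_neg (by omega), if_neg (by omega)]
      exact h.entry_zero s (by omega) b
  · have hz : ∀ b, wordIndex d m (t * d + a + 1) b = 0 := by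
      intro b; rw [wordIndex_child d m t ha, if_neg hlt]
    constructor <;> simp only [hσ, ne_eq, Nat.reduceEqDiff, not_false_eq_true,
      State.setNat_nat_of_ne, State.setNat_nat_apply, and_self, if_true]
    · intro s hs
      rcases Nat.le_succ_iff.mp hs with h1 | rfl
      · exact h.degree s h1
      · rw [h.degree_zero _ (Nat.lt_succ_self _)]
        simp [hz]
    · intro s hs b hb
      rcases Nat.le_succ_iff.mp hs with h1 | rfl
      · exact h.entry s h1 b hb
      · rw [h.entry_zero _ (Nat.lt_succ_self _), hz]
    · exact fun s hs => h.degree_zero s (by omega)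
    · exact fun s hs => h.entry_zero s (by omega)

lemma den_tableCmd {σ : State} {d k N : ℕ} (hd : σ.nat 0 0 0 = d) (hk : σ.nat 0 0 1 = k)
    (hN : σ.nat 0 0 2 = N) (hd0 : 0 < d) (h3 : σ.nat 3 = fun _ _ => 0)
    (h4 : σ.nat 4 = fun _ _ => 0) (h5 : σ.nat 5 = fun _ _ => 0) :
    ∀ t < N, ∀ b < d, (tableCmd.den σ).nat 4 t b = wordIndex d (2 * k) t b := by
  have key := loop_induction (a := 10) (j := 2) (c := loop 11 0 tableStep) (σ := σ)
    (fun t τ => TableFilled d (2 * k) (t * d) τ) ?_ ?_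
  · rw [hN] at key
    intro t ht b hb
    exact key.entry t (ht.le.trans (Nat.le_mul_of_pos_right N hd0)) b hb
  · refine TableFilled.setNat ⟨?_, ?_, ?_, ?_, ?_⟩ (by decide) (by decide) (by decide) _ <;>
      simp [h3, h4, h5, wordIndex_zero]
  · intro t ht τ hF hτ hP
    have e0 : τ.nat 0 = σ.nat 0 := hF.nat 0 (by decide)
    have key2 := loop_induction (a := 11) (j := 0) (c := tableStep) (σ := τ)
      (fun a τ => TableFilled d (2 * k) (t * d + a) τ) (hP.setNat (by decide) (by decide)
        (by decide) _) ?_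
    · rw [e0, hd] at key2
      rw [add_mul, one_mul]
      exact key2.setNat (by decide) (by decide) (by decide) _
    · intro a ha υ hF2 hυ hP2
      have e02 : υ.nat 0 = σ.nat 0 := (hF2.nat 0 (by decide)).trans e0
      have e10 : υ.nat 10 = τ.nat 10 := hF2.nat 10 (by decide)
      rw [e0, hd] at ha
      exact (hP2.step (by rw [e10, hτ]) hυ ha (by rw [e02, hd]) (by rw [e02, hk]; ring)).setNat
        (by decide) (by decide) (by decide) _

/-- One factor of a Hermite function at a sample point. -/
def factorCmd : Cmd :=
  seq (setNat 7 (.lit 0) (.lit 0) (.cell 4 (nv 10) (nv 13)))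
    (seq (ite (.natLt (nv 13) (nv 11)) skip (ite (.natLt (nv 11) (nv 13)) skip
        (setNat 7 (.lit 0) (.lit 0) (.add (nv 7) (.lit 1)))))
      (seq (setReal 12 (.lit 0) (.lit 0) (.cell 1 (nv 12) (nv 13)))
        (seq (setReal 13 (.lit 0) (.lit 0) (.ofNat (.lit 1))) hermite)))

lemma den_factorCmd {σ : State}
    (h : σ.nat 4 (σ.nat 10 0 0) (σ.nat 13 0 0) + 1 ≤ σ.nat 0 0 2) :
    (factorCmd.den σ).real 10 0 0 = He (σ.nat 4 (σ.nat 10 0 0) (σ.nat 13 0 0) +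
      if σ.nat 13 0 0 = σ.nat 11 0 0 then 1 else 0) (σ.real 1 (σ.nat 12 0 0) (σ.nat 13 0 0)) 1 := by
  simp only [factorCmd, den, Test.holds, NatExp.eval, RealExp.eval]
  rw [den_hermite]
  · simp only [State.setReal_real_apply, and_self, if_true, ne_eq, Nat.reduceEqDiff,
      not_false_eq_true, State.setReal_real_of_ne, State.setReal_nat, Nat.cast_one]
    rcases lt_trichotomy (σ.nat 13 0 0) (σ.nat 11 0 0) with h1 | h1 | h1
    · simp [h1, h1.ne, State.setNat_nat_of_ne]
    · simp [h1, State.setNat_nat_of_ne]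
    · simp [h1, h1.ne', h1.not_gt, State.setNat_nat_of_ne]
  · simp only [State.setReal_nat, State.setNat_nat_of_ne, ne_eq, Nat.reduceEqDiff,
      not_false_eq_true]
    split_ifs <;> simp [State.setNat_nat_of_ne] <;> omega

/-- The contribution of a sample point to an estimated Hermite coefficient. -/
def termCmd : Cmd :=
  ite (.natLt (nv 12) (nv 1)) (prodLoop 16 13 0 factorCmd (rv 10))
    (setReal 16 (.lit 0) (.lit 0) (.ofNat (.lit 0)))

lemma den_termCmd {σ : State}
    (h : ∀ b < σ.nat 0 0 0, σ.nat 4 (σ.nat 10 0 0) b + 1 ≤ σ.nat 0 0 2) :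
    (termCmd.den σ).real 16 0 0 = if σ.nat 12 0 0 < σ.nat 1 0 0 then
      ∏ b ∈ Finset.range (σ.nat 0 0 0), He (σ.nat 4 (σ.nat 10 0 0) b +
        if b = σ.nat 11 0 0 then 1 else 0) (σ.real 1 (σ.nat 12 0 0) b) 1 else 0 := by
  by_cases hlt : σ.nat 12 0 0 < σ.nat 1 0 0
  · rw [if_pos hlt, termCmd, den_ite_pos (b := .natLt (nv 12) (nv 1)) hlt]
    refine den_prodLoop (r := 16) (c := factorCmd) (by decide) _ fun i hi τ hF hτ => ?_
    have e0 : τ.nat 0 = σ.nat 0 := hF.nat 0 (by decide)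
    have e4 : τ.nat 4 = σ.nat 4 := hF.nat 4 (by decide)
    have e10 : τ.nat 10 = σ.nat 10 := hF.nat 10 (by decide)
    have e11 : τ.nat 11 = σ.nat 11 := hF.nat 11 (by decide)
    have e12 : τ.nat 12 = σ.nat 12 := hF.nat 12 (by decide)
    have r1 : τ.real 1 = σ.real 1 := hF.real 1 (by decide)
    simp only [RealExp.eval, NatExp.eval]
    rw [den_factorCmd] <;> rw [e4, e10, hτ]
    · rw [e11, e12, r1]
    · rw [e0]; exact h i hi
  · rw [if_neg hlt, termCmd, den_ite_neg (b := .natLt (nv 12) (nv 1)) hlt]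
    simp [den, RealExp.eval, NatExp.eval]

/-- One entry of an estimated coefficient vector. -/
def entryCmd : Cmd :=
  seq (sumLoop 15 12 2 termCmd (.mul (.cell 2 (nv 12) (.lit 0)) (rv 16)))
    (setReal 5 (nv 10) (nv 11) (.div (rv 15) (.ofNat (nv 1))))

/-- Compute all the estimated coefficient vectors. -/
def rowsCmd : Cmd := loop 10 2 (loop 11 0 entryCmd)

/-- The value that the program `entryCmd` computes. -/
noncomputable def entryVal (σ : State) (t b : ℕ) : ℝ :=
  (∑ j ∈ Finset.range (σ.nat 0 0 2), σ.real 2 j 0 * if j < σ.nat 1 0 0 then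
      ∏ b' ∈ Finset.range (σ.nat 0 0 0), He (σ.nat 4 t b' + if b' = b then 1 else 0)
        (σ.real 1 j b') 1 else 0) / σ.nat 1 0 0

lemma den_entryCmd {σ : State}
    (h : ∀ b < σ.nat 0 0 0, σ.nat 4 (σ.nat 10 0 0) b + 1 ≤ σ.nat 0 0 2) (s c : ℕ) :
    (entryCmd.den σ).real 5 s c = if s = σ.nat 10 0 0 ∧ c = σ.nat 11 0 0 then
      entryVal σ (σ.nat 10 0 0) (σ.nat 11 0 0) else σ.real 5 s c := by
  have hs : ((sumLoop 15 12 2 termCmd (.mul (.cell 2 (nv 12) (.lit 0)) (rv 16))).den σ).real 15 0 0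
      = ∑ j ∈ Finset.range (σ.nat 0 0 2), σ.real 2 j 0 * if j < σ.nat 1 0 0 then
      ∏ b' ∈ Finset.range (σ.nat 0 0 0), He (σ.nat 4 (σ.nat 10 0 0) b' +
        if b' = σ.nat 11 0 0 then 1 else 0) (σ.real 1 j b') 1 else 0 := by
    refine den_sumLoop (by decide) _ fun i hi τ hF hτ => ?_
    have e0 : τ.nat 0 = σ.nat 0 := hF.nat 0 (by decide)
    have e1 : τ.nat 1 = σ.nat 1 := hF.nat 1 (by decide)
    have e4 : τ.nat 4 = σ.nat 4 := hF.nat 4 (by decide)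
    have e10 : τ.nat 10 = σ.nat 10 := hF.nat 10 (by decide)
    have e11 : τ.nat 11 = σ.nat 11 := hF.nat 11 (by decide)
    have r1 : τ.real 1 = σ.real 1 := hF.real 1 (by decide)
    have r2 : τ.real 2 = σ.real 2 := hF.real 2 (by decide)
    simp only [RealExp.eval, NatExp.eval]
    rw [den_termCmd (by rw [e0, e4, e10]; exact h), termCmd.den_real τ (by decide),
      termCmd.den_nat τ (by decide), e0, e1, e4, e10, e11, r1, r2, hτ]
  simp only [entryCmd, den, NatExp.eval, RealExp.eval, State.setReal_real_apply, hs]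
  rw [den_nat _ σ (by decide : 10 ∉ natWrites _), den_nat _ σ (by decide : 11 ∉ natWrites _),
    den_nat _ σ (by decide : 1 ∉ natWrites _), den_real _ σ (by decide : 5 ∉ realWrites _)]
  rfl

lemma den_rowsCmd {σ : State}
    (h : ∀ t < σ.nat 0 0 2, ∀ b < σ.nat 0 0 0, σ.nat 4 t b + 1 ≤ σ.nat 0 0 2) :
    ∀ t < σ.nat 0 0 2, ∀ b < σ.nat 0 0 0, (rowsCmd.den σ).real 5 t b = entryVal σ t b := by
  refine loop_induction (a := 10) (j := 2) (c := loop 11 0 entryCmd) (σ := σ)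
    (fun t τ => ∀ s < t, ∀ b < σ.nat 0 0 0, τ.real 5 s b = entryVal σ s b)
    (fun s hs => by omega) fun t ht τ hF hτ hP => ?_
  have e0 : τ.nat 0 = σ.nat 0 := hF.nat 0 (by decide)
  have key := loop_induction (a := 11) (j := 0) (c := entryCmd) (σ := τ)
    (fun b υ => (∀ s < t, ∀ b < σ.nat 0 0 0, υ.real 5 s b = entryVal σ s b) ∧
      ∀ c < b, υ.real 5 t c = entryVal σ t c) ⟨hP, fun c hc => by omega⟩ ?_
  · intro s hs b hb
    rw [State.setNat_real]
    rw [e0] at key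
    rcases Nat.lt_succ_iff_lt_or_eq.mp hs with h1 | rfl
    · exact key.1 s h1 b hb
    · exact key.2 b hb
  · rintro b hb υ hF2 hυ ⟨hP1, hP2⟩
    have e02 : υ.nat 0 = σ.nat 0 := (hF2.nat 0 (by decide)).trans e0
    have e1 : υ.nat 1 = σ.nat 1 := (hF2.nat 1 (by decide)).trans (hF.nat 1 (by decide))
    have e4 : υ.nat 4 = σ.nat 4 := (hF2.nat 4 (by decide)).trans (hF.nat 4 (by decide))
    have e10 : υ.nat 10 0 0 = t := by rw [hF2.nat 10 (by decide), hτ]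
    have r1 : υ.real 1 = σ.real 1 := (hF2.real 1 (by decide)).trans (hF.real 1 (by decide))
    have r2 : υ.real 2 = σ.real 2 := (hF2.real 2 (by decide)).trans (hF.real 2 (by decide))
    have hent := den_entryCmd (σ := υ) (by rw [e02, e4, e10]; exact h t ht)
    have hval : entryVal υ t b = entryVal σ t b := by
      simp only [entryVal, e02, e1, e4, r1, r2]
    simp only [State.setNat_real, hent, e10, hυ, hval]
    constructor
    · intro s hs c hc
      rw [if_neg (by omega)]
      exact hP1 s hs c hc
    · intro c hc
      by_cases hcb : c = b
      · simp [hcb]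
      · rw [if_neg (by tauto)]
        exact hP2 c (by omega)

end Cmd

end RealRAM

/-! ### Pivoted Gram-Schmidt as a program -/

/-- The coordinates of a vector, extended by zero. -/
noncomputable def coord {d : ℕ} (x : EuclideanSpace ℝ (Fin d)) (b : ℕ) : ℝ :=
  if h : b < d then x ⟨b, h⟩ else 0

lemma coord_fin {d : ℕ} (x : EuclideanSpace ℝ (Fin d)) (b : Fin d) : coord x b = x b :=
  dif_pos b.2

lemma sum_coord_mul {d : ℕ} (x y : EuclideanSpace ℝ (Fin d)) :
    ∑ b ∈ Finset.range d, coord x b * coord y b = inner ℝ x y := by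
  rw [← Fin.sum_univ_eq_sum_range (fun b => coord x b * coord y b)]
  simp [coord_fin, PiLp.inner_apply, mul_comm]

lemma coord_deflate {d : ℕ} (u : EuclideanSpace ℝ (Fin d)) (R : ℕ → EuclideanSpace ℝ (Fin d))
    (t b : ℕ) : coord (deflate u R t) b =
      coord (R t) b - inner ℝ (R t) u / inner ℝ u u * coord u b := by
  simp only [coord, deflate]
  split_ifs <;> simp

namespace RealRAM

/-- The row `t` of the real array `a` holds the vector `x`. -/
def State.Holds {d : ℕ} (σ : State) (a t : ℕ) (x : EuclideanSpace ℝ (Fin d)) : Prop :=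
  ∀ b < d, σ.real a t b = coord x b

namespace Cmd

lemma den_dot_eq_inner {d r A p B q : ℕ} {σ : State} (hd : σ.nat 0 0 0 = d)
    {x y : EuclideanSpace ℝ (Fin d)} (hx : σ.Holds A (σ.nat p 0 0) x)
    (hy : σ.Holds B (σ.nat q 0 0) y) (hA : A ≠ r) (hB : B ≠ r) (hp : p ≠ 16) (hq : q ≠ 16) :
    ((dot r A p B q).den σ).real r 0 0 = inner ℝ x y := by
  rw [den_dot hA hB hp hq, hd, ← sum_coord_mul]
  refine Finset.sum_congr rfl fun b hb => ?_
  rw [hx b (Finset.mem_range.mp hb), hy b (Finset.mem_range.mp hb)]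

/-- Compare the current residual vector with the longest one so far. -/
def pivotStep : Cmd :=
  seq (dot 17 5 10 5 10) (seq (dot 18 5 6 5 6)
    (ite (.realLt (rv 18) (rv 17)) (setNat 6 (.lit 0) (.lit 0) (nv 10)) skip))

/-- Find the longest residual vector. -/
def pivotCmd : Cmd := seq (setNat 6 (.lit 0) (.lit 0) (.lit 0)) (loop 10 2 pivotStep)

lemma den_pivotCmd {d : ℕ} {σ : State} (hd : σ.nat 0 0 0 = d)
    {R : ℕ → EuclideanSpace ℝ (Fin d)} (hR : ∀ t < σ.nat 0 0 2, σ.Holds 5 t (R t)) :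
    (pivotCmd.den σ).nat 6 0 0 = pivot R (σ.nat 0 0 2) := by
  refine loop_induction (a := 10) (j := 2) (c := pivotStep) (σ := σ.setNat 6 0 0 0)
    (fun n τ => τ.nat 6 0 0 = pivot R n) (by simp [State.setNat_nat_of_ne, pivot]) ?_
  intro i hi τ hF hτ hP
  rw [State.setNat_nat_of_ne _ (by decide)] at hi
  have e0 : τ.nat 0 = σ.nat 0 := by
    rw [hF.nat 0 (by decide)]; simp [State.setNat_nat_of_ne]
  have r5 : τ.real 5 = σ.real 5 := hF.real 5 (by decide)
  have hlt : pivot R i < σ.nat 0 0 2 := by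
    rcases Nat.eq_zero_or_pos i with rfl | h0
    · exact hi
    · exact (pivot_lt R h0).trans hi
  have hh : ∀ t < σ.nat 0 0 2, τ.Holds 5 t (R t) := by
    intro t ht b hb
    rw [r5]; exact hR t ht b hb
  have h17 : ((dot 17 5 10 5 10).den τ).real 17 0 0 = inner ℝ (R i) (R i) := by
    refine den_dot_eq_inner (by rw [e0, hd]) ?_ ?_ (by decide) (by decide) (by decide)
      (by decide) <;> rw [hτ] <;> exact hh i hi
  set υ := (dot 17 5 10 5 10).den τ with hυ
  have u0 : υ.nat 0 = σ.nat 0 := (den_nat _ _ (by decide)).trans e0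
  have u6 : υ.nat 6 0 0 = pivot R i := by rw [hυ, den_nat _ _ (by decide), hP]
  have u10 : υ.nat 10 0 0 = i := by rw [hυ, den_nat _ _ (by decide), hτ]
  have v5 : υ.real 5 = τ.real 5 := den_real _ _ (by decide)
  have h18 : ((dot 18 5 6 5 6).den υ).real 18 0 0 = inner ℝ (R (pivot R i)) (R (pivot R i)) := by
    refine den_dot_eq_inner (by rw [u0, hd]) ?_ ?_ (by decide) (by decide) (by decide)
      (by decide) <;> rw [u6] <;> intro b hb <;> rw [v5] <;> exact hh _ hlt b hb
  set ω := (dot 18 5 6 5 6).den υ with hω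
  have w17 : ω.real 17 0 0 = inner ℝ (R i) (R i) := by
    rw [hω, den_real _ _ (by decide), h17]
  have w6 : ω.nat 6 0 0 = pivot R i := by rw [hω, den_nat _ _ (by decide), u6]
  have w10 : ω.nat 10 0 0 = i := by rw [hω, den_nat _ _ (by decide), u10]
  simp only [pivotStep, den, ← hυ, ← hω, Test.holds, RealExp.eval, NatExp.eval, h18, w17, w10,
    pivot]
  split_ifs
  · simp [State.setNat_nat_of_ne]
  · simp [State.setNat_nat_of_ne, w6]

/-- Store the pivot vector. -/
def copyCmd : Cmd := loop 11 0 (setReal 6 (nv 15) (nv 11) (.cell 5 (nv 6) (nv 11)))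

lemma den_copyCmd (σ : State) (s c : ℕ) :
    (copyCmd.den σ).real 6 s c = if s = σ.nat 15 0 0 ∧ c < σ.nat 0 0 0 then
      σ.real 5 (σ.nat 6 0 0) c else σ.real 6 s c := by
  refine loop_induction (a := 11) (j := 0)
    (c := setReal 6 (nv 15) (nv 11) (.cell 5 (nv 6) (nv 11))) (σ := σ)
    (fun n τ => ∀ s c, τ.real 6 s c = if s = σ.nat 15 0 0 ∧ c < n then
      σ.real 5 (σ.nat 6 0 0) c else σ.real 6 s c) (by simp) ?_ s c
  intro i hi τ hF hτ hP s c
  have e6 : τ.nat 6 = σ.nat 6 := hF.nat 6 (by decide)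
  have e15 : τ.nat 15 = σ.nat 15 := hF.nat 15 (by decide)
  have r5 : τ.real 5 = σ.real 5 := hF.real 5 (by decide)
  simp only [den, NatExp.eval, RealExp.eval, State.setNat_real, State.setReal_real_apply, e6, e15,
    r5, hτ, hP]
  by_cases hs : s = σ.nat 15 0 0
  · rcases lt_trichotomy c i with h1 | rfl | h1
    · simp [hs, h1, h1.ne, Nat.lt_succ_of_lt h1]
    · simp [hs]
    · simp [hs, h1.ne', h1.not_gt, show ¬ c < i + 1 by omega]
  · simp [hs]

/-- Remove from one residual vector the component along the pivot vector. -/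
def deflateRow : Cmd :=
  seq (dot 20 5 10 6 15) (loop 11 0 (setReal 5 (nv 10) (nv 11)
    (.sub (.cell 5 (nv 10) (nv 11)) (.mul (.div (rv 20) (rv 19)) (.cell 6 (nv 15) (nv 11))))))

/-- Remove from all residual vectors the component along the pivot vector. -/
def deflateCmd : Cmd := loop 10 2 deflateRow

lemma den_deflateRow {d : ℕ} {σ : State} (hd : σ.nat 0 0 0 = d) {x u : EuclideanSpace ℝ (Fin d)}
    (hx : σ.Holds 5 (σ.nat 10 0 0) x) (hu : σ.Holds 6 (σ.nat 15 0 0) u) (s c : ℕ) (hc : c < d) :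
    (deflateRow.den σ).real 5 s c = if s = σ.nat 10 0 0 then
      coord x c - inner ℝ x u / σ.real 19 0 0 * coord u c else σ.real 5 s c := by
  have h20 := den_dot_eq_inner (r := 20) hd hx hu (by decide) (by decide) (by decide) (by decide)
  set υ := (dot 20 5 10 6 15).den σ with hυ
  have u0 : υ.nat 0 = σ.nat 0 := den_nat _ _ (by decide)
  have u10 : υ.nat 10 = σ.nat 10 := den_nat _ _ (by decide)
  have u15 : υ.nat 15 = σ.nat 15 := den_nat _ _ (by decide)
  have v5 : υ.real 5 = σ.real 5 := den_real _ _ (by decide)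
  have v6 : υ.real 6 = σ.real 6 := den_real _ _ (by decide)
  have v19 : υ.real 19 = σ.real 19 := den_real _ _ (by decide)
  have key := loop_induction (a := 11) (j := 0) (c := setReal 5 (nv 10) (nv 11)
      (.sub (.cell 5 (nv 10) (nv 11)) (.mul (.div (rv 20) (rv 19)) (.cell 6 (nv 15) (nv 11)))))
    (σ := υ) (fun n τ => ∀ s, ∀ c < d, τ.real 5 s c = if s = σ.nat 10 0 0 ∧ c < n then
      coord x c - inner ℝ x u / σ.real 19 0 0 * coord u c else σ.real 5 s c)
    (by simp [v5]) ?_ s c hc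
  · rw [u0, hd] at key
    simp only [hc, and_true] at key
    exact key
  · intro i hi τ hF hτ hP s c hc
    have e10 : τ.nat 10 = σ.nat 10 := (hF.nat 10 (by decide)).trans u10
    have e15 : τ.nat 15 = σ.nat 15 := (hF.nat 15 (by decide)).trans u15
    have r6 : τ.real 6 = σ.real 6 := (hF.real 6 (by decide)).trans v6
    have r19 : τ.real 19 = σ.real 19 := (hF.real 19 (by decide)).trans v19
    have r20 : τ.real 20 0 0 = inner ℝ x u := by rw [hF.real 20 (by decide), h20]
    rw [u0, hd] at hi
    simp only [den, NatExp.eval, RealExp.eval, State.setNat_real, State.setReal_real_apply, e10,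
      e15, r6, r19, r20, hτ, hP _ _ hi, hP _ _ hc]
    by_cases hs : s = σ.nat 10 0 0
    · rcases lt_trichotomy c i with h1 | rfl | h1
      · simp [hs, h1, h1.ne, Nat.lt_succ_of_lt h1]
      · simp [hs, hx c hc, hu c hc]
      · simp [hs, h1.ne', h1.not_gt, show ¬ c < i + 1 by omega]
    · simp [hs]

lemma den_deflateCmd {d : ℕ} {σ : State} (hd : σ.nat 0 0 0 = d)
    {R : ℕ → EuclideanSpace ℝ (Fin d)} (hR : ∀ t < σ.nat 0 0 2, σ.Holds 5 t (R t))
    {u : EuclideanSpace ℝ (Fin d)} (hu : σ.Holds 6 (σ.nat 15 0 0) u)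
    (huu : σ.real 19 0 0 = inner ℝ u u) :
    ∀ t < σ.nat 0 0 2, (deflateCmd.den σ).Holds 5 t (deflate u R t) := by
  have key := loop_induction (a := 10) (j := 2) (c := deflateRow) (σ := σ)
    (fun n τ => ∀ t < σ.nat 0 0 2, τ.Holds 5 t (if t < n then deflate u R t else R t))
    (fun t ht b hb => by simpa using hR t ht b hb) ?_
  · intro t ht b hb
    have h1 := key t ht b hb
    rw [if_pos ht] at h1
    exact h1
  · intro i hi τ hF hτ hP t ht b hb
    have e0 : τ.nat 0 = σ.nat 0 := hF.nat 0 (by decide)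
    have e15 : τ.nat 15 = σ.nat 15 := hF.nat 15 (by decide)
    have r6 : τ.real 6 = σ.real 6 := hF.real 6 (by decide)
    have r19 : τ.real 19 = σ.real 19 := hF.real 19 (by decide)
    have hx : τ.Holds 5 (τ.nat 10 0 0) (R i) := by
      rw [hτ]; simpa using hP i hi
    have hu' : τ.Holds 6 (τ.nat 15 0 0) u := by
      rw [e15]; intro b hb; rw [r6]; exact hu b hb
    rw [State.setNat_real, den_deflateRow (by rw [e0, hd]) hx hu' t b hb, hτ, r19, huu,
      ← coord_deflate]
    by_cases h : t = i
    · simp [h]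
    · rw [if_neg h, hP t ht b hb]
      have : t < i + 1 ↔ t < i := by omega
      simp only [this]

/-- One round of pivoted Gram-Schmidt. -/
def roundCmd : Cmd := seq pivotCmd (seq copyCmd (seq (dot 19 6 15 6 15) deflateCmd))

/-- Compute the pivot vectors. -/
def greedyCmd : Cmd := loop 15 1 roundCmd

lemma den_roundCmd {d : ℕ} {σ : State} (hd : σ.nat 0 0 0 = d) (hN : 0 < σ.nat 0 0 2)
    {R : ℕ → EuclideanSpace ℝ (Fin d)} (hR : ∀ t < σ.nat 0 0 2, σ.Holds 5 t (R t)) :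
    (∀ t < σ.nat 0 0 2, (roundCmd.den σ).Holds 5 t (deflate (R (pivot R (σ.nat 0 0 2))) R t)) ∧
      (roundCmd.den σ).Holds 6 (σ.nat 15 0 0) (R (pivot R (σ.nat 0 0 2))) ∧
      ∀ s ≠ σ.nat 15 0 0, (roundCmd.den σ).real 6 s = σ.real 6 s := by
  have hpiv := den_pivotCmd hd hR
  set τ := pivotCmd.den σ with hτ
  have e0 : τ.nat 0 = σ.nat 0 := den_nat _ _ (by decide)
  have e15 : τ.nat 15 = σ.nat 15 := den_nat _ _ (by decide)
  have r5 : τ.real 5 = σ.real 5 := den_real _ _ (by decide)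
  have r6 : τ.real 6 = σ.real 6 := den_real _ _ (by decide)
  have hcopy := den_copyCmd τ
  set υ := copyCmd.den τ with hυ
  have u0 : υ.nat 0 = σ.nat 0 := (den_nat _ _ (by decide)).trans e0
  have u15 : υ.nat 15 = σ.nat 15 := (den_nat _ _ (by decide)).trans e15
  have v5 : υ.real 5 = σ.real 5 := (den_real _ _ (by decide)).trans r5
  set u := R (pivot R (σ.nat 0 0 2)) with hu
  have hU : υ.Holds 6 (σ.nat 15 0 0) u := by
    intro b hb
    rw [hcopy, e15, e0, hd, if_pos ⟨rfl, hb⟩, hpiv, r5]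
    exact hR _ (pivot_lt R hN) b hb
  have hdot := den_dot_eq_inner (r := 19) (A := 6) (p := 15) (B := 6) (q := 15) (σ := υ)
    (by rw [u0, hd]) (by rw [u15]; exact hU) (by rw [u15]; exact hU) (by decide) (by decide)
    (by decide) (by decide)
  set ω := (dot 19 6 15 6 15).den υ with hω
  have w0 : ω.nat 0 = σ.nat 0 := (den_nat _ _ (by decide)).trans u0
  have w15 : ω.nat 15 = σ.nat 15 := (den_nat _ _ (by decide)).trans u15
  have x5 : ω.real 5 = σ.real 5 := (den_real _ _ (by decide)).trans v5
  have x6 : ω.real 6 = υ.real 6 := den_real _ _ (by decide)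
  have hdef := den_deflateCmd (σ := ω) (by rw [w0, hd]) (R := R)
    (by rw [w0]; intro t ht b hb; rw [x5]; exact hR t ht b hb) (u := u)
    (by rw [w15]; intro b hb; rw [x6]; exact hU b hb) hdot
  rw [w0] at hdef
  have hround : roundCmd.den σ = deflateCmd.den ω := rfl
  have h6 : (roundCmd.den σ).real 6 = υ.real 6 := by
    rw [hround, den_real _ _ (by decide), x6]
  refine ⟨by rw [hround]; exact hdef, fun b hb => by rw [h6]; exact hU b hb, fun s hs => ?_⟩
  rw [h6]
  funext c
  rw [hcopy, e15, if_neg (by tauto), r6]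

lemma den_greedyCmd {d : ℕ} {σ : State} (hd : σ.nat 0 0 0 = d) (hN : 0 < σ.nat 0 0 2)
    {R : ℕ → EuclideanSpace ℝ (Fin d)} (hR : ∀ t < σ.nat 0 0 2, σ.Holds 5 t (R t)) :
    ∀ r < σ.nat 0 0 1, (greedyCmd.den σ).Holds 6 r (pivotVec R (σ.nat 0 0 2) r) := by
  refine (loop_induction (a := 15) (j := 1) (c := roundCmd) (σ := σ)
    (fun r τ => (∀ t < σ.nat 0 0 2, τ.Holds 5 t (gsResidual R (σ.nat 0 0 2) r t)) ∧
      ∀ s < r, τ.Holds 6 s (pivotVec R (σ.nat 0 0 2) s)) ⟨hR, fun s hs => by omega⟩ ?_).2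
  rintro r hr τ hF hτ ⟨h1, h2⟩
  have e0 : τ.nat 0 = σ.nat 0 := hF.nat 0 (by decide)
  obtain ⟨g1, g2, g3⟩ := den_roundCmd (σ := τ) (by rw [e0, hd]) (by rw [e0]; exact hN)
    (R := gsResidual R (σ.nat 0 0 2) r) (by rw [e0]; exact h1)
  rw [e0] at g1 g2
  rw [hτ] at g2 g3
  refine ⟨g1, fun s hs b hb => ?_⟩
  rw [State.setNat_real]
  rcases Nat.lt_succ_iff_lt_or_eq.mp hs with h | rfl
  · rw [g3 s h.ne]
    exact h2 s h b hb
  · exact g2 b hb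

end Cmd

end RealRAM

/-! ### The two programs compute the estimator

In the prediction program the natural-number arrays `12`, `15` and `17` count the samples, the pivot
vectors and the degrees; the array `20` is never written, so that its first cell is the index `0` of
the row that holds the query point. -/

namespace RealRAM

namespace Cmd

/-- The learning program. -/
def learnCmd : Cmd := seq halfCmd (seq truncCmd (seq tableCmd (seq rowsCmd greedyCmd)))

/-- Add the term of one degree to a kernel factor. -/
def degreeStep : Cmd :=
  seq (setNat 7 (.lit 0) (.lit 0) (nv 17))
    (seq (setReal 12 (.lit 0) (.lit 0) (rv 23))
      (seq (setReal 13 (.lit 0) (.lit 0) (rv 22))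
        (seq hermite
          (seq (setReal 27 (.lit 0) (.lit 0) (rv 10))
            (seq (setReal 12 (.lit 0) (.lit 0) (rv 24))
              (seq hermite
                (seq (setReal 25 (.lit 0) (.lit 0)
                    (.add (rv 25) (.div (.mul (rv 27) (rv 10)) (rv 26))))
                  (setReal 26 (.lit 0) (.lit 0)
                    (.mul (.mul (rv 26) (rv 22)) (.ofNat (.add (nv 17) (.lit 1))))))))))))

/-- Compute one factor of the kernel. -/
def kernelCmd : Cmd :=
  seq (dot 22 6 15 6 15) (seq (dot 23 6 15 3 20) (seq (dot 24 6 15 1 12)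
    (seq (setReal 25 (.lit 0) (.lit 0) (.ofNat (.lit 0)))
      (seq (setReal 26 (.lit 0) (.lit 0) (.ofNat (.lit 1)))
        (loop 17 2 (ite (.natLt (nv 17) (.add (nv 2) (.lit 1))) degreeStep skip))))))

/-- The contribution of one sample point to the prediction. -/
def sampleCmd : Cmd :=
  ite (.natLt (nv 12) (nv 1)) (setReal 29 (.lit 0) (.lit 0) (.ofNat (.lit 0)))
    (prodLoop 29 15 1 kernelCmd (rv 25))

/-- The prediction program. -/
def predictCmd : Cmd :=
  seq (sumLoop 28 12 2 sampleCmd (.mul (.cell 2 (nv 12) (.lit 0)) (rv 29)))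
    (setReal 4 (.lit 0) (.lit 0)
      (.div (rv 28) (.ofNat (.sub (.cell 0 (.lit 0) (.lit 2)) (nv 1)))))

lemma den_degreeStep {σ : State} (h : σ.nat 17 0 0 ≤ σ.nat 0 0 2) :
    (degreeStep.den σ).real 25 0 0 = σ.real 25 0 0 +
      He (σ.nat 17 0 0) (σ.real 23 0 0) (σ.real 22 0 0) *
        He (σ.nat 17 0 0) (σ.real 24 0 0) (σ.real 22 0 0) / σ.real 26 0 0 ∧
    (degreeStep.den σ).real 26 0 0 =
      σ.real 26 0 0 * σ.real 22 0 0 * ((σ.nat 17 0 0 + 1 : ℕ) : ℝ) := by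
  set σ₁ := ((σ.setNat 7 0 0 (σ.nat 17 0 0)).setReal 12 0 0 (σ.real 23 0 0)).setReal 13 0 0
    (σ.real 22 0 0) with h1
  have hh1 := den_hermite (σ := σ₁) (by simpa [h1, State.setNat_nat_of_ne] using h)
  set σ₂ := ((hermite.den σ₁).setReal 27 0 0 ((hermite.den σ₁).real 10 0 0)).setReal 12 0 0
    ((hermite.den σ₁).real 24 0 0) with h2
  have n0 : (hermite.den σ₁).nat 0 = σ.nat 0 := by
    rw [den_nat _ _ (by decide)]; simp [h1, State.setNat_nat_of_ne]
  have n7 : (hermite.den σ₁).nat 7 0 0 = σ.nat 17 0 0 := by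
    rw [den_nat _ _ (by decide)]; simp [h1]
  have n17 : (hermite.den σ₁).nat 17 = σ.nat 17 := by
    rw [den_nat _ _ (by decide)]; simp [h1, State.setNat_nat_of_ne]
  have r13 : (hermite.den σ₁).real 13 0 0 = σ.real 22 0 0 := by
    rw [den_real _ _ (by decide)]; simp [h1]
  have hr : ∀ a, a ∉ hermite.realWrites → a ≠ 12 → a ≠ 13 →
      (hermite.den σ₁).real a = σ.real a := by
    intro a ha h12 h13
    rw [den_real _ _ ha]
    simp [h1, State.setReal_real_of_ne, h12, h13]
  have hh2 := den_hermite (σ := σ₂) (by simpa [h2, n0, n7] using h)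
  have hr2 : ∀ a, a ∉ hermite.realWrites → a ≠ 12 → a ≠ 13 → a ≠ 27 →
      (hermite.den σ₂).real a = σ.real a := by
    intro a ha h12 h13 h27
    rw [den_real _ _ ha, h2, State.setReal_real_of_ne _ h12, State.setReal_real_of_ne _ h27,
      hr a ha h12 h13]
  have r27 : (hermite.den σ₂).real 27 0 0 = (hermite.den σ₁).real 10 0 0 := by
    rw [den_real _ _ (by decide), h2]; simp [State.setReal_real_of_ne]
  have m17 : (hermite.den σ₂).nat 17 = σ.nat 17 := by
    rw [den_nat _ _ (by decide), h2]; simpa using n17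
  have hstep : degreeStep.den σ = ((hermite.den σ₂).setReal 25 0 0
      ((hermite.den σ₂).real 25 0 0 + (hermite.den σ₂).real 27 0 0 *
        (hermite.den σ₂).real 10 0 0 / (hermite.den σ₂).real 26 0 0)).setReal 26 0 0
      ((hermite.den σ₂).real 26 0 0 * (hermite.den σ₂).real 22 0 0 *
        ((hermite.den σ₂).nat 17 0 0 + 1 : ℕ)) := rfl
  have a7 : σ₁.nat 7 0 0 = σ.nat 17 0 0 := by simp [h1]
  have a12 : σ₁.real 12 0 0 = σ.real 23 0 0 := by simp [h1, State.setReal_real_of_ne]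
  have a13 : σ₁.real 13 0 0 = σ.real 22 0 0 := by simp [h1]
  have b7 : σ₂.nat 7 0 0 = σ.nat 17 0 0 := by simpa [h2] using n7
  have b12 : σ₂.real 12 0 0 = σ.real 24 0 0 := by
    simp [h2, hr 24 (by decide) (by decide) (by decide)]
  have b13 : σ₂.real 13 0 0 = σ.real 22 0 0 := by
    simp [h2, State.setReal_real_of_ne, r13]
  rw [a7, a12, a13] at hh1
  rw [b7, b12, b13] at hh2
  rw [hstep, m17, hr2 25 (by decide) (by decide) (by decide) (by decide),
    hr2 26 (by decide) (by decide) (by decide) (by decide),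
    hr2 22 (by decide) (by decide) (by decide) (by decide), r27, hh1, hh2]
  constructor
  · rw [State.setReal_real_of_ne _ (by decide)]; simp
  · simp

lemma den_kernelCmd {d : ℕ} {σ : State} (hd : σ.nat 0 0 0 = d) (hl : σ.nat 2 0 0 + 1 ≤ σ.nat 0 0 2)
    (h20 : σ.nat 20 0 0 = 0) {u x y : EuclideanSpace ℝ (Fin d)}
    (hu : σ.Holds 6 (σ.nat 15 0 0) u) (hx : σ.Holds 3 0 x) (hy : σ.Holds 1 (σ.nat 12 0 0) y) :
    (kernelCmd.den σ).real 25 0 0 = queryFactor (σ.nat 2 0 0) u x y := by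
  have c22 := den_dot_eq_inner (r := 22) hd hu hu (by decide) (by decide) (by decide) (by decide)
  set σ₁ := (dot 22 6 15 6 15).den σ with h1
  have hn1 : ∀ a, a ≠ 16 → σ₁.nat a = σ.nat a := fun a ha =>
    den_nat _ _ (by simp [dot, sumLoop, natWrites, ha])
  have hr1 : ∀ a, a ≠ 22 → σ₁.real a = σ.real a := fun a ha =>
    den_real _ _ (by simp [dot, sumLoop, realWrites, ha])
  have c23 := den_dot_eq_inner (σ := σ₁) (r := 23) (A := 6) (p := 15) (B := 3) (q := 20) (x := u)
    (y := x) (by rw [hn1 0 (by decide), hd])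
    (by rw [hn1 15 (by decide)]; intro b hb; rw [hr1 6 (by decide)]; exact hu b hb)
    (by rw [hn1 20 (by decide), h20]; intro b hb; rw [hr1 3 (by decide)]; exact hx b hb)
    (by decide) (by decide) (by decide) (by decide)
  set σ₂ := (dot 23 6 15 3 20).den σ₁ with h2
  have hn2 : ∀ a, a ≠ 16 → σ₂.nat a = σ.nat a := fun a ha =>
    (den_nat _ _ (by simp [dot, sumLoop, natWrites, ha])).trans (hn1 a ha)
  have hr2 : ∀ a, a ≠ 22 → a ≠ 23 → σ₂.real a = σ.real a := fun a ha ha' =>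
    (den_real _ _ (by simp [dot, sumLoop, realWrites, ha'])).trans (hr1 a ha)
  have c24 := den_dot_eq_inner (σ := σ₂) (r := 24) (A := 6) (p := 15) (B := 1) (q := 12) (x := u)
    (y := y) (by rw [hn2 0 (by decide), hd])
    (by rw [hn2 15 (by decide)]; intro b hb; rw [hr2 6 (by decide) (by decide)]; exact hu b hb)
    (by rw [hn2 12 (by decide)]; intro b hb; rw [hr2 1 (by decide) (by decide)]; exact hy b hb)
    (by decide) (by decide) (by decide) (by decide)
  set σ₃ := (dot 24 6 15 1 12).den σ₂ with h3
  have hn3 : ∀ a, a ≠ 16 → σ₃.nat a = σ.nat a := fun a ha =>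
    (den_nat _ _ (by simp [dot, sumLoop, natWrites, ha])).trans (hn2 a ha)
  have d22 : σ₃.real 22 0 0 = ‖u‖ ^ 2 := by
    rw [h3, den_real _ _ (by decide), h2, den_real _ _ (by decide), c22,
      real_inner_self_eq_norm_sq]
  have d23 : σ₃.real 23 0 0 = inner ℝ u x := by
    rw [h3, den_real _ _ (by decide), c23]
  set l := σ.nat 2 0 0 with hldef
  set s := ‖u‖ ^ 2 with hs
  have key := loop_induction (a := 17) (j := 2)
    (c := ite (.natLt (nv 17) (.add (nv 2) (.lit 1))) degreeStep skip)
    (σ := (σ₃.setReal 25 0 0 ((0 : ℕ) : ℝ)).setReal 26 0 0 ((1 : ℕ) : ℝ))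
    (fun i τ => τ.real 25 0 0 = ∑ n ∈ Finset.range (min i (l + 1)),
        He n (inner ℝ u x) s * He n (inner ℝ u y) s / (s ^ n * n.factorial) ∧
      τ.real 26 0 0 = s ^ min i (l + 1) * (min i (l + 1)).factorial) ?_ ?_
  · have e : ((σ₃.setReal 25 0 0 ((0 : ℕ) : ℝ)).setReal 26 0 0 ((1 : ℕ) : ℝ)).nat 0 0 2 =
        σ.nat 0 0 2 := by
      rw [State.setReal_nat, State.setReal_nat, hn3 0 (by decide)]
    have h4 := key.1
    rw [e, min_eq_right hl] at h4
    exact h4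
  · simp [State.setReal_real_of_ne]
  · rintro i hi τ hF hτ ⟨h25, h26⟩
    have e0 : τ.nat 0 = σ.nat 0 := (hF.nat 0 (by decide)).trans (hn3 0 (by decide))
    have e2 : τ.nat 2 = σ.nat 2 := (hF.nat 2 (by decide)).trans (hn3 2 (by decide))
    have r22 : τ.real 22 0 0 = s := by
      rw [hF.real 22 (by decide)]; simp [State.setReal_real_of_ne, d22]
    have r23 : τ.real 23 0 0 = inner ℝ u x := by
      rw [hF.real 23 (by decide)]; simp [State.setReal_real_of_ne, d23]
    have r24 : τ.real 24 0 0 = inner ℝ u y := by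
      rw [hF.real 24 (by decide)]; simp [State.setReal_real_of_ne, c24]
    have hiN : i ≤ σ.nat 0 0 2 := by
      rw [State.setReal_nat, State.setReal_nat, hn3 0 (by decide)] at hi
      exact hi.le
    by_cases hlt : i < l + 1
    · have htest : (Test.natLt (nv 17) (.add (nv 2) (.lit 1))).holds τ := by
        simp only [Test.holds, NatExp.eval, hτ, e2]
        exact hlt
      rw [den_ite_pos htest, State.setNat_real]
      obtain ⟨g1, g2⟩ := den_degreeStep (σ := τ) (by rw [hτ, e0]; exact hiN)
      rw [min_eq_left hlt.le] at h25 h26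
      rw [min_eq_left (by omega : i + 1 ≤ l + 1), g1, g2, h25, h26, hτ, r22, r23, r24]
      refine ⟨(Finset.sum_range_succ _ i).symm, ?_⟩
      rw [Nat.factorial_succ]
      push_cast
      ring
    · have htest : ¬ (Test.natLt (nv 17) (.add (nv 2) (.lit 1))).holds τ := by
        simp only [Test.holds, NatExp.eval, hτ, e2]
        exact hlt
      rw [den_ite_neg htest, State.setNat_real]
      rw [min_eq_right (by omega)] at h25 h26 ⊢
      exact ⟨h25, h26⟩

lemma den_predictCmd {d : ℕ} {σ : State} (hd : σ.nat 0 0 0 = d)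
    (hl : σ.nat 2 0 0 + 1 ≤ σ.nat 0 0 2) (h20 : σ.nat 20 0 0 = 0)
    {u X : ℕ → EuclideanSpace ℝ (Fin d)} {x : EuclideanSpace ℝ (Fin d)}
    (hu : ∀ r < σ.nat 0 0 1, σ.Holds 6 r (u r)) (hx : σ.Holds 3 0 x)
    (hX : ∀ j < σ.nat 0 0 2, σ.Holds 1 j (X j)) :
    (predictCmd.den σ).real 4 0 0 = (∑ j ∈ Finset.range (σ.nat 0 0 2), σ.real 2 j 0 *
      if j < σ.nat 1 0 0 then 0 else
        ∏ r ∈ Finset.range (σ.nat 0 0 1), queryFactor (σ.nat 2 0 0) (u r) x (X j)) /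
      ((σ.nat 0 0 2 - σ.nat 1 0 0 : ℕ) : ℝ) := by
  have hsum : ((sumLoop 28 12 2 sampleCmd (.mul (.cell 2 (nv 12) (.lit 0)) (rv 29))).den
      σ).real 28 0 0 = ∑ j ∈ Finset.range (σ.nat 0 0 2), σ.real 2 j 0 *
      if j < σ.nat 1 0 0 then 0 else
        ∏ r ∈ Finset.range (σ.nat 0 0 1), queryFactor (σ.nat 2 0 0) (u r) x (X j) := by
    refine den_sumLoop (r := 28) (c := sampleCmd) (by decide) _ fun j hj τ hF hτ => ?_
    have e0 : τ.nat 0 = σ.nat 0 := hF.nat 0 (by decide)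
    have e1 : τ.nat 1 = σ.nat 1 := hF.nat 1 (by decide)
    have e2 : τ.nat 2 = σ.nat 2 := hF.nat 2 (by decide)
    have e20 : τ.nat 20 = σ.nat 20 := hF.nat 20 (by decide)
    have r1 : τ.real 1 = σ.real 1 := hF.real 1 (by decide)
    have r2 : τ.real 2 = σ.real 2 := hF.real 2 (by decide)
    have r3 : τ.real 3 = σ.real 3 := hF.real 3 (by decide)
    have r6 : τ.real 6 = σ.real 6 := hF.real 6 (by decide)
    have h29 : (sampleCmd.den τ).real 29 0 0 = if j < σ.nat 1 0 0 then 0 else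
        ∏ r ∈ Finset.range (σ.nat 0 0 1), queryFactor (σ.nat 2 0 0) (u r) x (X j) := by
      by_cases hlt : j < σ.nat 1 0 0
      · have htest : (Test.natLt (nv 12) (nv 1)).holds τ := by
          simp only [Test.holds, NatExp.eval, hτ, e1]
          exact hlt
        rw [if_pos hlt, sampleCmd, den_ite_pos htest]
        simp [den, RealExp.eval, NatExp.eval]
      · have htest : ¬ (Test.natLt (nv 12) (nv 1)).holds τ := by
          simp only [Test.holds, NatExp.eval, hτ, e1]
          exact hlt
        rw [if_neg hlt, sampleCmd, den_ite_neg htest, ← e0]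
        refine den_prodLoop (r := 29) (c := kernelCmd) (by decide) _ fun r hr υ hG hυ => ?_
        rw [e0] at hr
        have f0 : υ.nat 0 = σ.nat 0 := (hG.nat 0 (by decide)).trans e0
        have f2 : υ.nat 2 = σ.nat 2 := (hG.nat 2 (by decide)).trans e2
        have f12 : υ.nat 12 0 0 = j := by rw [hG.nat 12 (by decide), hτ]
        have f20 : υ.nat 20 = σ.nat 20 := (hG.nat 20 (by decide)).trans e20
        have s1 : υ.real 1 = σ.real 1 := (hG.real 1 (by decide)).trans r1
        have s3 : υ.real 3 = σ.real 3 := (hG.real 3 (by decide)).trans r3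
        have s6 : υ.real 6 = σ.real 6 := (hG.real 6 (by decide)).trans r6
        simp only [RealExp.eval, NatExp.eval]
        rw [den_kernelCmd (u := u r) (x := x) (y := X j) (by rw [f0, hd]) (by rw [f0, f2]; exact hl)
          (by rw [f20, h20]) (by rw [hυ]; intro b hb; rw [s6]; exact hu r hr b hb)
          (fun b hb => by rw [s3]; exact hx b hb)
          (by rw [f12]; intro b hb; rw [s1]; exact hX j hj b hb), f2]
    simp only [RealExp.eval, NatExp.eval]
    rw [h29, sampleCmd.den_nat τ (by decide), sampleCmd.den_real τ (by decide), r2, hτ]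
  simp only [predictCmd, den, NatExp.eval, RealExp.eval, State.setReal_real_apply, and_self,
    if_true, hsum]
  rw [den_nat _ σ (by decide : 0 ∉ natWrites _), den_nat _ σ (by decide : 1 ∉ natWrites _)]

end Cmd

end RealRAM

/-- The truncation degree that the program finds by comparisons of reals, in closed form. -/
lemma eq_ceil_of_mul_mul {l : ℕ} {ε : ℝ} (hε : 0 < ε) (h1 : 16 ≤ (l : ℝ) * ε * ε)
    (h2 : ((l : ℝ) - 1) * ε * ε < 16) : l = ⌈16 / (ε * ε)⌉₊ := by
  have hl : l ≠ 0 := by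
    rintro rfl
    norm_num at h1
  symm
  rw [Nat.ceil_eq_iff hl, lt_div_iff₀ (by positivity), div_le_iff₀ (by positivity), ← mul_assoc,
    ← mul_assoc, Nat.cast_pred (Nat.pos_of_ne_zero hl)]
  exact ⟨h2, h1⟩

/-- A sequence indexed by `Fin N`, extended by zero. -/
noncomputable def extendSeq {E : Type*} [Zero E] {N : ℕ} (X : Fin N → E) (j : ℕ) : E :=
  if h : j < N then X ⟨j, h⟩ else 0

lemma extendSeq_fin {E : Type*} [Zero E] {N : ℕ} (X : Fin N → E) (j : Fin N) :
    extendSeq X j = X j := by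
  simp [extendSeq]

namespace RealRAM.Cmd

variable {d k N : ℕ} {ε : ℝ}

lemma input_holds (S : Fin N → EuclideanSpace ℝ (Fin d) × ℝ) (j : ℕ) :
    (Learner.input d k N ε S).Holds 1 j (extendSeq (fun i => (S i).1) j) := by
  intro b hb
  by_cases hj : j < N
  · simp [Learner.input, hj, hb, extendSeq, coord]
  · simp [Learner.input, hj, extendSeq, coord]

lemma input_label (S : Fin N → EuclideanSpace ℝ (Fin d) × ℝ) (j : Fin N) :
    (Learner.input d k N ε S).real 2 j 0 = (S j).2 := by
  simp [Learner.input]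

/-- The memory after learning: the hypothesis consists of the sample, the size of its first half,
the truncation degree and the pivot vectors. -/
lemma den_learnCmd (hd : 0 < d) (hk : 2 * k + 1 ≤ N) (hε : 0 < ε) (hN : 16 ≤ (N : ℝ) * ε * ε)
    (f : EuclideanSpace ℝ (Fin d) → ℝ) (X : Fin N → EuclideanSpace ℝ (Fin d)) {σ : State}
    (hσ : σ = Learner.input d k N ε fun j => (X j, f (X j))) :
    (learnCmd.den σ).nat 1 0 0 = (N + 1) / 2 ∧
    (learnCmd.den σ).nat 2 0 0 = ⌈16 / (ε * ε)⌉₊ ∧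
    ∀ r < k, (learnCmd.den σ).Holds 6 r (dirEst (2 * k) ((N + 1) / 2) f X r) := by
  have hz : ∀ a, a ≠ 0 → σ.nat a = fun _ _ => 0 := fun a ha => by
    subst hσ; funext i j; simp [Learner.input, ha]
  have s0 : σ.nat 0 0 0 = d := by subst hσ; simp [Learner.input]
  have s1 : σ.nat 0 0 1 = k := by subst hσ; simp [Learner.input]
  have s2 : σ.nat 0 0 2 = N := by subst hσ; simp [Learner.input]
  have sε : σ.real 0 0 0 = ε := by subst hσ; simp [Learner.input]
  have sX : ∀ j, σ.Holds 1 j (extendSeq X j) := fun j => by subst hσ; exact input_holds _ j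
  have sY : ∀ j : Fin N, σ.real 2 j 0 = f (X j) := fun j => by subst hσ; exact input_label _ j
  clear hσ
  obtain ⟨σ₁, e1⟩ : ∃ τ, τ = halfCmd.den σ := ⟨_, rfl⟩
  obtain ⟨σ₂, e2⟩ : ∃ τ, τ = truncCmd.den σ₁ := ⟨_, rfl⟩
  obtain ⟨σ₃, e3⟩ : ∃ τ, τ = tableCmd.den σ₂ := ⟨_, rfl⟩
  obtain ⟨σ₄, e4⟩ : ∃ τ, τ = rowsCmd.den σ₃ := ⟨_, rfl⟩
  obtain ⟨σ₅, e5⟩ : ∃ τ, τ = greedyCmd.den σ₄ := ⟨_, rfl⟩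
  have hL : learnCmd.den σ = σ₅ := by rw [e5, e4, e3, e2, e1]; rfl
  -- the half of the sample size
  have c1 : σ₁.nat 1 0 0 = (N + 1) / 2 := by
    rw [e1, den_halfCmd (by rw [hz 1 (by decide)]), s2]
  have n1 : ∀ a, a ∉ halfCmd.natWrites → σ₁.nat a = σ.nat a := fun a ha => by
    rw [e1, den_nat _ _ ha]
  have r1 : ∀ a, a ∉ halfCmd.realWrites → σ₁.real a = σ.real a := fun a ha => by
    rw [e1, den_real _ _ ha]
  -- the truncation degree
  have c2 : σ₂.nat 2 0 0 = ⌈16 / (ε * ε)⌉₊ := by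
    have := den_truncCmd (σ := σ₁) (by rw [n1 2 (by decide), hz 2 (by decide)])
      (by rw [n1 0 (by decide), r1 0 (by decide), s2, sε]; exact hN)
    rw [← e2, r1 0 (by decide), sε] at this
    exact eq_ceil_of_mul_mul hε this.1 this.2
  have n2 : ∀ a, a ∉ truncCmd.natWrites → σ₂.nat a = σ₁.nat a := fun a ha => by
    rw [e2, den_nat _ _ ha]
  have r2 : ∀ a, a ∉ truncCmd.realWrites → σ₂.real a = σ₁.real a := fun a ha => by
    rw [e2, den_real _ _ ha]
  -- the table of multi-indices
  have n20 : σ₂.nat 0 = σ.nat 0 := by rw [n2 0 (by decide), n1 0 (by decide)]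
  have c3 : ∀ t < N, ∀ b < d, σ₃.nat 4 t b = wordIndex d (2 * k) t b := by
    rw [e3]
    refine den_tableCmd (by rw [n20, s0]) (by rw [n20, s1]) (by rw [n20, s2]) hd ?_ ?_ ?_
    · rw [n2 3 (by decide), n1 3 (by decide), hz 3 (by decide)]
    · rw [n2 4 (by decide), n1 4 (by decide), hz 4 (by decide)]
    · rw [n2 5 (by decide), n1 5 (by decide), hz 5 (by decide)]
  have n3 : ∀ a, a ∉ tableCmd.natWrites → σ₃.nat a = σ₂.nat a := fun a ha => by
    rw [e3, den_nat _ _ ha]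
  have r3 : ∀ a, a ∉ tableCmd.realWrites → σ₃.real a = σ₂.real a := fun a ha => by
    rw [e3, den_real _ _ ha]
  -- the coefficient vectors
  have n30 : σ₃.nat 0 = σ.nat 0 := by rw [n3 0 (by decide), n20]
  have r31 : σ₃.real 1 = σ.real 1 := by
    rw [r3 1 (by decide), r2 1 (by decide), r1 1 (by decide)]
  have r32 : σ₃.real 2 = σ.real 2 := by
    rw [r3 2 (by decide), r2 2 (by decide), r1 2 (by decide)]
  have hentry : ∀ t < N, ∀ b < d,
      entryVal σ₃ t b = coord (rowEst (2 * k) ((N + 1) / 2) f X t) b := by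
    intro t ht b hb
    have hc : coord (rowEst (2 * k) ((N + 1) / 2) f X t) b =
        (rowEst (2 * k) ((N + 1) / 2) f X t) ⟨b, hb⟩ := coord_fin _ ⟨b, hb⟩
    rw [hc, entryVal, rowEst, n3 1 (by decide), n2 1 (by decide), c1, n30, s0, s2, r31, r32,
      div_eq_inv_mul, ← Fin.sum_univ_eq_sum_range (n := N)]
    refine congrArg _ ?_
    rw [Finset.sum_filter]
    refine Finset.sum_congr rfl fun j _ => ?_
    rw [sY]
    split_ifs with hj
    · refine congrArg _ ?_
      rw [hermiteFun, ← Fin.prod_univ_eq_prod_range (n := d)]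
      refine Finset.prod_congr rfl fun b' _ => ?_
      rw [c3 t ht b' b'.2, sX j b' b'.2, extendSeq_fin, coord_fin, EuclideanSpace.basisFun_inner]
      simp only [Fin.ext_iff]
    · rw [mul_zero]
  have c4 : ∀ t < N, σ₄.Holds 5 t (rowEst (2 * k) ((N + 1) / 2) f X t) := by
    intro t ht b hb
    rw [← hentry t ht b hb, e4]
    refine den_rowsCmd ?_ t (by rw [n30, s2]; exact ht) b (by rw [n30, s0]; exact hb)
    rw [n30, s0, s2]
    intro t ht b hb
    rw [c3 t ht b hb]
    have h1 := Finset.single_le_sum (f := fun a => wordIndex d (2 * k) t a)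
      (fun a _ => Nat.zero_le _) (Finset.mem_range.mpr hb)
    have h2 := sum_wordIndex_le hd (2 * k) t
    omega
  have n4 : ∀ a, a ∉ rowsCmd.natWrites → σ₄.nat a = σ₃.nat a := fun a ha => by
    rw [e4, den_nat _ _ ha]
  have n40 : σ₄.nat 0 = σ.nat 0 := by rw [n4 0 (by decide), n30]
  -- the directions
  have c5 : ∀ r < k, σ₅.Holds 6 r (dirEst (2 * k) ((N + 1) / 2) f X r) := by
    have := den_greedyCmd (σ := σ₄) (R := rowEst (2 * k) ((N + 1) / 2) f X) (by rw [n40, s0])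
      (by rw [n40, s2]; omega) (by rw [n40, s2]; exact c4)
    rw [n40, s1, s2, ← e5] at this
    exact this
  have n5 : ∀ a, a ∉ greedyCmd.natWrites → σ₅.nat a = σ₄.nat a := fun a ha => by
    rw [e5, den_nat _ _ ha]
  rw [hL]
  refine ⟨?_, ?_, c5⟩
  · rw [n5 1 (by decide), n4 1 (by decide), n3 1 (by decide), n2 1 (by decide), c1]
  · rw [n5 2 (by decide), n4 2 (by decide), n3 2 (by decide), c2]

lemma den_predictCmd_query (hd : 0 < d) (hk : 2 * k + 1 ≤ N) (hε : 0 < ε)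
    (hN : 16 ≤ (N : ℝ) * ε * ε) (hl : ⌈16 / (ε * ε)⌉₊ + 1 ≤ N)
    (f : EuclideanSpace ℝ (Fin d) → ℝ) (X : Fin N → EuclideanSpace ℝ (Fin d))
    (x : EuclideanSpace ℝ (Fin d)) :
    (predictCmd.den (Learner.query (learnCmd.den
      (Learner.input d k N ε fun j => (X j, f (X j)))) x)).real 4 0 0 =
      netEst k ⌈16 / (ε * ε)⌉₊ (2 * k) ((N + 1) / 2) f X x := by
  obtain ⟨σ, hσ⟩ : ∃ σ, σ = Learner.input d k N ε fun j => (X j, f (X j)) := ⟨_, rfl⟩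
  obtain ⟨c1, c2, c6⟩ := den_learnCmd hd hk hε hN f X hσ
  have s0 : σ.nat 0 0 0 = d := by subst hσ; simp [Learner.input]
  have s1 : σ.nat 0 0 1 = k := by subst hσ; simp [Learner.input]
  have s2 : σ.nat 0 0 2 = N := by subst hσ; simp [Learner.input]
  have s20 : σ.nat 20 0 0 = 0 := by subst hσ; simp [Learner.input]
  have sX : ∀ j, σ.Holds 1 j (extendSeq X j) := fun j => by subst hσ; exact input_holds _ j
  have sY : ∀ j : Fin N, σ.real 2 j 0 = f (X j) := fun j => by subst hσ; exact input_label _ j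
  rw [← hσ]
  clear hσ
  have n0 : (learnCmd.den σ).nat 0 = σ.nat 0 := den_nat _ _ (by decide)
  have n20 : (learnCmd.den σ).nat 20 = σ.nat 20 := den_nat _ _ (by decide)
  have r1 : (learnCmd.den σ).real 1 = σ.real 1 := den_real _ _ (by decide)
  have r2 : (learnCmd.den σ).real 2 = σ.real 2 := den_real _ _ (by decide)
  obtain ⟨τ, hτ⟩ : ∃ τ, τ = learnCmd.den σ := ⟨_, rfl⟩
  rw [← hτ] at c1 c2 c6 n0 n20 r1 r2 ⊢
  clear hτ
  obtain ⟨υ, hυ⟩ : ∃ υ, υ = Learner.query τ x := ⟨_, rfl⟩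
  have hn : υ.nat = τ.nat := by rw [hυ]; rfl
  have hr : ∀ a, a ≠ 3 → υ.real a = τ.real a := fun a ha => by
    subst hυ; funext i j; simp [Learner.query, ha]
  have hx : υ.Holds 3 0 x := fun b hb => by
    subst hυ; simp [Learner.query, hb, coord]
  rw [← hυ]
  clear hυ
  rw [den_predictCmd (σ := υ) (u := dirEst (2 * k) ((N + 1) / 2) f X) (X := extendSeq X) (x := x)
    (by rw [hn, n0, s0]) (by rw [hn, c2, n0, s2]; exact hl) (by rw [hn, n20, s20])
    (by rw [hn, n0, s1]; intro r hr' b hb; rw [hr 6 (by decide)]; exact c6 r hr' b hb) hx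
    (by intro j _ b hb; rw [hr 1 (by decide), r1]; exact sX j b hb)]
  rw [hn, n0, s1, s2, c1, c2, hr 2 (by decide), r2, netEst, div_eq_inv_mul,
    ← Fin.sum_univ_eq_sum_range (n := N), Finset.sum_filter]
  refine congrArg _ (Finset.sum_congr rfl fun j _ => ?_)
  rw [sY, extendSeq_fin]
  split_ifs with hj
  · rw [mul_zero]
  · rw [queryKernel, ← Fin.prod_univ_eq_prod_range (n := k)]

lemma input_nat_zero_le (hd : d ≤ N) (hk : k ≤ N) (S : Fin N → EuclideanSpace ℝ (Fin d) × ℝ)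
    (j : ℕ) : (Learner.input d k N ε S).nat 0 0 j ≤ N := by
  simp only [Learner.input, and_self, if_true]
  split_ifs <;> omega

end RealRAM.Cmd

open RealRAM RealRAM.Cmd in
/-- The two programs output the estimator in polynomial time, for every target function. -/
lemma outputs_netEst : ∃ p : ℕ, ∀ {d k N : ℕ} {ε : ℝ}, 0 < d → d ≤ N → 2 * k + 1 ≤ N → 0 < ε →
    16 ≤ (N : ℝ) * ε * ε → ⌈16 / (ε * ε)⌉₊ + 1 ≤ N →
    ∀ (f : EuclideanSpace ℝ (Fin d) → ℝ) (X : Fin N → EuclideanSpace ℝ (Fin d)),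
      Learner.Outputs ⟨learnCmd.compile, predictCmd.compile⟩ d k N ε (fun j => (X j, f (X j)))
        (p * N ^ p) (netEst k ⌈16 / (ε * ε)⌉₊ (2 * k) ((N + 1) / 2) f X) := by
  obtain ⟨p, hp⟩ := exists_cost_le learnCmd
  obtain ⟨q, hq⟩ := exists_cost_le predictCmd
  refine ⟨p + q, fun {d k N ε} hd hdN hk hε hN hl f X => ?_⟩
  have hN1 : 1 ≤ N := by omega
  have hmono : ∀ r ≤ p + q, r * N ^ r ≤ (p + q) * N ^ (p + q) := fun r hr =>
    Nat.mul_le_mul hr (Nat.pow_le_pow_right hN1 hr)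
  have hin := input_nat_zero_le (ε := ε) hdN (by omega : k ≤ N) fun j => (X j, f (X j))
  obtain ⟨t, ht, hexec⟩ := exec_compile learnCmd (by decide) (by decide) N _ hin
  refine ⟨_, t, ht.trans ((hp N hN1).trans (hmono p (by omega))), hexec, fun x => ?_⟩
  obtain ⟨s, hs, hexec'⟩ := exec_compile predictCmd (by decide) (by decide) N
    (Learner.query (learnCmd.den (Learner.input d k N ε fun j => (X j, f (X j)))) x) (by
      intro j
      change (learnCmd.den _).nat 0 0 j ≤ N
      rw [den_nat _ _ (by decide)]
      exact hin j)
  exact ⟨_, s, hs.trans ((hq N hN1).trans (hmono q (by omega))), hexec',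
    den_predictCmd_query hd hk hε hN hl f X x⟩

theorem theorem1 :
    ∃ C₀ : ℝ, 0 < C₀ ∧ ∃ ε₀ : ℝ, 0 < ε₀ ∧ ∀ C : ℝ, C₀ ≤ C →
      ∃ (A : Learner) (p : ℕ),
        ∀ (d k : ℕ), 0 < d → 0 < k → ∀ ε : ℝ, 0 < ε → ε ≤ ε₀ →
        ∀ N : ℕ, N = ⌈((d : ℝ) * (k : ℝ) / ε) ^ (C * (k : ℝ))⌉₊ →
        ∀ (w : Fin k → ℝ) (v : Fin k → EuclideanSpace ℝ (Fin d)),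
          ∑ i, |w i| ≤ 1 → (∀ i, ‖v i‖ = 1) →
          ∃ Ftilde : (Fin N → EuclideanSpace ℝ (Fin d)) → EuclideanSpace ℝ (Fin d) → ℝ,
            (∀ X : Fin N → EuclideanSpace ℝ (Fin d),
              A.Outputs d k N ε (fun j => (X j, reluNetwork w v (X j))) (p * N ^ p) (Ftilde X)) ∧
            Measure.pi (fun _ : Fin N => stdGaussian (EuclideanSpace ℝ (Fin d)))
              {X | ¬ (MemLp (fun x => Ftilde X x - reluNetwork w v x) 2
                        (stdGaussian (EuclideanSpace ℝ (Fin d))) ∧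
                      eLpNorm (fun x => Ftilde X x - reluNetwork w v x) 2
                        (stdGaussian (EuclideanSpace ℝ (Fin d))) ≤ ENNReal.ofReal ε)}
              ≤ 1 / 10 := by
  refine ⟨100, by norm_num, 1 / 2, by norm_num, fun C hC => ?_⟩
  obtain ⟨p, hp⟩ := outputs_netEst
  refine ⟨⟨RealRAM.Cmd.learnCmd.compile, RealRAM.Cmd.predictCmd.compile⟩, p,
    fun d k hd hk ε hε hε1 N hN w v hw hv => ?_⟩
  obtain ⟨hkN, hdN, hM, hNε, hacc⟩ := exists_accuracy hd hk hε hε1 hC hN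
  have hl1 : 16 ≤ (⌈16 / (ε * ε)⌉₊ : ℝ) * ε * ε := by
    rw [mul_assoc, ← div_le_iff₀ (by positivity)]
    exact Nat.le_ceil _
  have hl2 : ((⌈16 / (ε * ε)⌉₊ : ℝ) - 1) * ε * ε ≤ 16 := by
    rw [mul_assoc, ← le_div_iff₀ (by positivity), sub_le_iff_le_add]
    exact (Nat.ceil_lt_add_one (by positivity)).le
  obtain ⟨hh, hhN, hl, hlN, τ, hτ, h1, h2, h3⟩ := hacc _ _ rfl hl1 hl2
  exact ⟨fun X => netEst k ⌈16 / (ε * ε)⌉₊ (2 * k) ((N + 1) / 2) (reluNetwork w v) X,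
    fun X => hp hd hdN hkN hε hNε hlN (reluNetwork w v) X,
    measure_netEst_le hd hh hhN hl hw hv hτ hε hM h1 h2 h3⟩
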